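/- Let $N\ge 1$ and let $M(N)$ be the space of complex $N\times N$ matrices. Let $\rho=(A_{i,j})_{1\le i,j\le N}$ be a positive semidefinite $N^2\times N^2$ matrix with $N\times N$ blocks $A_{i,j}$, let $T:M(N)\to M(N)$, $T(X)=\sum_{i,j}X_{ij}A_{i,j}$, be the completely positive operator with Choi matrix $\rho$, let $T^*$ be its dual for $\langle X,Y\rangle=\operatorname{tr}(XY^\dagger)$, and view the image $\operatorname{Im}(\rho)\subset\mathbb C^N\otimes\mathbb C^N$ as a linear subspace of $M(N)$ (column by column). $T$ is rank non-decreasing if $\operatorname{rank}T(X)\ge\operatorname{rank}X$ for all $X\succeq0$. Assume that $\operatorname{Im}(\rho)$ has the Edmonds–Rado property: it contains a nonsingular matrix if and only if $T$ is rank non-decreasing. Put $DS(T)=\operatorname{tr}((T(I)-I)^2)+\operatorname{tr}((T^*(I)-I)^2)$. If $T(I)$ and $T^*(I)$ are nonsingular, Operator Sinkhorn Scaling is the sequence $T_0=T$, $T_{n+1}=R(T_n)$ for even $n$, $T_{n+1}=C(T_n)$ for odd $n$, where $R(T)(X)=T(I)^{-1/2}\,T(X)\,T(I)^{-1/2}$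 and $C(T)(X)=T\big(T^*(I)^{-1/2}XT^*(I)^{-1/2}\big)$. (A) There are absolute constants $C,K$ such that, if the entries of $\rho$ are integers of absolute value at most $\mathbf M$ ($\mathbf M\in\mathbb N$, with the convention $\ln 0=0$), the following holds. 1. If $\operatorname{Im}(\rho)$ contains a nonsingular matrix, then $T(I)$ and $T^*(I)$ are nonsingular and $DS(T_n)\le 1/N$ for some $n\le C\,N(N\ln N+N\ln\mathbf M)$. Conversely, if $T(I)$, $T^*(I)$ are nonsingular and $DS(T_n)\le 1/N$ for some $n$, then $\operatorname{Im}(\rho)$ contains a nonsingular matrix. 2. The scaling can be carried out in rational arithmetic: starting from $P=Q=I$, iteration $n$ computes $\operatorname{tr}((P\,T(Q)-I)^2)+\operatorname{tr}((Q\,T^*(P)-I)^2)$ and then replaces $P$ by $T(Q)^{-1}$ ($n$ even) or $Q$ by $T^*(P)^{-1}$ ($n$ odd), inverting by Gauss–Jordan elimination. If $T(I)$ and $T^*(I)$ are nonsingular, no iteration breaks down and the number computed in iteration $n$ is $DS(T_n)$. Besides one evaluation of $T$ and one of $T^*$, each iteration uses at most $KN^3$ rational operations; an evaluation of $T$ or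 $T^*$ from the $N^4$ entries of $\rho$ uses at most $KN^4$. 3. For every integer $L\ge C\,N(N\ln N+N\ln\mathbf M)$, the procedure that runs iterations $0,\dots,L$, accepts as soon as the computed number is at most $1/N$, and rejects if this does not happen or a matrix to be inverted is singular, accepts if and only if $\operatorname{Im}(\rho)$ contains a nonsingular matrix. It uses at most $(L+1)KN^4$ rational operations. (B) Consequently Edmonds' problem is solved in deterministic polynomial time under this promise: there is a deterministic algorithm (a random access machine program over the integers with logarithmic cost, i.e. every occurring value is charged its bit length) and a polynomial $p$ such that, for every $N\ge1$ and every positive semidefinite $\rho$ with rational entries whose image has the Edmonds–Rado property, the algorithm on input $(N,\rho)$ halts within time $p(s)$, where $s$ is $N$ plus the number of bits of the entries of $\rho$, with output $1$ if $\operatorname{Im}(\rho)$ contains a nonsingular matrix and $0$ otherwise. -/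

import Mathlib

open scoped ComplexOrder MatrixOrder
open Matrix

namespace OperatorScaling

/-! ## Completely positive operators, Choi matrices, operator Sinkhorn scaling -/

/-- The space `M(N)` of complex `N × N` matrices. -/
abbrev Mat (N : ℕ) := Matrix (Fin N) (Fin N) ℂ

/-- Linear operators `M(N) → M(N)`. -/
abbrev Op (N : ℕ) := Mat N →ₗ[ℂ] Mat N

/-- `N² × N²` matrices as `N × N` block matrices with `N × N` blocks:
`ρ (i₁, i₂) (j₁, j₂)` is the entry `(i₂, j₂)` of the block `(i₁, j₁)`. -/
abbrev Bipartite (N : ℕ) (R : Type) := Matrix (Fin N × Fin N) (Fin N × Fin N) R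

/-- The block `A_{i,j}` of a bipartite matrix. -/
def block {N : ℕ} {R : Type} (ρ : Bipartite N R) (i j : Fin N) : Matrix (Fin N) (Fin N) R :=
  Matrix.of fun a b => ρ (i, a) (j, b)

/-- Choi's representation: the block matrix whose `(i, j)` block is `T (e_i e_j†)`. -/
def choi {N : ℕ} (T : Op N) : Bipartite N ℂ :=
  Matrix.of fun p q => T (Matrix.single p.1 q.1 1) p.2 q.2

/-- The operator whose Choi matrix is `ρ`. -/
def opOfChoi {N : ℕ} (ρ : Bipartite N ℂ) : Op N where
  toFun X := ∑ i, ∑ j, X i j • block ρ i j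
  map_add' X Y := by simp [add_smul, Finset.sum_add_distrib]
  map_smul' c X := by simp [mul_smul, Finset.smul_sum]

theorem choi_opOfChoi {N : ℕ} (ρ : Bipartite N ℂ) : choi (opOfChoi ρ) = ρ := by
  ext ⟨i, a⟩ ⟨j, b⟩
  simp only [choi, opOfChoi, LinearMap.coe_mk, AddHom.coe_mk, Matrix.of_apply, Matrix.sum_apply,
    Matrix.smul_apply, smul_eq_mul, block, Matrix.single_apply]
  rw [Finset.sum_eq_single i (by intro x _ hx; simp [hx.symm]) (by simp),
    Finset.sum_eq_single j (by intro x _ hx; simp [hx.symm]) (by simp)]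
  simp

/-- The dual `T*` of `T` for the inner product `⟨X, Y⟩ = tr (X Y†)`. -/
def dual {N : ℕ} (T : Op N) : Op N where
  toFun Y := Matrix.of fun i j => (Y * (T (Matrix.single i j 1))ᴴ).trace
  map_add' X Y := by ext i j; simp [add_mul]
  map_smul' c X := by ext i j; simp

theorem trace_mul_dual {N : ℕ} (T : Op N) (X Y : Mat N) :
    (T X * Yᴴ).trace = (X * (dual T Y)ᴴ).trace := by
  have hX : T X = ∑ i, ∑ j, X i j • T (Matrix.single i j 1) := by
    conv_lhs => rw [Matrix.matrix_eq_sum_single X]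
    simp only [map_sum]
    refine Finset.sum_congr rfl fun i _ => Finset.sum_congr rfl fun j _ => ?_
    rw [← map_smul]
    simp
  have h2 : ∀ i j, star ((dual T Y) i j) = (T (Matrix.single i j 1) * Yᴴ).trace := by
    intro i j
    simp only [dual, LinearMap.coe_mk, AddHom.coe_mk, Matrix.of_apply]
    rw [← Matrix.trace_conjTranspose]
    simp
  rw [hX]
  simp only [Matrix.sum_mul, Matrix.trace_sum, Matrix.smul_mul, Matrix.trace_smul, smul_eq_mul]
  rw [Matrix.trace]
  simp only [Matrix.diag_apply, Matrix.mul_apply (N := (dual T Y)ᴴ), Matrix.conjTranspose_apply, h2]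

/-- Rank non-decreasing operators. -/
def RankNonDecreasing {N : ℕ} (T : Op N) : Prop :=
  ∀ X : Mat N, X.PosSemidef → X.rank ≤ (T X).rank

/-- `Im ρ ⊆ ℂ^N ⊗ ℂ^N`, seen as a linear subspace of `M(N)` through the column by column
correspondence `A ↦ vec A` between matrices and vectors. -/
def imageSpace {N : ℕ} (ρ : Bipartite N ℂ) : Submodule ℂ (Mat N) where
  carrier := {A | A.vec ∈ LinearMap.range ρ.mulVecLin}
  add_mem' {A B} hA hB := by
    have h := (LinearMap.range ρ.mulVecLin).add_mem hA hB
    rwa [← Matrix.vec_add] at h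
  zero_mem' := by
    have h := (LinearMap.range ρ.mulVecLin).zero_mem
    rwa [← Matrix.vec_zero] at h
  smul_mem' c A hA := by
    have h := (LinearMap.range ρ.mulVecLin).smul_mem c hA
    rwa [← Matrix.vec_smul] at h

/-- The question of Edmonds' problem: does the subspace contain a nonsingular matrix? -/
def HasNonsingular {N : ℕ} (V : Submodule ℂ (Mat N)) : Prop :=
  ∃ A ∈ V, IsUnit A.det

/-- The Edmonds–Rado property of `Im ρ`: it contains a nonsingular matrix if and only if the
completely positive operator with Choi matrix `ρ` is rank non-decreasing. -/
def EdmondsRado {N : ℕ} (ρ : Bipartite N ℂ) : Prop :=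
  HasNonsingular (imageSpace ρ) ↔ RankNonDecreasing (opOfChoi ρ)

/-- Operator scaling `X ↦ C₁ T(C₂† X C₂) C₁†`. -/
def scale {N : ℕ} (C₁ C₂ : Mat N) (T : Op N) : Op N where
  toFun X := C₁ * T (C₂ᴴ * X * C₂) * C₁ᴴ
  map_add' X Y := by simp [mul_add, add_mul]
  map_smul' c X := by simp

/-- `A^{-1/2}` for a positive definite matrix `A`. -/
noncomputable def invSqrt {N : ℕ} (A : Mat N) : Mat N := CFC.sqrt A⁻¹

/-- The row scaling `R(T)`. -/
noncomputable def rowScale {N : ℕ} (T : Op N) : Op N := scale (invSqrt (T 1)) 1 T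

/-- The column scaling `C(T)`. -/
noncomputable def colScale {N : ℕ} (T : Op N) : Op N := scale 1 (invSqrt (dual T 1)) T

/-- Operator Sinkhorn iterative scaling `… C R C R (T)`: the trajectory `T₀ = T, T₁ = R(T₀),
T₂ = C(T₁), …`. It is meaningful when `Scalable T` holds. -/
noncomputable def osi {N : ℕ} (T : Op N) : ℕ → Op N
  | 0 => T
  | n + 1 => if Even n then rowScale (osi T n) else colScale (osi T n)

/-- `T(I)` and `T*(I)` are nonsingular. -/
def Scalable {N : ℕ} (T : Op N) : Prop := IsUnit (T 1).det ∧ IsUnit (dual T 1).det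

/-- `DS(T) = tr((T(I) - I)²) + tr((T*(I) - I)²)`, which is a real number for positive `T`. -/
noncomputable def DS {N : ℕ} (T : Op N) : ℝ :=
  (((T 1 - 1) ^ 2).trace + ((dual T 1 - 1) ^ 2).trace).re

/-! ## The rational form of the algorithm, with a count of the rational operations

The computations below are built only from `rAdd`, `rSub`, `rMul`, `rDiv`, `rLe`, `rIsZero`, each
of which counts one operation; sums of `n` terms count `n` additions. -/

/-- A computed value together with the number of rational operations spent on it. -/
structure Counted (α : Type) where
  val : α
  ops : ℕ

namespace Counted

instance : Monad Counted where
  pure a := ⟨a, 0⟩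
  bind x f := ⟨(f x.val).val, x.ops + (f x.val).ops⟩

def rAdd (a b : ℚ) : Counted ℚ := ⟨a + b, 1⟩
def rSub (a b : ℚ) : Counted ℚ := ⟨a - b, 1⟩
def rMul (a b : ℚ) : Counted ℚ := ⟨a * b, 1⟩
def rDiv (a b : ℚ) : Counted ℚ := ⟨a / b, 1⟩
def rLe (a b : ℚ) : Counted Bool := ⟨decide (a ≤ b), 1⟩
def rIsZero (a : ℚ) : Counted Bool := ⟨decide (a = 0), 1⟩

/-- Summation of `n` computed terms. -/
def sum {n : ℕ} (f : Fin n → Counted ℚ) : Counted ℚ :=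
  ⟨∑ i, (f i).val, (∑ i, (f i).ops) + n⟩

/-- A matrix computed entry by entry. -/
def matrix {n : ℕ} (f : Fin n → Fin n → Counted ℚ) : Counted (Matrix (Fin n) (Fin n) ℚ) :=
  ⟨Matrix.of fun i j => (f i j).val, ∑ i, ∑ j, (f i j).ops⟩

end Counted

open Counted

/-- Product of two matrices. -/
def matMul {N : ℕ} (A B : Matrix (Fin N) (Fin N) ℚ) : Counted (Matrix (Fin N) (Fin N) ℚ) :=
  Counted.matrix fun i j => Counted.sum fun k => rMul (A i k) (B k j)

/-- One Gauss–Jordan exchange step with pivot `A k k`. -/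
def sweep {N : ℕ} (A : Matrix (Fin N) (Fin N) ℚ) (k : Fin N) :
    Counted (Matrix (Fin N) (Fin N) ℚ) :=
  Counted.matrix fun i j =>
    if i = k then
      if j = k then rDiv 1 (A k k)
      else do
        let x ← rDiv (A k j) (A k k)
        rSub 0 x
    else
      if j = k then rDiv (A i k) (A k k)
      else do
        let x ← rMul (A i k) (A k j)
        let y ← rDiv x (A k k)
        rSub (A i j) y

/-- Gauss–Jordan steps along a list of pivots; it gives up at a vanishing pivot. -/
def sweepAll {N : ℕ} : List (Fin N) → Matrix (Fin N) (Fin N) ℚ →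
    Counted (Option (Matrix (Fin N) (Fin N) ℚ))
  | [], A => pure (some A)
  | k :: ks, A => do
      let z ← rIsZero (A k k)
      if z then pure none
      else do
        let B ← sweep A k
        sweepAll ks B

/-- Inversion of a symmetric positive semidefinite matrix (no pivot search is needed); the result
is `none` for a singular one. -/
def invert {N : ℕ} (A : Matrix (Fin N) (Fin N) ℚ) : Counted (Option (Matrix (Fin N) (Fin N) ℚ)) :=
  sweepAll (List.finRange N) A

/-- Evaluation of `T(X)` from the entries of the Choi matrix `ρ` of `T`. -/
def applyOp {N : ℕ} (ρ : Bipartite N ℚ) (X : Matrix (Fin N) (Fin N) ℚ) :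
    Counted (Matrix (Fin N) (Fin N) ℚ) :=
  Counted.matrix fun a b => Counted.sum fun i => Counted.sum fun j => rMul (X i j) (ρ (i, a) (j, b))

/-- Evaluation of `T*(Y)` from the entries of the Choi matrix `ρ` of `T`. -/
def applyDual {N : ℕ} (ρ : Bipartite N ℚ) (Y : Matrix (Fin N) (Fin N) ℚ) :
    Counted (Matrix (Fin N) (Fin N) ℚ) :=
  Counted.matrix fun i j => Counted.sum fun a => Counted.sum fun b => rMul (Y a b) (ρ (i, a) (j, b))

/-- `tr((A B - I)²)`. -/
def defect {N : ℕ} (A B : Matrix (Fin N) (Fin N) ℚ) : Counted ℚ := do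
  let C ← matMul A B
  let D ← Counted.matrix fun i j => rSub (C i j) (if i = j then 1 else 0)
  Counted.sum fun i => Counted.sum fun j => rMul (D i j) (D j i)

/-- The algorithm stores `P = L†L` and `Q = R†R`, where `T_n(X) = L T(R† X R) L†`. -/
structure ScalingState (N : ℕ) where
  P : Matrix (Fin N) (Fin N) ℚ
  Q : Matrix (Fin N) (Fin N) ℚ

/-- Iteration number `n`: computes `DS(T_n)` and the next state, `P ← T(Q)⁻¹` for even `n`
and `Q ← T*(P)⁻¹` for odd `n` (`none` if the matrix to be inverted is singular). -/
def iteration {N : ℕ} (ρ : Bipartite N ℚ) (n : ℕ) (s : ScalingState N) :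
    Counted (ℚ × Option (ScalingState N)) := do
  let S ← applyOp ρ s.Q
  let S' ← applyDual ρ s.P
  let d ← defect s.P S
  let d' ← defect s.Q S'
  let ds ← rAdd d d'
  if n % 2 = 0 then do
    let P' ← invert S
    pure (ds, P'.map fun P => ⟨P, s.Q⟩)
  else do
    let Q' ← invert S'
    pure (ds, Q'.map fun Q => ⟨s.P, Q⟩)

/-- The state of the algorithm before iteration `n`. -/
def stateAt {N : ℕ} (ρ : Bipartite N ℚ) : ℕ → Option (ScalingState N)
  | 0 => some ⟨1, 1⟩
  | n + 1 => (stateAt ρ n).bind fun s => (iteration ρ n s).val.2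

/-- Run at most `fuel` iterations from iteration `n` on; accept as soon as `DS(T_n) ≤ 1/N`. -/
def search {N : ℕ} (ρ : Bipartite N ℚ) : ℕ → ℕ → ScalingState N → Counted Bool
  | 0, _, _ => pure false
  | fuel + 1, n, s => do
      let r ← iteration ρ n s
      let ε ← rDiv 1 (N : ℚ)
      let done ← rLe r.1 ε
      if done then pure true
      else match r.2 with
        | none => pure false
        | some s' => search ρ fuel (n + 1) s'

/-- The decision procedure: accept iff one of `T_0, …, T_L` satisfies `DS ≤ 1/N`. -/
def decideEdmonds {N : ℕ} (ρ : Bipartite N ℚ) (L : ℕ) : Counted Bool :=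
  search ρ (L + 1) 0 ⟨1, 1⟩

/-! ## Deterministic polynomial time

A random access machine in the form of while-programs over arrays of integers, with the
logarithmic cost criterion: every value that occurs, addresses included, is charged its bit
length. Up to polynomial factors this is the running time of a Turing machine. -/

/-- Bit length of an integer, with one bit for the sign. -/
def bitLength (z : ℤ) : ℕ := z.natAbs.size + 1

/-- Finitely many of the arrays occur in a program; array `a` has the cells `m a i`, `i : ℤ`. -/
abbrev Memory := ℕ → ℤ → ℤ

inductive Expr : Type
  | const (z : ℤ)
  | load (a : ℕ) (address : Expr)
  | add (e f : Expr)
  | sub (e f : Expr)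
  | mul (e f : Expr)
  | div (e f : Expr)

namespace Expr

def eval (m : Memory) : Expr → ℤ
  | const z => z
  | load a e => m a (e.eval m)
  | add e f => e.eval m + f.eval m
  | sub e f => e.eval m - f.eval m
  | mul e f => e.eval m * f.eval m
  | div e f => e.eval m / f.eval m

/-- The sum of the bit lengths of the values of all subexpressions. -/
def cost (m : Memory) : Expr → ℕ
  | const z => bitLength z
  | load a e => e.cost m + bitLength (m a (e.eval m))
  | add e f => e.cost m + f.cost m + bitLength (e.eval m + f.eval m)
  | sub e f => e.cost m + f.cost m + bitLength (e.eval m - f.eval m)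
  | mul e f => e.cost m + f.cost m + bitLength (e.eval m * f.eval m)
  | div e f => e.cost m + f.cost m + bitLength (e.eval m / f.eval m)

end Expr

inductive Prog : Type
  | skip
  | store (a : ℕ) (address value : Expr)
  | seq (p q : Prog)
  | ifPos (e : Expr) (p q : Prog)
  | whilePos (e : Expr) (p : Prog)

/-- `Run p m m' t`: started in memory `m`, the program `p` halts in memory `m'` at cost `t`. -/
inductive Run : Prog → Memory → Memory → ℕ → Prop
  | skip (m : Memory) : Run .skip m m 1
  | store (a : ℕ) (e f : Expr) (m : Memory) :
      Run (.store a e f) m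
        (Function.update m a (Function.update (m a) (e.eval m) (f.eval m)))
        (e.cost m + f.cost m + 1)
  | seq {p q : Prog} {m m' m'' : Memory} {t t' : ℕ} :
      Run p m m' t → Run q m' m'' t' → Run (.seq p q) m m'' (t + t' + 1)
  | ifTrue {e : Expr} {p q : Prog} {m m' : Memory} {t : ℕ} :
      0 < e.eval m → Run p m m' t → Run (.ifPos e p q) m m' (e.cost m + t + 1)
  | ifFalse {e : Expr} {p q : Prog} {m m' : Memory} {t : ℕ} :
      e.eval m ≤ 0 → Run q m m' t → Run (.ifPos e p q) m m' (e.cost m + t + 1)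
  | whileTrue {e : Expr} {p : Prog} {m m' m'' : Memory} {t t' : ℕ} :
      0 < e.eval m → Run p m m' t → Run (.whilePos e p) m' m'' t' →
      Run (.whilePos e p) m m'' (e.cost m + t + t' + 1)
  | whileFalse {e : Expr} {p : Prog} {m : Memory} :
      e.eval m ≤ 0 → Run (.whilePos e p) m m (e.cost m + 1)

/-- The address of the entry `(p, q)` of a bipartite matrix that is stored row by row. -/
def entryAddress {N : ℕ} (p q : Fin N × Fin N) : ℤ :=
  ((p.1 * N + p.2) * N + q.1) * N + q.2

/-- The input: `N` in cell `0` of array `0`, the numerators and the denominators of the entries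
of `ρ` in the arrays `1` and `2`; all other cells are `0`. -/
def inputMemory {N : ℕ} (ρ : Bipartite N ℚ) : Memory := fun a z =>
  if a = 0 then (if z = 0 then (N : ℤ) else 0)
  else if a = 1 then ∑ p, ∑ q, if z = entryAddress p q then (ρ p q).num else 0
  else if a = 2 then ∑ p, ∑ q, if z = entryAddress p q then ((ρ p q).den : ℤ) else 0
  else 0

/-- The size of the input: `N` plus the number of bits of the rational entries of `ρ`. -/
def inputSize {N : ℕ} (ρ : Bipartite N ℚ) : ℕ :=
  N + ∑ p, ∑ q, (bitLength (ρ p q).num + bitLength (ρ p q).den)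

end OperatorScaling

open OperatorScaling

/-! A scaled operator X ↦ L T(R†XR) L† is recorded by P = L†L and Q = R†R. Its `DS` equals tr((P
T(Q) - 1)²) + tr((Q T*(P) - 1)²) (`DS_scale`), so neither square roots nor L and R themselves are
needed. Everything is governed by the potential f(P,Q) = tr(P T(Q)) - log det P - log det Q on
positive definite pairs. Row and column normalisation are its exact partial minimisations P = T(Q)⁻¹
and Q = T*(P)⁻¹.

Soundness (`rankNonDecreasing_of_DS_le`): suppose rank T(X) < rank X, and let E and F be the support
projections of X and T(X). Then T(E) lives on F, so tr(E T*(1)) = tr(T(E)) ≤ tr(F T(1)) although tr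
E ≥ tr F + 1. Hence T(1) and T*(1) cannot both be close to 1, and `DS` exceeds 1/N. The Edmonds–Rado
property turns rank non-decrease into a nonsingular matrix.

Completeness: if the image of an integral ρ contains a nonsingular matrix, it also contains an
integral A with small coefficients and |det A| ≥ 1. Up to a factor M N⁶, ρ dominates the rank-one
Choi matrix of X ↦ AXA† (`exists_dominated_kraus`). Monotonicity of log det gives log det T(X) ≥ log
det X - N log(M N⁶), which bounds f from below (`le_potential`). A Sinkhorn step lowers f by at
least 1/(6N) as long as `DS` > 1/N (`logDet_add_logDet_le`, `potential_le`). The quotient of the two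
bounds is the iteration count (`exists_iteration_le`).

For polynomial time in the bit model the numbers must stay short. The program therefore runs natural
gradient descent on the same f with integral matrices at a fixed scale (`gradient_step`,
`gradStep_spec`). Rounding is compensated by adding a multiple of the identity, which can only
increase log det. Each step still lowers f by 1/(32N²), and the matrices at most double in size
(`descend_spec`), so polynomially many steps on words of polynomial length suffice. The rest
verifies, by rules for loops over a memory of bounded words, that a concrete program performs this
descent at polynomial cost. -/

namespace OperatorScaling

variable {N : ℕ} {n : Type*} [Fintype n] [DecidableEq n]

/-! ### Positive matrices, log det inequalities and the gradient step. -/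

theorem exists_unitary_diagonal {B : Matrix n n ℂ} (hB : B.IsHermitian) :
    ∃ (V : Matrix n n ℂ) (b : n → ℝ), Vᴴ * V = 1 ∧ V * Vᴴ = 1 ∧
      B = V * diagonal (fun i => (b i : ℂ)) * Vᴴ := by
  refine ⟨hB.eigenvectorUnitary, hB.eigenvalues, ?_, ?_, ?_⟩
  · exact Unitary.coe_star_mul_self hB.eigenvectorUnitary
  · exact Unitary.coe_mul_star_self hB.eigenvectorUnitary
  · conv_lhs => rw [hB.spectral_theorem]
    rfl

theorem trace_conj_unitary {V : Matrix n n ℂ} (hV : Vᴴ * V = 1) (A : Matrix n n ℂ) :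
    (V * A * Vᴴ).trace = A.trace := by
  rw [Matrix.trace_mul_comm, ← Matrix.mul_assoc, hV, Matrix.one_mul]

theorem posSemidef_conj_unitary_iff {V : Matrix n n ℂ} (hV : Vᴴ * V = 1) (A : Matrix n n ℂ) :
    (V * A * Vᴴ).PosSemidef ↔ A.PosSemidef := by
  constructor
  · intro h
    have := h.conjTranspose_mul_mul_same V
    rwa [show Vᴴ * (V * A * Vᴴ) * V = (Vᴴ * V) * A * (Vᴴ * V) by simp only [Matrix.mul_assoc], hV,
      Matrix.one_mul, Matrix.mul_one] at this
  · intro h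
    exact h.mul_mul_conjTranspose_same V

theorem exists_conjTranspose_mul_self {P : Matrix n n ℂ} (hP : P.PosSemidef) : ∃ L : Matrix n n ℂ,
    P = Lᴴ * L := by
  obtain ⟨L, hL⟩ := CStarAlgebra.nonneg_iff_eq_star_mul_self.mp (Matrix.nonneg_iff_posSemidef.mpr hP)
  exact ⟨L, hL⟩

/-- The eigenvalues are nonnegative, so each is at most their sum. -/
theorem posSemidef_le_trace {B : Matrix n n ℂ} (hB : B.PosSemidef) :
    (B.trace • (1 : Matrix n n ℂ) - B).PosSemidef := by
  obtain ⟨V, b, h1, h2, h3⟩ := exists_unitary_diagonal hB.1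
  have hb : (diagonal (fun i => (b i : ℂ))).PosSemidef := by
    rwa [h3, posSemidef_conj_unitary_iff h1] at hB
  have ht : B.trace = ∑ i, (b i : ℂ) := by
    rw [h3, trace_conj_unitary h1, trace_diagonal]
  have : B.trace • (1 : Matrix n n ℂ) - B =
      V * diagonal (fun i => B.trace - (b i : ℂ)) * Vᴴ := by
    have e : diagonal (fun i => B.trace - (b i : ℂ)) = B.trace • (1 : Matrix n n ℂ) -
        diagonal (fun i => (b i : ℂ)) := by
      ext i j; by_cases h : i = j <;> simp [h]
    rw [e, Matrix.mul_sub, Matrix.sub_mul, ← h3]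
    simp [h2]
  rw [this, posSemidef_conj_unitary_iff h1, posSemidef_diagonal_iff]
  rw [posSemidef_diagonal_iff] at hb
  intro i
  rw [ht, sub_nonneg]
  exact Finset.single_le_sum (f := fun i => (b i : ℂ)) (fun j _ => hb j) (Finset.mem_univ i)

/-- With A = L†L the trace is that of the positive semidefinite matrix L B L†. -/
theorem trace_mul_nonneg {A B : Matrix n n ℂ} (hA : A.PosSemidef) (hB : B.PosSemidef) :
    0 ≤ (A * B).trace := by
  obtain ⟨L, rfl⟩ := exists_conjTranspose_mul_self hA
  rw [Matrix.mul_assoc, Matrix.trace_mul_comm]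
  exact (hB.mul_mul_conjTranspose_same L).trace_nonneg

/-- Simultaneous diagonalization by congruence. -/
theorem exists_simultaneous_diagonal {P S : Mat N} (hP : P.PosDef) (hS : S.PosSemidef) :
    ∃ (K : Mat N) (b : Fin N → ℝ), K.det ≠ 0 ∧ P = Kᴴ * K ∧
      K * S * Kᴴ = diagonal (fun i => (b i : ℂ)) ∧ ∀ i, 0 ≤ b i := by
  obtain ⟨L, rfl⟩ := exists_conjTranspose_mul_self hP.posSemidef
  have hdet := hP.det_pos.ne'
  rw [det_mul, mul_ne_zero_iff] at hdet
  have hB := hS.mul_mul_conjTranspose_same L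
  obtain ⟨V, b, h1, h2, h3⟩ := exists_unitary_diagonal hB.1
  have hV : Vᴴ.det ≠ 0 := by
    intro h
    have := congrArg det h1
    rw [det_mul, h, zero_mul, det_one] at this
    exact zero_ne_one this
  refine ⟨Vᴴ * L, b, ?_, ?_, ?_, ?_⟩
  · rw [det_mul]
    exact mul_ne_zero hV hdet.2
  · rw [conjTranspose_mul, conjTranspose_conjTranspose, Matrix.mul_assoc, ← Matrix.mul_assoc V, h2,
      Matrix.one_mul]
  · have : Vᴴ * L * S * (Vᴴ * L)ᴴ = Vᴴ * (L * S * Lᴴ) * V := by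
      simp only [conjTranspose_mul, conjTranspose_conjTranspose, Matrix.mul_assoc]
    rw [this, h3]
    calc Vᴴ * (V * diagonal (fun i => (b i : ℂ)) * Vᴴ) * V
        = (Vᴴ * V) * diagonal (fun i => (b i : ℂ)) * (Vᴴ * V) := by simp only [Matrix.mul_assoc]
      _ = _ := by rw [h1, Matrix.one_mul, Matrix.mul_one]
  · rw [h3, posSemidef_conj_unitary_iff h1, posSemidef_diagonal_iff] at hB
    intro i
    exact_mod_cast hB i

/-- The logarithm of the absolute value of the determinant. -/
noncomputable def logDet (A : Mat N) : ℝ := Real.log ‖A.det‖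

theorem logDet_mul {A B : Mat N} (hA : A.det ≠ 0) (hB : B.det ≠ 0) :
    logDet (A * B) = logDet A + logDet B := by
  rw [logDet, det_mul, norm_mul, Real.log_mul (by simpa) (by simpa)]
  rfl

theorem logDet_conjTranspose (A : Mat N) : logDet Aᴴ = logDet A := by
  simp [logDet, det_conjTranspose]

theorem logDet_one : logDet (1 : Mat N) = 0 := by simp [logDet]

theorem logDet_smul {c : ℝ} (hc : 0 < c) {A : Mat N} (hA : A.det ≠ 0) :
    logDet ((c : ℂ) • A) = N * Real.log c + logDet A := by
  rw [logDet, det_smul, norm_mul, Real.log_mul (by simp [hc.ne']) (by simpa)]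
  simp [logDet, abs_of_pos hc]

theorem logDet_diagonal {z : Fin N → ℝ} (hz : ∀ i, 0 < z i) :
    logDet (diagonal (fun i => (z i : ℂ))) = ∑ i, Real.log (z i) := by
  rw [logDet, det_diagonal, norm_prod, Real.log_prod (fun i _ => by simp [(hz i).ne'])]
  refine Finset.sum_congr rfl fun i _ => ?_
  simp

theorem logDet_inv {A : Mat N} (hA : A.det ≠ 0) : logDet A⁻¹ = - logDet A := by
  have hA' : IsUnit A.det := hA.isUnit
  have h := logDet_mul (A := A) (B := A⁻¹) hA (by
    rw [det_nonsing_inv]; simpa using hA)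
  rw [Matrix.mul_nonsing_inv _ hA', logDet_one] at h
  linarith

theorem det_conjTranspose_ne_zero {A : Mat N} (hA : A.det ≠ 0) : Aᴴ.det ≠ 0 := by
  simpa [det_conjTranspose] using hA

theorem posDef_conjTranspose_mul_mul {K A : Mat N} (hK : K.det ≠ 0) (hA : A.PosDef) :
    (Kᴴ * A * K).PosDef := by
  have hu : IsUnit K := (Matrix.isUnit_iff_isUnit_det K).mpr hK.isUnit
  exact (Matrix.IsUnit.posDef_star_left_conjugate_iff hu).mpr hA

theorem posDef_mul_mul_conjTranspose {K A : Mat N} (hK : K.det ≠ 0) (hA : A.PosDef) :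
    (K * A * Kᴴ).PosDef := by
  have := posDef_conjTranspose_mul_mul (det_conjTranspose_ne_zero hK) hA
  rwa [conjTranspose_conjTranspose] at this

section Diagonal

variable {P S K : Mat N} {b : Fin N → ℝ} (hP : P = Kᴴ * K)
  (hS : K * S * Kᴴ = diagonal (fun i => (b i : ℂ)))


include hP hS in
theorem mul_mul_eq_of_diagonal : P * S * P = Kᴴ * diagonal (fun i => (b i : ℂ)) * K := by
  rw [hP, ← hS]; simp only [Matrix.mul_assoc]

include hS in
theorem trace_conj_diagonal_mul (z : Fin N → ℝ) :
    (Kᴴ * diagonal (fun i => (z i : ℂ)) * K * S).trace.re = ∑ i, z i * b i := by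
  have : (Kᴴ * diagonal (fun i => (z i : ℂ)) * K * S).trace =
      (diagonal (fun i => (z i : ℂ)) * (K * S * Kᴴ)).trace := by
    rw [Matrix.mul_assoc, Matrix.mul_assoc, Matrix.trace_mul_comm]
    simp only [Matrix.mul_assoc]
  rw [this, hS, diagonal_mul_diagonal, trace_diagonal, Complex.re_sum]
  simp

include hP hS in
theorem trace_mul_of_diagonal : (P * S).trace.re = ∑ i, b i := by
  have := trace_conj_diagonal_mul hS (fun _ => 1)
  simpa [hP] using this

include hP hS in
theorem trace_mul_sub_one_sq_of_diagonal : ((P * S - 1) ^ 2).trace.re = ∑ i, (b i - 1) ^ 2 := by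
  have h1 := trace_mul_of_diagonal hP hS
  have h2 := trace_conj_diagonal_mul hS b
  rw [← mul_mul_eq_of_diagonal hP hS] at h2
  have e : (P * S - 1) ^ 2 = P * S * P * S - (2 : ℂ) • (P * S) + 1 := by
    rw [sq, sub_mul, mul_sub, mul_one, one_mul, two_smul]
    simp only [Matrix.mul_assoc]
    abel
  rw [e, trace_add, trace_sub, trace_smul, trace_one]
  simp only [Complex.add_re, Complex.sub_re, smul_eq_mul, Complex.mul_re, h1, h2]
  have e2 : ∀ i, (b i - 1) ^ 2 = b i * b i - 2 * b i + 1 := fun i => by ring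
  simp [e2, Finset.sum_add_distrib, ← Finset.mul_sum]

include hP in
theorem logDet_of_diagonal (hK : K.det ≠ 0) {z : Fin N → ℝ} (hz : ∀ i, 0 < z i) :
    logDet (Kᴴ * diagonal (fun i => (z i : ℂ)) * K) = logDet P + ∑ i, Real.log (z i) := by
  have hd : (diagonal (fun i => (z i : ℂ))).det ≠ 0 := by
    rw [det_diagonal]
    exact Finset.prod_ne_zero_iff.mpr fun i _ => by exact_mod_cast (hz i).ne'
  have hK' := det_conjTranspose_ne_zero hK
  rw [logDet_mul (by rw [det_mul]; exact mul_ne_zero hK' hd) hK, logDet_mul hK' hd, hP,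
    logDet_mul hK' hK, logDet_diagonal hz]
  ring

include hP hS in
theorem logDet_add_logDet_of_diagonal (hK : K.det ≠ 0) (hSd : S.det ≠ 0) (hb : ∀ i, 0 < b i) :
    logDet P + logDet S = ∑ i, Real.log (b i) := by
  have hK' := det_conjTranspose_ne_zero hK
  rw [← logDet_diagonal hb, ← hS, logDet_mul (by rw [det_mul]; exact mul_ne_zero hK hSd) hK',
    logDet_mul hK hSd, hP, logDet_mul hK' hK]
  ring

end Diagonal

theorem diagonal_pos_of_posDef {S K : Mat N} {b : Fin N → ℝ} (hS : S.PosDef) (hK : K.det ≠ 0)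
    (h : K * S * Kᴴ = diagonal (fun i => (b i : ℂ))) (i : Fin N) : 0 < b i := by
  have := posDef_mul_mul_conjTranspose hK hS
  rw [h, posDef_diagonal_iff] at this
  exact_mod_cast this i

/-- `P ↦ tr (P S) - log det P` is at least its value at `P = S⁻¹`. -/
theorem le_trace_sub_logDet {P S : Mat N} (hP : P.PosDef) (hS : S.PosDef) :
    (N : ℝ) + logDet S ≤ (P * S).trace.re - logDet P := by
  obtain ⟨K, b, hK, h1, h2, -⟩ := exists_simultaneous_diagonal hP hS.posSemidef
  have hb := diagonal_pos_of_posDef hS hK h2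
  have h3 := logDet_add_logDet_of_diagonal h1 h2 hK hS.det_pos.ne' hb
  rw [trace_mul_of_diagonal h1 h2]
  -- The b i are the eigenvalues of P S, so the matrix inequality is the scalar one log b ≤ b - 1,
  -- summed.
  have : ∑ i, Real.log (b i) ≤ ∑ i, (b i - 1) :=
    Finset.sum_le_sum fun i _ => Real.log_le_sub_one_of_pos (hb i)
  simp at this
  linarith

/-- Apply `le_trace_sub_logDet` to A and B⁻¹: log det A ≤ log det B + tr(A B⁻¹) - N, and tr(A B⁻¹) ≤
N because A ≤ B. -/
theorem logDet_le_logDet {A B : Mat N} (hA : A.PosDef) (hB : B.PosDef)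
    (h : (B - A).PosSemidef) : logDet A ≤ logDet B := by
  have h1 := le_trace_sub_logDet hA hB.inv
  have h2 := Complex.le_def.mp (trace_mul_nonneg h hB.inv.posSemidef)
  rw [logDet_inv hB.det_pos.ne'] at h1
  rw [sub_mul, Matrix.mul_nonsing_inv _ hB.det_pos.ne'.isUnit, trace_sub, trace_one] at h2
  have h3 := h2.1
  simp at h3
  linarith

/-- A quantitative form of log x ≤ x - 1. With x = s², the bound log s ≤ s - 1 leaves a gap of at
least (s - 1)², while (x - 1)² = (s - 1)²(s + 1)². Either (s + 1)² ≤ 6, or s > √6 - 1 and then (s -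
1)² alone exceeds 1/6. -/
theorem log_add_min_le {x : ℝ} (hx : 0 < x) : Real.log x + min ((x - 1) ^ 2) 1 / 6 ≤ x - 1 := by
  obtain ⟨s, hs, rfl⟩ : ∃ s, 0 < s ∧ x = s ^ 2 := ⟨√x, Real.sqrt_pos.mpr hx,
      (Real.sq_sqrt hx.le).symm⟩
  have h := Real.log_le_sub_one_of_pos hs
  rw [Real.log_pow]
  push_cast
  suffices min ((s ^ 2 - 1) ^ 2) 1 / 6 ≤ (s - 1) ^ 2 by nlinarith
  by_cases h2 : s ≤ 7 / 5
  · have h3 : (s + 1) ^ 2 ≤ 6 := by nlinarith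
    have h4 : (s ^ 2 - 1) ^ 2 = (s - 1) ^ 2 * (s + 1) ^ 2 := by ring
    have h5 := min_le_left ((s ^ 2 - 1) ^ 2) 1
    nlinarith [mul_le_mul_of_nonneg_left h3 (sq_nonneg (s - 1))]
  · by_cases h3 : (s+1) ^ 2 ≤ 6
    · have h4 : (s ^ 2 - 1) ^ 2 = (s - 1) ^ 2 * (s + 1) ^ 2 := by ring
      have h5 := min_le_left ((s ^ 2 - 1) ^ 2) 1
      nlinarith [mul_le_mul_of_nonneg_left h3 (sq_nonneg (s - 1))]
    · have h5 := min_le_right ((s ^ 2 - 1) ^ 2) 1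
      push Not at h2 h3
      have : 1.449 ≤ s := by nlinarith
      nlinarith

/-- The progress of one Sinkhorn step. The eigenvalues of P S sum to N, so the linear terms in
`log_add_min_le` cancel and only the quadratic gain remains. -/
theorem logDet_add_logDet_le {P S : Mat N} (hN : 1 ≤ N) (hP : P.PosDef) (hS : S.PosDef)
    (ht : (P * S).trace.re = N) (hd : 1 / (N : ℝ) ≤ ((P * S - 1) ^ 2).trace.re) :
    logDet P + logDet S ≤ - (1 / (6 * N)) := by
  obtain ⟨K, b, hK, h1, h2, -⟩ := exists_simultaneous_diagonal hP hS.posSemidef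
  have hb := diagonal_pos_of_posDef hS hK h2
  rw [logDet_add_logDet_of_diagonal h1 h2 hK hS.det_pos.ne' hb]
  rw [trace_mul_of_diagonal h1 h2] at ht
  rw [trace_mul_sub_one_sq_of_diagonal h1 h2] at hd
  have hN' : (1 : ℝ) ≤ N := by exact_mod_cast hN
  have hN1 : 1 / (N : ℝ) ≤ 1 := by rw [div_le_one (by linarith)]; exact hN'
  -- Capping the squares at 1 is harmless: one capped term already contributes 1 ≥ 1/N.
  have key : 1 / (N : ℝ) ≤ ∑ i, min ((b i - 1) ^ 2) 1 := by
    by_cases h : ∀ i, (b i - 1) ^ 2 ≤ 1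
    · simpa [min_eq_left (h _)] using hd
    · push Not at h
      obtain ⟨i, hi⟩ := h
      have := Finset.single_le_sum (f := fun i => min ((b i - 1) ^ 2) 1)
        (fun j _ => le_min (sq_nonneg _) zero_le_one) (Finset.mem_univ i)
      simp only [min_eq_right hi.le] at this
      linarith
  have h3 : ∑ i, (Real.log (b i) + min ((b i - 1) ^ 2) 1 / 6) ≤ ∑ i, (b i - 1) :=
    Finset.sum_le_sum fun i _ => log_add_min_le (hb i)
  rw [Finset.sum_add_distrib, ← Finset.sum_div, Finset.sum_sub_distrib, ht] at h3
  simp at h3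
  have h4 : 1 / (6 * (N : ℝ)) = 1 / N / 6 := by field_simp
  rw [h4]
  linarith

/-- Follows from log(1 + x) ≥ x/(1 + x), as x - (x - 2x²)(1 + x) = x²(1 + 2x) ≥ 0. -/
theorem log_lower_bound {x : ℝ} (hx : |x| ≤ 1 / 2) : x - 2 * x ^ 2 ≤ Real.log (1 + x) := by
  have h := abs_le.mp hx
  have h1 : 0 < 1 + x := by linarith
  refine le_trans ?_ (Real.one_sub_inv_le_log_of_pos h1)
  have : 1 - (1 + x)⁻¹ = x / (1 + x) := by field_simp; ring
  rw [this, le_div_iff₀ h1]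
  nlinarith [mul_nonneg (sq_nonneg x) (by linarith : 0 ≤ 1 + 2 * x)]

/-- One step of natural gradient descent for `P ↦ tr (P S) - log det P`. -/
theorem gradient_step {P S : Mat N} (hN : 1 ≤ N) (hP : P.PosDef) (hS : S.PosSemidef)
    (ht : (P * S).trace.re ≤ 2 * N) {P' : Mat N}
    (hP' : P' = P + ((1 / (4 * N) : ℝ) : ℂ) • (P - P * S * P)) :
    P'.PosDef ∧ (P' * S).trace.re ≤ 2 * N - 1 / 2 ∧
    (P' * S).trace.re - logDet P' ≤
      (P * S).trace.re - logDet P - 1 / (8 * N) * ((P * S - 1) ^ 2).trace.re := by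
  obtain ⟨K, b, hK, h1, h2, hb⟩ := exists_simultaneous_diagonal hP hS
  have hN' : (1 : ℝ) ≤ N := by exact_mod_cast hN
  -- The eigenvalues b i of P S lie between 0 and tr(P S) ≤ 2N. This step length keeps |η(1 - b i)|
  -- ≤ 1/2, so the new matrix stays positive definite and the quadratic bound for the logarithm
  -- applies.
  set η : ℝ := 1 / (4 * N) with hη
  have hη0 : 0 < η := by positivity
  have hηN : η * N = 1 / 4 := by rw [hη]; field_simp
  have hη4 : η ≤ 1 / 4 := by nlinarith
  set z : Fin N → ℝ := fun i => 1 + η * (1 - b i) with hz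
  have hPz : P' = Kᴴ * diagonal (fun i => (z i : ℂ)) * K := by
    have e : diagonal (fun i => (z i : ℂ)) =
        1 + (η : ℂ) • (1 - diagonal (fun i => (b i : ℂ))) := by
      ext i j; by_cases h : i = j <;> simp [h, hz]
    rw [hP', mul_mul_eq_of_diagonal h1 h2, e, h1]
    simp only [Matrix.mul_add, Matrix.add_mul, Matrix.mul_sub, Matrix.sub_mul, Matrix.mul_one,
      Matrix.mul_smul, Matrix.smul_mul]
  have htr := trace_mul_of_diagonal h1 h2
  rw [htr] at ht
  have hbN : ∀ i, b i ≤ 2 * N := fun i =>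
    (Finset.single_le_sum (fun j _ => hb j) (Finset.mem_univ i)).trans ht
  have hx : ∀ i, |η * (1 - b i)| ≤ 1 / 2 := by
    intro i
    rw [abs_le]
    constructor <;> nlinarith [hb i, hbN i]
  have hz0 : ∀ i, 0 < z i := by
    intro i
    have := (abs_le.mp (hx i)).1
    simp only [hz]; linarith
  have htz := trace_conj_diagonal_mul h2 z
  rw [← hPz] at htz
  have hsum : ∑ i, z i * b i = (1 + η) * ∑ i, b i - η * ∑ i, b i ^ 2 := by
    rw [Finset.mul_sum, Finset.mul_sum, ← Finset.sum_sub_distrib]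
    refine Finset.sum_congr rfl fun i _ => ?_
    simp only [hz]; ring
  have hb0 : 0 ≤ ∑ i, b i := Finset.sum_nonneg fun i _ => hb i
  refine ⟨?_, ?_, ?_⟩
  · rw [hPz]
    refine posDef_conjTranspose_mul_mul hK ?_
    rw [posDef_diagonal_iff]
    intro i
    exact_mod_cast hz0 i
  · rw [htz, hsum]
    -- By Cauchy–Schwarz, with u = η tr(P S) ≤ 1/2, the new trace is at most 4Nu + u - 4u². This is
    -- increasing on that range and equals 2N - 1/2 at its end.
    have hcs : (∑ i, b i) ^ 2 ≤ N * ∑ i, b i ^ 2 := by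
      simpa using sq_sum_le_card_mul_sum_sq (s := Finset.univ) (f := b)
    set s := ∑ i, b i
    set q := ∑ i, b i ^ 2
    have h5 : s ^ 2 / N ≤ q := by rw [div_le_iff₀ (by linarith)]; linarith
    have h6 : η * (s ^ 2 / N) ≤ η * q := mul_le_mul_of_nonneg_left h5 hη0.le
    have h7 : η * (s ^ 2 / N) = 4 * (η * s) ^ 2 := by
      rw [hη]; field_simp
      try norm_num
    have h8 : s = 4 * N * (η * s) := by rw [hη]; field_simp
    have h9 : η * s ≤ 1 / 2 := by nlinarith
    have h10 : 0 ≤ η * s := by positivity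
    set u := η * s
    nlinarith
  · rw [htz, htr, hPz, logDet_of_diagonal h1 hK hz0, trace_mul_sub_one_sq_of_diagonal h1 h2]
    have h3 : ∑ i, (η * (1 - b i) - 2 * (η * (1 - b i)) ^ 2) ≤ ∑ i, Real.log (z i) :=
      Finset.sum_le_sum fun i _ => log_lower_bound (hx i)
    -- The linear term moves the trace by η(1 - b) - η(1 - b)². Half of the quadratic gain pays for
    -- the error 2η²(1 - b)² of the logarithm, since η ≤ 1/4.
    have h4 : ∑ i, z i * b i ≤ ∑ i, b i - η / 2 * ∑ i, (b i - 1) ^ 2 +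
        ∑ i, (η * (1 - b i) - 2 * (η * (1 - b i)) ^ 2) := by
      rw [Finset.mul_sum, ← Finset.sum_sub_distrib, ← Finset.sum_add_distrib]
      refine Finset.sum_le_sum fun i _ => ?_
      simp only [hz]
      nlinarith [mul_nonneg (mul_nonneg hη0.le (sq_nonneg (b i - 1))) (by linarith : 0 ≤ 1 - 4 * η)]
    have h5 : 1 / (8 * (N : ℝ)) = η / 2 := by rw [hη]; field_simp; norm_num
    rw [h5]
    linarith

end OperatorScaling

/-! ### Operators, their duals and their scalings in terms of Choi matrices. -/

namespace OperatorScaling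

variable {N : ℕ}

theorem opOfChoi_apply (ρ : Bipartite N ℂ) (X : Mat N) (a b : Fin N) :
    opOfChoi ρ X a b = ∑ i, ∑ j, X i j * ρ (i, a) (j, b) := by
  simp [opOfChoi, Matrix.sum_apply, block]

theorem opOfChoi_sub (ρ σ : Bipartite N ℂ) (X : Mat N) :
    opOfChoi (ρ - σ) X = opOfChoi ρ X - opOfChoi σ X := by
  ext a b
  simp [opOfChoi_apply, mul_sub, Finset.sum_sub_distrib]

theorem opOfChoi_smul (c : ℂ) (ρ : Bipartite N ℂ) (X : Mat N) :
    opOfChoi (c • ρ) X = c • opOfChoi ρ X := by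
  ext a b
  simp [opOfChoi_apply, mul_left_comm, Finset.mul_sum]

/-- With X = Y†Y, the value T(X) is the sum of B_k† ρ B_k, where B_k is the tensor product of the
k-th row of Y, as a column, with the identity. -/
theorem opOfChoi_posSemidef {ρ : Bipartite N ℂ} (hρ : ρ.PosSemidef) {X : Mat N}
    (hX : X.PosSemidef) : (opOfChoi ρ X).PosSemidef := by
  obtain ⟨Y, rfl⟩ := exists_conjTranspose_mul_self hX
  set B : Fin N → Matrix (Fin N × Fin N) (Fin N) ℂ :=
    fun k => Matrix.of fun p b => if p.2 = b then Y k p.1 else 0 with hB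
  have : opOfChoi ρ (Yᴴ * Y) = ∑ k, (B k)ᴴ * ρ * B k := by
    ext a b
    rw [opOfChoi_apply, Matrix.sum_apply]
    simp only [Matrix.mul_apply, hB, conjTranspose_apply, Matrix.of_apply, Fintype.sum_prod_type,
      Finset.sum_mul, apply_ite star, star_zero, ite_mul, zero_mul, mul_ite, mul_zero,
      Finset.sum_ite_eq', Finset.mem_univ, if_true]
    have e : ∀ k, ∑ j, ∑ i, star (Y k i) * ρ (i, a) (j, b) * Y k j =
        ∑ i, ∑ j, star (Y k i) * Y k j * ρ (i, a) (j, b) := fun k => by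
      rw [Finset.sum_comm]
      exact Finset.sum_congr rfl fun i _ => Finset.sum_congr rfl fun j _ => by ring
    simp only [e]
    exact (Finset.sum_congr rfl fun i _ => Finset.sum_comm).trans Finset.sum_comm
  rw [this]
  exact Matrix.posSemidef_sum _ fun k _ => hρ.conjTranspose_mul_mul_same (B k)

/-- The Choi matrix of the dual operator. -/
def dualChoi (ρ : Bipartite N ℂ) : Bipartite N ℂ := Matrix.of fun p q => star (ρ p.swap q.swap)

theorem dual_opOfChoi (ρ : Bipartite N ℂ) : dual (opOfChoi ρ) = opOfChoi (dualChoi ρ) := by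
  ext Y i j
  have h : ∀ a b, opOfChoi ρ (Matrix.single i j 1) a b = ρ (i, a) (j, b) := fun a b => by
    conv_rhs => rw [← choi_opOfChoi ρ]
    rfl
  rw [opOfChoi_apply]
  simp [dual, Matrix.trace, Matrix.mul_apply, h, dualChoi]

theorem dualChoi_posSemidef {ρ : Bipartite N ℂ} (hρ : ρ.PosSemidef) : (dualChoi ρ).PosSemidef :=
  hρ.conjTranspose.transpose.submatrix Prod.swap

theorem dual_posSemidef {ρ : Bipartite N ℂ} (hρ : ρ.PosSemidef) {X : Mat N}
    (hX : X.PosSemidef) : (dual (opOfChoi ρ) X).PosSemidef := by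
  rw [dual_opOfChoi]
  exact opOfChoi_posSemidef (dualChoi_posSemidef hρ) hX

/-- A rank-one Choi matrix is a single Kraus operator. Hence an inequality between ρ and vec A (vec
A)† becomes one between T(X) and AXA†. -/
theorem opOfChoi_vecMulVec (A X : Mat N) :
    opOfChoi (vecMulVec A.vec (star A.vec)) X = A * X * Aᴴ := by
  ext a b
  rw [opOfChoi_apply]
  simp only [Matrix.mul_apply, vecMulVec_apply, vec, Pi.star_apply, conjTranspose_apply,
    Finset.sum_mul]
  rw [Finset.sum_comm]
  exact Finset.sum_congr rfl fun i _ => Finset.sum_congr rfl fun j _ => by ring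

theorem dual_opOfChoi_vecMulVec (A X : Mat N) :
    opOfChoi (dualChoi (vecMulVec A.vec (star A.vec))) X = Aᴴ * X * A := by
  ext a b
  rw [opOfChoi_apply]
  simp only [Matrix.mul_apply, vecMulVec_apply, vec, Pi.star_apply, conjTranspose_apply,
    Finset.sum_mul, dualChoi, Matrix.of_apply, Prod.swap, star_mul', star_star]
  rw [Finset.sum_comm]
  exact Finset.sum_congr rfl fun i _ => Finset.sum_congr rfl fun j _ => by ring

theorem trace_mul_dual_of_isHermitian (T : Op N) (X : Mat N) {Y : Mat N} (hY : Y.IsHermitian)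
    (hY' : (dual T Y).IsHermitian) : (T X * Y).trace = (X * dual T Y).trace := by
  have := trace_mul_dual T X Y
  rwa [hY.eq, hY'.eq] at this

/-! ### Scaling -/

theorem scale_apply (L R : Mat N) (T : Op N) (X : Mat N) :
    scale L R T X = L * T (Rᴴ * X * R) * Lᴴ := rfl

theorem dual_scale_apply (L R : Mat N) (T : Op N) (Y : Mat N) :
    dual (scale L R T) Y = R * dual T (Lᴴ * Y * L) * Rᴴ := by
  ext i j
  have h := trace_mul_dual T (Rᴴ * Matrix.single i j 1 * R) (Lᴴ * Y * L)
  have h2 : dual (scale L R T) Y i j = star ((T (Rᴴ * Matrix.single i j 1 * R) *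
      (Lᴴ * Y * L)ᴴ).trace) := by
    rw [← Matrix.trace_conjTranspose]
    simp only [dual, scale_apply, LinearMap.coe_mk, AddHom.coe_mk, Matrix.of_apply,
      conjTranspose_mul, conjTranspose_conjTranspose]
    rw [← Matrix.mul_assoc, ← Matrix.mul_assoc, Matrix.trace_mul_comm]
    simp only [Matrix.mul_assoc]
  rw [h2, h, ← Matrix.trace_conjTranspose]
  simp only [conjTranspose_mul, conjTranspose_conjTranspose, conjTranspose_single, star_one]
  set D := dual T (Lᴴ * Y * L)
  have : (D * (Rᴴ * (Matrix.single j i 1 * R))).trace =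
      (R * D * Rᴴ * Matrix.single j i 1).trace := by
    rw [← Matrix.mul_assoc, ← Matrix.mul_assoc, Matrix.trace_mul_comm]
    simp only [Matrix.mul_assoc]
  rw [this, Matrix.trace_mul_single]
  simp

theorem scale_scale (L L' R R' : Mat N) (T : Op N) :
    scale L' R' (scale L R T) = scale (L' * L) (R' * R) T := by
  ext1 X
  simp only [scale_apply, conjTranspose_mul, Matrix.mul_assoc]

theorem scale_one_one (T : Op N) : scale 1 1 T = T := by
  ext1 X
  simp [scale_apply]

/-- Cyclicity moves L† next to L in `DS`, so that only L†L and R†R are needed. -/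
theorem trace_mul_sub_one_sq_comm (X Y : Mat N) :
    ((X * Y - 1) ^ 2).trace = ((Y * X - 1) ^ 2).trace := by
  have e : ∀ A : Mat N, (A - 1) ^ 2 = A * A - (2 : ℂ) • A + 1 := fun A => by
    rw [sq, sub_mul, mul_sub, mul_one, one_mul, two_smul]
    abel
  have h : (X * Y * (X * Y)).trace = (Y * X * (Y * X)).trace := by
    rw [Matrix.mul_assoc, Matrix.trace_mul_comm]
    simp only [Matrix.mul_assoc]
  simp only [e, trace_add, trace_sub, trace_smul, h, Matrix.trace_mul_comm X Y]

/-- `DS` of a scaled operator in terms of `P = L†L` and `Q = R†R`. -/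
theorem DS_scale (T : Op N) (L R : Mat N) :
    DS (scale L R T) = ((Lᴴ * L * T (Rᴴ * R) - 1) ^ 2).trace.re +
      ((Rᴴ * R * dual T (Lᴴ * L) - 1) ^ 2).trace.re := by
  have key : ∀ A B : Mat N, ((A * B * Aᴴ - 1) ^ 2).trace = ((Aᴴ * A * B - 1) ^ 2).trace := by
    intro A B
    rw [trace_mul_sub_one_sq_comm, Matrix.mul_assoc]
  rw [DS, scale_apply, dual_scale_apply, Matrix.mul_one, Matrix.mul_one, key, key, Complex.add_re]

/-- An invertible R preserves the rank of the argument, and multiplication by L and L† on the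
outside can only lower the rank of the value; so L may be singular. -/
theorem RankNonDecreasing.of_scale {T : Op N} {L R : Mat N} (hR : IsUnit R.det)
    (h : RankNonDecreasing (scale L R T)) : RankNonDecreasing T := by
  intro X hX
  have h1 := h (R⁻¹ᴴ * X * R⁻¹) (hX.conjTranspose_mul_mul_same _)
  have e : Rᴴ * (R⁻¹ᴴ * X * R⁻¹) * R = X := by
    have e1 : Rᴴ * R⁻¹ᴴ = 1 := by
      rw [← conjTranspose_mul, Matrix.nonsing_inv_mul _ hR, conjTranspose_one]
    calc _ = (Rᴴ * R⁻¹ᴴ) * X * (R⁻¹ * R) := by simp only [Matrix.mul_assoc]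
      _ = X := by rw [e1, Matrix.nonsing_inv_mul _ hR, Matrix.one_mul, Matrix.mul_one]
  rw [scale_apply, e] at h1
  have h2 : (R⁻¹ᴴ * X * R⁻¹).rank = X.rank := by
    have hu : IsUnit R⁻¹.det := by rw [det_nonsing_inv]; exact hR.ringInverse
    rw [rank_mul_eq_left_of_isUnit_det _ _ hu, rank_mul_eq_right_of_isUnit_det]
    rw [det_conjTranspose]; exact hu.star
  rw [h2] at h1
  exact h1.trans ((rank_mul_le_left _ _).trans (rank_mul_le_right _ _))

/-! ### Small `DS` forces rank non-decrease -/

/-- The support projection of a positive semidefinite matrix. -/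
theorem exists_support_projection {X : Mat N} (hX : X.PosSemidef) :
    ∃ (P : Mat N) (c : ℝ), P.PosSemidef ∧ (1 - P).PosSemidef ∧ P * P = P ∧ P.trace = X.rank ∧
      ((c : ℂ) • X - P).PosSemidef ∧ (1 - P) * X = 0 := by
  obtain ⟨V, x, h1, h2, h3⟩ := exists_unitary_diagonal hX.1
  have hx : ∀ i, 0 ≤ x i := by
    rw [h3, posSemidef_conj_unitary_iff h1, posSemidef_diagonal_iff] at hX
    exact fun i => by exact_mod_cast hX i
  have hV : IsUnit V.det := by
    have := congrArg det h1
    rw [det_mul, det_one] at this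
    exact IsUnit.of_mul_eq_one_right _ this
  set d : Fin N → ℂ := fun i => if x i = 0 then 0 else 1 with hd
  -- Zero eigenvalues contribute nothing because 0⁻¹ = 0. Thus c · x i ≥ 1 at every nonzero
  -- eigenvalue, and c X dominates the projection.
  set c : ℝ := ∑ i, (x i)⁻¹ with hc
  have hsub : 1 - V * diagonal d * Vᴴ = V * diagonal (fun i => 1 - d i) * Vᴴ := by
    have : diagonal (fun i => 1 - d i) = 1 - diagonal d := by
      ext i j; by_cases h : i = j <;> simp [h]
    rw [this, Matrix.mul_sub, Matrix.sub_mul, Matrix.mul_one, h2]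
  have hmul : ∀ e f : Fin N → ℂ, (V * diagonal e * Vᴴ) * (V * diagonal f * Vᴴ) =
      V * diagonal (fun i => e i * f i) * Vᴴ := fun e f => by
    calc _ = V * diagonal e * (Vᴴ * V) * diagonal f * Vᴴ := by simp only [Matrix.mul_assoc]
      _ = _ := by rw [h1, Matrix.mul_one, Matrix.mul_assoc V, diagonal_mul_diagonal]
  refine ⟨V * diagonal d * Vᴴ, c, ?_, ?_, ?_, ?_, ?_, ?_⟩
  · rw [posSemidef_conj_unitary_iff h1, posSemidef_diagonal_iff]
    intro i; simp only [hd]; split_ifs <;> simp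
  · rw [hsub, posSemidef_conj_unitary_iff h1, posSemidef_diagonal_iff]
    intro i; simp only [hd]; split_ifs <;> simp
  · rw [hmul]
    congr 3; ext i; simp only [hd]; split_ifs <;> simp
  · rw [trace_conj_unitary h1, trace_diagonal, h3,
      rank_mul_eq_left_of_isUnit_det _ _ (by rw [det_conjTranspose]; exact hV.star),
      rank_mul_eq_right_of_isUnit_det _ _ hV, rank_diagonal, Fintype.card_subtype]
    simp [hd, Finset.sum_ite]
  · have : (c : ℂ) • X - V * diagonal d * Vᴴ =
        V * diagonal (fun i => ((c * x i - if x i = 0 then 0 else 1 : ℝ) : ℂ)) * Vᴴ := by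
      have e : diagonal (fun i => ((c * x i - if x i = 0 then 0 else 1 : ℝ) : ℂ)) =
          (c : ℂ) • diagonal (fun i => (x i : ℂ)) - diagonal d := by
        ext i j; by_cases h : i = j <;> simp [h, hd, apply_ite ((↑) : ℝ → ℂ)]
      rw [e, Matrix.mul_sub, Matrix.sub_mul, Matrix.mul_smul, Matrix.smul_mul, ← h3]
    rw [this, posSemidef_conj_unitary_iff h1, posSemidef_diagonal_iff]
    intro i
    have : 0 ≤ c * x i - if x i = 0 then 0 else 1 := by
      split_ifs with h
      · simp [h]
      · have h4 : (x i)⁻¹ ≤ c :=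
          Finset.single_le_sum (f := fun i => (x i)⁻¹) (fun j _ => inv_nonneg.mpr (hx j))
            (Finset.mem_univ i)
        have h5 := mul_le_mul_of_nonneg_right h4 (hx i)
        rw [inv_mul_cancel₀ h] at h5
        linarith
    exact_mod_cast this
  · rw [hsub]
    conv_lhs => rw [h3]
    rw [hmul]
    have : (fun i => (1 - d i) * (x i : ℂ)) = fun _ => 0 := by
      ext i; simp only [hd]; split_ifs with h <;> simp [h]
    rw [this, diagonal_zero, Matrix.mul_zero, Matrix.zero_mul]

/-- Cauchy–Schwarz with a parameter: expand tr((X - tB)†(X - tB)) ≥ 0 and use tr(X²) = N. -/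
theorem two_mul_trace_mul_le {X B : Mat N} (hX : X.IsHermitian) (hXX : X * X = 1)
    (hB : B.IsHermitian) (t : ℝ) :
    2 * t * (X * B).trace.re ≤ N + t ^ 2 * (B ^ 2).trace.re := by
  have h := (posSemidef_conjTranspose_mul_self (X - (t : ℂ) • B)).trace_nonneg
  have hc : ((t : ℂ) • B)ᴴ = (t : ℂ) • B := by
    rw [conjTranspose_smul, hB.eq]; simp
  rw [conjTranspose_sub, hX.eq, hc, sub_mul, mul_sub, mul_sub, hXX, trace_sub, trace_sub, trace_sub,
    trace_one, Matrix.smul_mul, Matrix.mul_smul, Matrix.smul_mul, Matrix.mul_smul, smul_smul,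
        trace_smul,
    trace_smul, trace_smul, Matrix.trace_mul_comm B X, ← sq] at h
  have h' := (Complex.le_def.mp h).1
  simp [← Complex.ofReal_pow, ← sq] at h'
  linarith

/-- If the rank dropped, the support projections P of X and Q of T(X) would satisfy tr(P T*(1)) ≤
tr(Q T(1)) with tr P ≥ tr Q + 1. The resulting gap of 1 is too large for the two deviations from the
identity. -/
theorem rankNonDecreasing_of_DS_le (hN : 1 ≤ N) {T : Op N}
    (hT : ∀ X : Mat N, X.PosSemidef → (T X).PosSemidef) (hT' : (dual T 1).PosSemidef)
    (h : DS T ≤ 1 / N) : RankNonDecreasing T := by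
  intro X hX
  by_contra hlt
  push Not at hlt
  obtain ⟨P, c, hP, hP1, hPP, hPt, hPX, -⟩ := exists_support_projection hX
  obtain ⟨Q, -, hQ, hQ1, hQQ, hQt, -, hQX⟩ := exists_support_projection (hT X hX)
  have hT1 := hT 1 Matrix.PosSemidef.one
  have a1 : (T P).trace = (P * dual T 1).trace := by
    have := trace_mul_dual_of_isHermitian T P (Y := 1) (by simp [Matrix.IsHermitian]) hT'.1
    rwa [Matrix.mul_one] at this
  have a2 : (T 1).trace = (dual T 1).trace := by
    have := trace_mul_dual_of_isHermitian T 1 (Y := 1) (by simp [Matrix.IsHermitian]) hT'.1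
    rwa [Matrix.mul_one, Matrix.one_mul] at this
  -- P ≤ cX gives T(P) ≤ cT(X), and 1 - Q annihilates T(X); hence T(P) has no trace outside Q.
  have a3 : ((1 - Q) * T P).trace.re ≤ 0 := by
    have := (Complex.le_def.mp (trace_mul_nonneg hQ1 (hT _ hPX))).1
    rw [map_sub, map_smul, mul_sub, Matrix.mul_smul, hQX] at this
    simpa using this
  have a4 : (Q * T P).trace.re ≤ (Q * T 1).trace.re := by
    have := (Complex.le_def.mp (trace_mul_nonneg hQ (hT _ hP1))).1
    rw [map_sub, mul_sub] at this
    simpa using this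
  have hB : (T 1 - 1).IsHermitian := hT1.1.sub (by simp [Matrix.IsHermitian])
  have hE : (dual T 1 - 1).IsHermitian := hT'.1.sub (by simp [Matrix.IsHermitian])
  have refl : ∀ R : Mat N, R * R = R → ((2 : ℂ) • R - 1) * ((2 : ℂ) • R - 1) = 1 := by
    intro R hR
    rw [sub_mul, mul_sub, Matrix.smul_mul, Matrix.mul_smul, hR]
    simp only [Matrix.mul_one, Matrix.one_mul, two_smul]
    abel
  have herm : ∀ R : Mat N, R.IsHermitian → ((2 : ℂ) • R - 1).IsHermitian := by
    intro R hR
    rw [Matrix.IsHermitian, conjTranspose_sub, conjTranspose_smul, hR.eq]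
    simp
  -- The reflections 2Q - 1 and 2P - 1 replace the projections. Since tr T(1) = tr T*(1), they
  -- double the gap, and adding the two inequalities with t = N and t = -N gives 4N ≤ 2N + N² DS(T)
  -- ≤ 3N, a contradiction.
  have b1 := two_mul_trace_mul_le (herm Q hQ.1) (refl Q hQQ) hB N
  have b2 := two_mul_trace_mul_le (herm P hP.1) (refl P hPP) hE (-N)
  have hds : ((T 1 - 1) ^ 2).trace.re + ((dual T 1 - 1) ^ 2).trace.re ≤
      1 / (N : ℝ) := by
    simpa [DS] using h
  have hN' : (1 : ℝ) ≤ N := by exact_mod_cast hN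
  have hds2 : (N : ℝ) ^ 2 * (((T 1 - 1) ^ 2).trace.re + ((dual T 1 - 1) ^ 2).trace.re) ≤ N := by
    refine (mul_le_mul_of_nonneg_left hds (by positivity)).trans_eq ?_
    field_simp
  have c1 : (((2 : ℂ) • Q - 1) * (T 1 - 1)).trace.re =
      2 * (Q * T 1).trace.re - 2 * (T P).trace.re * 0 - 2 * Q.trace.re - (T 1).trace.re + N := by
    rw [sub_mul, Matrix.smul_mul, mul_sub]
    simp
    ring
  have c2 : (((2 : ℂ) • P - 1) * (dual T 1 - 1)).trace.re =
      2 * (P * dual T 1).trace.re - 2 * P.trace.re - (dual T 1).trace.re + N := by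
    rw [sub_mul, Matrix.smul_mul, mul_sub]
    simp
    ring
  rw [hQt] at c1
  rw [hPt] at c2
  rw [c1] at b1
  rw [c2] at b2
  rw [sub_mul, trace_sub, Matrix.one_mul, Complex.sub_re] at a3
  have hr : ((T X).rank : ℝ) + 1 ≤ X.rank := by exact_mod_cast hlt
  rw [a2] at b1
  rw [a1] at a3
  simp only [Complex.natCast_re] at b1 b2
  have : (N : ℝ) * ((P * dual T 1).trace.re - X.rank) + N ≤ N * ((Q * T 1).trace.re - (T X).rank) :=
      by
    rw [← mul_add_one]
    exact mul_le_mul_of_nonneg_left (by linarith) (by linarith)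
  nlinarith

end OperatorScaling

/-! ### A dominated Kraus operator with determinant of absolute value at least one. -/

namespace OperatorScaling

variable {N : ℕ}

/-- The determinant of B + tA is a polynomial in t of degree at most N; being nonzero at y, it
cannot vanish at all N + 1 points 0, …, N. -/
theorem exists_nat_det_add_smul_ne_zero {A B : Mat N} {y : ℂ} (h : (B + y • A).det ≠ 0) :
    ∃ k : ℕ, k ≤ N ∧ (B + (k : ℂ) • A).det ≠ 0 := by
  set f : Polynomial ℂ := det ((Polynomial.X :
      Polynomial ℂ) • A.map Polynomial.C + B.map Polynomial.C) with hf
  have hev : ∀ t : ℂ, f.eval t = (B + t • A).det := by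
    intro t
    rw [hf, ← Polynomial.coe_evalRingHom, RingHom.map_det]
    congr 1
    ext i j
    simp [Matrix.add_apply]
    ring
  by_contra hc
  push Not at hc
  have hf0 : f = 0 := by
    refine Polynomial.eq_zero_of_natDegree_lt_card_of_eval_eq_zero' f
      ((Finset.range (N + 1)).image (fun k : ℕ => (k : ℂ))) ?_ ?_
    · intro t ht
      obtain ⟨k, hk, rfl⟩ := Finset.mem_image.mp ht
      rw [hev]
      exact hc k (by simpa [Nat.lt_succ_iff] using hk)
    · rw [Finset.card_image_of_injective _ Nat.cast_injective, Finset.card_range]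
      have := Polynomial.natDegree_det_X_add_C_le A B
      rw [Fintype.card_fin] at this
      exact Nat.lt_succ_of_le this
  apply h
  rw [← hev, hf0, Polynomial.eval_zero]

/-- The coefficients are replaced by small natural numbers one at a time, each by the univariate
lemma. -/
theorem exists_nat_combination_det_ne_zero {ι : Type*} [Fintype ι] [DecidableEq ι]
    (C : ι → Mat N) {x : ι → ℂ} (h : (∑ p, x p • C p).det ≠ 0) :
    ∃ k : ι → ℕ, (∀ p, k p ≤ N) ∧ (∑ p, (k p : ℂ) • C p).det ≠ 0 := by
  have key : ∀ s : Finset ι, ∃ y : ι → ℂ, (∀ p ∈ s, ∃ k : ℕ, k ≤ N ∧ y p = k) ∧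
      (∑ p, y p • C p).det ≠ 0 := by
    intro s
    induction s using Finset.induction_on with
    | empty => exact ⟨x, by simp, h⟩
    | insert a s ha ih =>
      obtain ⟨y, hy, hd⟩ := ih
      rw [← Finset.sum_erase_add _ _ (Finset.mem_univ a)] at hd
      obtain ⟨k, hk, hk'⟩ := exists_nat_det_add_smul_ne_zero hd
      refine ⟨Function.update y a k, ?_, ?_⟩
      · intro p hp
        by_cases hpa : p = a
        · subst hpa; exact ⟨k, hk, by simp⟩
        · rw [Function.update_of_ne hpa]
          exact hy p (by simpa [hpa] using hp)
      · rw [← Finset.sum_erase_add _ _ (Finset.mem_univ a)]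
        rw [Function.update_self]
        convert hk' using 3
        refine Finset.sum_congr rfl fun p hp => ?_
        rw [Function.update_of_ne (Finset.ne_of_mem_erase hp)]
  obtain ⟨y, hy, hd⟩ := key Finset.univ
  choose k hk hk' using fun p => hy p (Finset.mem_univ p)
  exact ⟨k, hk, by simpa [← hk'] using hd⟩

/-- Write ρ = L†L and u = Lx. Then ρx = L†u, and uu† ≤ |u|² · 1 with |u|² = x†ρx ≤ c; conjugation by
L gives the claim. -/
theorem posSemidef_smul_sub_vecMulVec {n : Type*} [Fintype n] [DecidableEq n]
    {ρ : Matrix n n ℂ} (hρ : ρ.PosSemidef) (x : n → ℂ) {c : ℂ} (hc : star x ⬝ᵥ (ρ *ᵥ x) ≤ c) :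
    (c • ρ - vecMulVec (ρ *ᵥ x) (star (ρ *ᵥ x))).PosSemidef := by
  obtain ⟨L, rfl⟩ := exists_conjTranspose_mul_self hρ
  set u := L *ᵥ x with hu
  have h1 : (c • (1 : Matrix n n ℂ) - vecMulVec u (star u)).PosSemidef := by
    have ht : (vecMulVec u (star u)).trace = star x ⬝ᵥ ((Lᴴ * L) *ᵥ x) := by
      rw [trace_vecMulVec, ← mulVec_mulVec, dotProduct_mulVec, ← star_mulVec, dotProduct_comm]
    have h2 := posSemidef_le_trace (posSemidef_vecMulVec_self_star u)
    have h3 : ((c - (vecMulVec u (star u)).trace) • (1 : Matrix n n ℂ)).PosSemidef :=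
      Matrix.PosSemidef.one.smul (sub_nonneg.mpr (ht ▸ hc))
    convert h2.add h3 using 1
    rw [sub_smul]
    abel
  convert h1.conjTranspose_mul_mul_same L using 1
  rw [Matrix.mul_sub, Matrix.sub_mul, Matrix.mul_smul, Matrix.smul_mul, Matrix.mul_one,
    Matrix.mul_vecMulVec, Matrix.vecMulVec_mul, ← mulVec_mulVec, star_mulVec (Lᴴ),
        conjTranspose_conjTranspose]

/-- A nonsingular matrix in the image of an integral Choi matrix yields a Kraus operator that is
dominated by the operator and has a determinant of absolute value at least `1`. -/
theorem exists_dominated_kraus {ρ : Bipartite N ℤ} {M : ℕ}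
    (hρ : (ρ.map (Int.cast : ℤ → ℂ)).PosSemidef) (hM : ∀ p q, |ρ p q| ≤ (M : ℤ))
    (hns : HasNonsingular (imageSpace (ρ.map (Int.cast : ℤ → ℂ)))) :
    ∃ A : Mat N, 1 ≤ ‖A.det‖ ∧
      (((M * N ^ 6 : ℝ) : ℂ) • ρ.map (Int.cast : ℤ → ℂ) -
        vecMulVec A.vec (star A.vec)).PosSemidef := by
  obtain ⟨A, ⟨x, hx⟩, hA⟩ := hns
  -- The columns of ρ reshaped to matrices; they span the image.
  set C : Fin N × Fin N → Matrix (Fin N) (Fin N) ℤ := fun p => Matrix.of fun a j => ρ (j, a) p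
    with hC
  have hvec : ∀ y : Fin N × Fin N → ℂ, (∑ p, y p • (C p).map (Int.cast : ℤ → ℂ)).vec =
      ρ.map (Int.cast : ℤ → ℂ) *ᵥ y := by
    intro y
    ext ⟨j, a⟩
    simp [vec, Matrix.sum_apply, hC, mulVec, dotProduct, mul_comm]
  have hAx : A = ∑ p, x p • (C p).map (Int.cast : ℤ → ℂ) := by
    rw [← vec_inj, hvec]; exact hx.symm
  rw [hAx] at hA
  obtain ⟨k, hk, hd⟩ := exists_nat_combination_det_ne_zero _ hA.ne_zero
  set B : Matrix (Fin N) (Fin N) ℤ := Matrix.of fun i j => ∑ p, (k p : ℤ) * C p i j with hB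
  have hBc : (∑ p, (k p : ℂ) • (C p).map (Int.cast : ℤ → ℂ)) = B.map (Int.cast : ℤ → ℂ) := by
    ext i j
    simp [hB, Matrix.sum_apply]
  refine ⟨B.map (Int.cast : ℤ → ℂ), ?_, ?_⟩
  · rw [hBc] at hd
    have e : (B.map (Int.cast : ℤ → ℂ)).det = (B.det : ℂ) := (Int.cast_det B).symm
    rw [e] at hd ⊢
    have h0 : B.det ≠ 0 := by exact_mod_cast hd
    rw [Complex.norm_intCast]
    exact_mod_cast Int.one_le_abs h0
  · rw [← hBc, hvec]
    refine posSemidef_smul_sub_vecMulVec hρ _ ?_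
    have e : star (fun p => (k p : ℂ)) ⬝ᵥ (ρ.map (Int.cast : ℤ → ℂ) *ᵥ fun p => (k p : ℂ)) =
        (((∑ p, ∑ q, (k p : ℤ) * (ρ p q * k q) : ℤ) : ℝ) : ℂ) := by
      simp [dotProduct, mulVec, Finset.mul_sum]
    rw [e, Complex.real_le_real]
    -- There are N⁴ pairs (p, q), each contributing at most N · M · N. This is the origin of M N⁶.
    have : (∑ p, ∑ q, (k p : ℤ) * (ρ p q * k q)) ≤ M * N ^ 6 := by
      calc (∑ p, ∑ q, (k p : ℤ) * (ρ p q * k q))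
          ≤ ∑ _p : Fin N × Fin N, ∑ _q : Fin N × Fin N, (N : ℤ) * (M * N) := by
            refine Finset.sum_le_sum fun p _ => Finset.sum_le_sum fun q _ => ?_
            have h1 : (k p : ℤ) ≤ N := by exact_mod_cast hk p
            have h2 : (k q : ℤ) ≤ N := by exact_mod_cast hk q
            have h3 := (le_abs_self _).trans (hM p q)
            have h4 : ρ p q * k q ≤ M * N :=
              (mul_le_mul_of_nonneg_right h3 (by positivity)).trans
                (mul_le_mul_of_nonneg_left h2 (by positivity))
            exact (mul_le_mul_of_nonneg_left h4 (by positivity)).trans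
              (mul_le_mul_of_nonneg_right h1 (by positivity))
        _ = M * N ^ 6 := by simp; ring
    exact_mod_cast this

section Dominated

variable {ρ : Bipartite N ℂ} {A : Mat N} {c : ℝ}

theorem dualChoi_sub_smul_vecMulVec (X : Mat N) :
    opOfChoi (dualChoi ((c : ℂ) • ρ - vecMulVec A.vec (star A.vec))) X =
      (c : ℂ) • opOfChoi (dualChoi ρ) X - Aᴴ * X * A := by
  rw [← dual_opOfChoi_vecMulVec, ← opOfChoi_smul, ← opOfChoi_sub]
  congr 2
  ext p q
  simp [dualChoi]

theorem posSemidef_smul_opOfChoi_sub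
    (h : ((c : ℂ) • ρ - vecMulVec A.vec (star A.vec)).PosSemidef) {X : Mat N}
    (hX : X.PosSemidef) : ((c : ℂ) • opOfChoi ρ X - A * X * Aᴴ).PosSemidef := by
  have := opOfChoi_posSemidef h hX
  rwa [opOfChoi_sub, opOfChoi_smul, opOfChoi_vecMulVec] at this

theorem posSemidef_smul_dual_sub
    (h : ((c : ℂ) • ρ - vecMulVec A.vec (star A.vec)).PosSemidef) {X : Mat N}
    (hX : X.PosSemidef) : ((c : ℂ) • dual (opOfChoi ρ) X - Aᴴ * X * A).PosSemidef := by
  have := opOfChoi_posSemidef (dualChoi_posSemidef h) hX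
  rwa [dualChoi_sub_smul_vecMulVec, ← dual_opOfChoi] at this

/-- Monotonicity of log det applied to B X B† ≤ cY; since |det B| ≥ 1, the factor B can only help.
-/
theorem posDef_and_logDet_le {Y X B : Mat N} (hc : 0 < c) (hY : Y.PosSemidef) (hX : X.PosDef)
    (hB : 1 ≤ ‖B.det‖) (h : ((c : ℂ) • Y - B * X * Bᴴ).PosSemidef) :
    Y.PosDef ∧ logDet X ≤ N * Real.log c + logDet Y := by
  have hB0 : B.det ≠ 0 := by
    intro h0; rw [h0, norm_zero] at hB; linarith
  have h1 : (B * X * Bᴴ).PosDef := posDef_mul_mul_conjTranspose hB0 hX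
  have h2 : ((c : ℂ) • Y).PosDef := by
    have := h1.add_posSemidef h
    rwa [add_sub_cancel] at this
  have h3 := h2.det_pos.ne'
  rw [det_smul, mul_ne_zero_iff] at h3
  refine ⟨hY.posDef_iff_det_ne_zero.mpr h3.2, ?_⟩
  have h4 := logDet_le_logDet h1 h2 h
  have hX0 := hX.det_pos.ne'
  rw [logDet_smul hc h3.2, logDet_mul (by rw [det_mul]; exact mul_ne_zero hB0 hX0)
    (det_conjTranspose_ne_zero hB0), logDet_mul hB0 hX0, logDet_conjTranspose] at h4
  have h5 : 0 ≤ logDet B := Real.log_nonneg hB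
  linarith

end Dominated

end OperatorScaling

namespace OperatorScaling

variable {N : ℕ}

/-! ### Gauss–Jordan exchange steps -/

/-- Row k of B u = w is solved for u k, which needs a nonzero pivot, and the result is substituted
into the other rows. The new matrix describes the same relation with u k and w k exchanged. -/
theorem sweep_mulVec_iff {B : Matrix (Fin N) (Fin N) ℚ} {k : Fin N} (hk : B k k ≠ 0)
    (u w : Fin N → ℚ) :
    B *ᵥ u = w ↔ (sweep B k).val *ᵥ Function.update u k (w k) = Function.update w k (u k) := by
  set s : Fin N → ℚ := fun i => ∑ j ∈ Finset.univ.erase k, B i j * u j with hs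
  have h1 : ∀ i, (B *ᵥ u) i = s i + B i k * u k := fun i => by
    rw [mulVec, dotProduct, ← Finset.sum_erase_add _ _ (Finset.mem_univ k)]
  have hval : ∀ i j, (sweep B k).val i j = if i = k then (if j = k then 1 / B k k
      else 0 - B k j / B k k) else if j = k then B i k / B k k
      else B i j - B i k * B k j / B k k := by
    intro i j
    simp only [sweep, Counted.matrix, Matrix.of_apply]
    split_ifs <;> rfl
  have h2 : ((sweep B k).val *ᵥ Function.update u k (w k)) k = (w k - s k) / B k k := by
    rw [mulVec, dotProduct, ← Finset.sum_erase_add _ _ (Finset.mem_univ k)]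
    have : ∀ j ∈ Finset.univ.erase k, (sweep B k).val k j * Function.update u k (w k) j =
        - (B k j * u j) / B k k := by
      intro j hj
      have hj' := Finset.ne_of_mem_erase hj
      rw [hval, Function.update_of_ne hj']
      simp only [if_true, hj', if_false]
      ring
    rw [Finset.sum_congr rfl this, hval, ← Finset.sum_div, Finset.sum_neg_distrib]
    simp only [if_true, Function.update_self]
    ring
  have h3 : ∀ i, i ≠ k → ((sweep B k).val *ᵥ Function.update u k (w k)) i =
      s i + B i k * ((w k - s k) / B k k) := by
    intro i hi
    rw [mulVec, dotProduct, ← Finset.sum_erase_add _ _ (Finset.mem_univ k)]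
    have : ∀ j ∈ Finset.univ.erase k, (sweep B k).val i j * Function.update u k (w k) j =
        B i j * u j - B i k / B k k * (B k j * u j) := by
      intro j hj
      have hj' := Finset.ne_of_mem_erase hj
      rw [hval, Function.update_of_ne hj']
      simp only [hi, hj', if_false]
      ring
    rw [Finset.sum_congr rfl this, hval, Finset.sum_sub_distrib, ← Finset.mul_sum]
    simp only [if_true, Function.update_self, hi, if_false, hs]
    ring
  have hrow : (B *ᵥ u) k = w k ↔ (w k - s k) / B k k = u k := by
    rw [h1, div_eq_iff hk]
    constructor <;> intro h <;> linarith
  constructor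
  · intro h
    have hk' := hrow.mp (congrFun h k)
    ext i
    by_cases hi : i = k
    · subst hi
      rw [h2, Function.update_self, hk']
    · rw [h3 i hi, hk', Function.update_of_ne hi, ← h1, h]
  · intro h
    have hk' : (w k - s k) / B k k = u k := by
      have := congrFun h k
      rwa [h2, Function.update_self] at this
    ext i
    by_cases hi : i = k
    · subst hi
      exact hrow.mpr hk'
    · have := congrFun h i
      rwa [h3 i hi, hk', Function.update_of_ne hi, ← h1] at this

/-- `B` arises from `A` by exchanging the variables `x i` and `y i`, `i ∈ s`, in `A x = y`. -/
def IsExchange (A B : Matrix (Fin N) (Fin N) ℚ) (s : Finset (Fin N)) : Prop :=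
  ∀ x y, A *ᵥ x = y ↔
    B *ᵥ (fun i => if i ∈ s then y i else x i) = fun i => if i ∈ s then x i else y i

theorem IsExchange.sweep {A B : Matrix (Fin N) (Fin N) ℚ} {s : Finset (Fin N)}
    (h : IsExchange A B s) {k : Fin N} (hk : k ∉ s) (hB : B k k ≠ 0) :
    IsExchange A (sweep B k).val (insert k s) := by
  intro x y
  rw [h x y, sweep_mulVec_iff hB]
  have e : ∀ a b : Fin N → ℚ, Function.update (fun i => if i ∈ s then a i else b i) k (a k) =
      fun i => if i ∈ insert k s then a i else b i := by
    intro a b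
    ext i
    by_cases hi : i = k
    · subst hi; simp
    · simp [hi]
  simp only [hk, if_false]
  rw [e, e]

/-- Feed the k-th unit vector to the exchanged system. If the pivot vanishes, then in every
coordinate x i or y i is zero, so x · Ax = 0 although x k = 1. This is why no pivot search is
needed. -/
theorem IsExchange.pivot_ne_zero {A B : Matrix (Fin N) (Fin N) ℚ} {s : Finset (Fin N)}
    (h : IsExchange A B s) (hA : ∀ x, x ≠ 0 → x ⬝ᵥ (A *ᵥ x) ≠ 0) {k : Fin N} (hk : k ∉ s) :
    B k k ≠ 0 := by
  intro h0
  set u : Fin N → ℚ := Pi.single k 1 with hu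
  set w := B *ᵥ u with hw
  have hwk : w k = 0 := by rw [hw, hu, mulVec_single_one, col_apply, h0]
  set x : Fin N → ℚ := fun i => if i ∈ s then w i else u i with hx
  set y : Fin N → ℚ := fun i => if i ∈ s then u i else w i with hy
  have hxy : A *ᵥ x = y := by
    rw [h x y]
    have e1 : (fun i => if i ∈ s then y i else x i) = u := by
      ext i; by_cases hi : i ∈ s <;> simp [hx, hy, hi]
    have e2 : (fun i => if i ∈ s then x i else y i) = w := by
      ext i; by_cases hi : i ∈ s <;> simp [hx, hy, hi]
    rw [e1, e2]
  refine hA x ?_ ?_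
  · intro hx0
    have := congrFun hx0 k
    simp [hx, hk, hu] at this
  · rw [hxy, dotProduct]
    refine Finset.sum_eq_zero fun i _ => ?_
    by_cases hi : i = k
    · subst hi
      simp [hy, hk, hwk]
    · by_cases hi' : i ∈ s <;> simp [hx, hy, hi', hu, hi]

/-- The two conclusions separate correctness from success: any result returned is right, while
definiteness of A serves to exclude a vanishing pivot. -/
theorem sweepAll_isExchange {A : Matrix (Fin N) (Fin N) ℚ} (l : List (Fin N)) :
    ∀ (s : Finset (Fin N)) (B : Matrix (Fin N) (Fin N) ℚ), l.Nodup → (∀ k ∈ l, k ∉ s) →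
      IsExchange A B s →
      (∀ D, (sweepAll l B).val = some D → IsExchange A D (s ∪ l.toFinset)) ∧
      ((∀ x, x ≠ 0 → x ⬝ᵥ (A *ᵥ x) ≠ 0) → ∃ D, (sweepAll l B).val = some D) := by
  induction l with
  | nil =>
    intro s B _ _ h
    refine ⟨fun D hD => ?_, fun _ => ⟨B, rfl⟩⟩
    have : B = D := by simpa [sweepAll, pure] using hD
    simpa [← this] using h
  | cons k l ih =>
    intro s B hl hs h
    have hk := hs k (by simp)
    have hval : (sweepAll (k :: l) B).val =
        if B k k = 0 then none else (sweepAll l (sweep B k).val).val := by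
      simp only [sweepAll, bind, Counted.rIsZero]
      by_cases h0 : B k k = 0 <;> simp [h0, pure]
    rw [hval]
    have step : B k k ≠ 0 → _ := fun h0 => ih (insert k s) (OperatorScaling.sweep B k).val
      (List.nodup_cons.mp hl).2 (fun j hj => by
        rw [Finset.mem_insert, not_or]
        exact ⟨fun e => (List.nodup_cons.mp hl).1 (e ▸ hj), hs j (by simp [hj])⟩) (h.sweep hk h0)
    constructor
    · intro D hD
      split_ifs at hD with h0
      have := (step h0).1 D hD
      rwa [List.toFinset_cons, Finset.union_insert, ← Finset.insert_union]
    · intro hA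
      have h0 := h.pivot_ne_zero hA hk
      rw [if_neg h0]
      exact (step h0).2 hA

theorem isExchange_self (A : Matrix (Fin N) (Fin N) ℚ) : IsExchange A A ∅ := by
  intro x y; simp

theorem mul_eq_one_of_invert {A B : Matrix (Fin N) (Fin N) ℚ} (h : (invert A).val = some B) :
    A * B = 1 := by
  have := (sweepAll_isExchange (A := A) (List.finRange N) ∅ A (List.nodup_finRange N) (by simp)
    (isExchange_self A)).1 B h
  -- With all variables exchanged, Ax = y is equivalent to By = x.
  have h2 : ∀ x y, A *ᵥ x = y ↔ B *ᵥ y = x := by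
    intro x y
    have := this x y
    simpa using this
  refine Matrix.ext_of_mulVec_single fun i => ?_
  rw [← mulVec_mulVec, one_mulVec, h2]

theorem exists_invert {A : Matrix (Fin N) (Fin N) ℚ} (hA : ∀ x, x ≠ 0 → x ⬝ᵥ (A *ᵥ x) ≠ 0) :
    ∃ B, (invert A).val = some B :=
  (sweepAll_isExchange (A := A) (List.finRange N) ∅ A (List.nodup_finRange N) (by simp)
    (isExchange_self A)).2 hA

/-! ### The rational algorithm in complex terms -/

/-- The complex matrix with the given rational entries. -/
abbrev toComplex (A : Matrix (Fin N) (Fin N) ℚ) : Mat N := A.map (Rat.cast : ℚ → ℂ)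

theorem toComplex_mul (A B : Matrix (Fin N) (Fin N) ℚ) :
    toComplex (A * B) = toComplex A * toComplex B := by
  ext i j; simp [Matrix.mul_apply]

theorem toComplex_sub (A B : Matrix (Fin N) (Fin N) ℚ) :
    toComplex (A - B) = toComplex A - toComplex B := by
  ext i j; simp

theorem toComplex_one : toComplex (1 : Matrix (Fin N) (Fin N) ℚ) = 1 := by
  exact Matrix.map_one _ Rat.cast_zero Rat.cast_one

theorem toComplex_of_mul_eq_one {A B : Matrix (Fin N) (Fin N) ℚ} (h : A * B = 1) :
    toComplex A * toComplex B = 1 := by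
  rw [← toComplex_mul, h, toComplex_one]

theorem exists_invert_of_posDef {A : Matrix (Fin N) (Fin N) ℚ} (hA : (toComplex A).PosDef) :
    ∃ B, (invert A).val = some B := by
  refine exists_invert fun x hx h0 => ?_
  have hx' : (fun i => (x i : ℂ)) ≠ 0 := by
    intro h
    apply hx
    ext i
    have := congrFun h i
    simpa using this
  have := hA.dotProduct_mulVec_pos hx'
  have e : star (fun i => (x i : ℂ)) ⬝ᵥ (toComplex A *ᵥ fun i => (x i : ℂ)) =
      ((x ⬝ᵥ (A *ᵥ x) : ℚ) : ℂ) := by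
    simp [dotProduct, mulVec]
  rw [e, h0] at this
  simp at this

theorem toComplex_applyOp (ρ : Bipartite N ℚ) (X : Matrix (Fin N) (Fin N) ℚ) :
    toComplex (applyOp ρ X).val = opOfChoi (ρ.map (Rat.cast : ℚ → ℂ)) (toComplex X) := by
  ext a b
  rw [opOfChoi_apply]
  simp [applyOp, Counted.matrix, Counted.sum, Counted.rMul]

theorem toComplex_applyDual (ρ : Bipartite N ℚ) (X : Matrix (Fin N) (Fin N) ℚ) :
    toComplex (applyDual ρ X).val = dual (opOfChoi (ρ.map (Rat.cast : ℚ → ℂ))) (toComplex X) := by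
  ext a b
  rw [dual_opOfChoi, opOfChoi_apply]
  simp [applyDual, Counted.matrix, Counted.sum, Counted.rMul, dualChoi]

theorem defect_val (A B : Matrix (Fin N) (Fin N) ℚ) :
    (((defect A B).val : ℚ) : ℝ) = ((toComplex A * toComplex B - 1) ^ 2).trace.re := by
  have h : (defect A B).val = ((A * B - 1) ^ 2).trace := by
    simp only [defect, matMul, Counted.matrix, Counted.sum, Counted.rMul, Counted.rSub, bind,
      Matrix.trace, sq, Matrix.mul_apply, Matrix.diag_apply, Matrix.of_apply, Matrix.sub_apply,
      Matrix.one_apply]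
  have h2 : ((toComplex A * toComplex B - 1) ^ 2).trace = ((((A * B - 1) ^ 2).trace : ℚ) : ℂ) := by
    have e : (toComplex A * toComplex B - 1) ^ 2 = toComplex ((A * B - 1) ^ 2) := by
      rw [sq, sq, toComplex_mul, toComplex_sub, toComplex_mul, toComplex_one]
    rw [e]
    simp [Matrix.trace]
  rw [h, h2]
  simp

/-- `DS` of the operator `T` scaled according to `P = L†L` and `Q = R†R`. -/
noncomputable def scaledDS (T : Op N) (P Q : Mat N) : ℝ :=
  ((P * T Q - 1) ^ 2).trace.re + ((Q * dual T P - 1) ^ 2).trace.re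

theorem iteration_val_fst (ρ : Bipartite N ℚ) (n : ℕ) (s : ScalingState N) :
    (((iteration ρ n s).val.1 : ℚ) : ℝ) =
      scaledDS (opOfChoi (ρ.map (Rat.cast : ℚ → ℂ))) (toComplex s.P) (toComplex s.Q) := by
  have h : (iteration ρ n s).val.1 =
      (defect s.P (applyOp ρ s.Q).val).val + (defect s.Q (applyDual ρ s.P).val).val := by
    simp only [iteration, bind, Counted.rAdd]
    split_ifs <;> rfl
  rw [h, scaledDS, Rat.cast_add, defect_val, defect_val, toComplex_applyOp, toComplex_applyDual]

theorem iteration_val_snd (ρ : Bipartite N ℚ) (n : ℕ) (s : ScalingState N) :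
    (iteration ρ n s).val.2 = if n % 2 = 0 then
      (invert (applyOp ρ s.Q).val).val.map (fun P => ⟨P, s.Q⟩) else
      (invert (applyDual ρ s.P).val).val.map (fun Q => ⟨s.P, Q⟩) := by
  simp only [iteration, bind]
  split_ifs <;> rfl

/-- The state consists of positive definite matrices. -/
def ScalingState.IsPosDef (s : ScalingState N) : Prop :=
  (toComplex s.P).PosDef ∧ (toComplex s.Q).PosDef

theorem posDef_of_mul_eq_one {A B : Mat N} (hA : A.PosSemidef) (h : A * B = 1) :
    A.PosDef ∧ B = A⁻¹ ∧ B.PosDef := by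
  have hd : A.det ≠ 0 := by
    intro h0
    have := congrArg det h
    rw [det_mul, h0, zero_mul, det_one] at this
    exact zero_ne_one this
  have h1 := hA.posDef_iff_det_ne_zero.mpr hd
  have h2 : B = A⁻¹ := (inv_eq_right_inv h).symm
  exact ⟨h1, h2, h2 ▸ h1.inv⟩

section

variable {ρ : Bipartite N ℚ} (hρ : (ρ.map (Rat.cast : ℚ → ℂ)).PosSemidef)

include hρ

theorem iteration_next {s s' : ScalingState N} {n : ℕ} (hs : s.IsPosDef)
    (h : (iteration ρ n s).val.2 = some s') :
    s'.IsPosDef ∧ if n % 2 = 0 then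
      toComplex s'.P = (opOfChoi (ρ.map (Rat.cast : ℚ → ℂ)) (toComplex s.Q))⁻¹ ∧ s'.Q = s.Q else
      toComplex s'.Q = (dual (opOfChoi (ρ.map (Rat.cast : ℚ → ℂ))) (toComplex s.P))⁻¹ ∧
        s'.P = s.P := by
  rw [iteration_val_snd] at h
  split_ifs at h ⊢ with hn
  · obtain ⟨P, hP, rfl⟩ := Option.map_eq_some_iff.mp h
    have h1 := toComplex_of_mul_eq_one (mul_eq_one_of_invert hP)
    rw [toComplex_applyOp] at h1
    obtain ⟨h2, h3, h4⟩ := posDef_of_mul_eq_one (opOfChoi_posSemidef hρ hs.2.posSemidef) h1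
    exact ⟨⟨h4, hs.2⟩, h3, rfl⟩
  · obtain ⟨Q, hQ, rfl⟩ := Option.map_eq_some_iff.mp h
    have h1 := toComplex_of_mul_eq_one (mul_eq_one_of_invert hQ)
    rw [toComplex_applyDual] at h1
    obtain ⟨h2, h3, h4⟩ := posDef_of_mul_eq_one (dual_posSemidef hρ hs.1.posSemidef) h1
    exact ⟨⟨hs.1, h4⟩, h3, rfl⟩

end

theorem isPosDef_one : (⟨1, 1⟩ : ScalingState N).IsPosDef := by
  simp only [ScalingState.IsPosDef, toComplex_one, and_self]
  exact Matrix.PosDef.one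

/-- Soundness for arbitrary P and Q, not just for Sinkhorn iterates, so that it also certifies
acceptance in the gradient descent. -/
theorem rankNonDecreasing_of_scaledDS_le (hN : 1 ≤ N) {ρ : Bipartite N ℂ} (hρ : ρ.PosSemidef)
    {P Q : Mat N} (hP : P.PosSemidef) (hQ : Q.PosDef) (h : scaledDS (opOfChoi ρ) P Q ≤ 1 / N) :
    RankNonDecreasing (opOfChoi ρ) := by
  obtain ⟨L, rfl⟩ := exists_conjTranspose_mul_self hP
  obtain ⟨R, rfl⟩ := exists_conjTranspose_mul_self hQ.posSemidef
  have hR := hQ.det_pos.ne'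
  rw [det_mul, mul_ne_zero_iff] at hR
  refine RankNonDecreasing.of_scale (L := L) hR.2.isUnit
    (rankNonDecreasing_of_DS_le hN ?_ ?_ (by rwa [DS_scale]))
  · intro X hX
    exact (opOfChoi_posSemidef hρ (hX.conjTranspose_mul_mul_same R)).mul_mul_conjTranspose_same L
  · rw [dual_scale_apply]
    exact (dual_posSemidef hρ (Matrix.PosSemidef.one.conjTranspose_mul_mul_same L)).mul_mul_conjTranspose_same R

/-- Replaces the loop with early exit by a search along the trajectory `stateAt`, which is
indifferent to acceptance. -/
theorem search_eq_true_iff (ρ : Bipartite N ℚ) (fuel : ℕ) : ∀ (n : ℕ) (s : ScalingState N),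
    stateAt ρ n = some s →
    ((search ρ fuel n s).val = true ↔ ∃ k, n ≤ k ∧ k < n + fuel ∧ ∃ s', stateAt ρ k = some s' ∧
      (iteration ρ k s').val.1 ≤ 1 / N) := by
  induction fuel with
  | zero =>
    intro n s _
    simp only [search, pure]
    constructor
    · intro h; simp at h
    · rintro ⟨k, h1, h2, -⟩; omega
  | succ fuel ih =>
    intro n s hs
    have hval : (search ρ (fuel + 1) n s).val = if (iteration ρ n s).val.1 ≤ 1 / (N : ℚ) then true
        else match (iteration ρ n s).val.2 with
          | none => false
          | some s' => (search ρ fuel (n + 1) s').val := by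
      simp only [search, bind, Counted.rDiv, Counted.rLe]
      by_cases h : (iteration ρ n s).val.1 ≤ 1 / (N : ℚ)
      · simp only [h, decide_true, if_true, pure]
      · simp only [h, decide_false, if_false]
        cases (iteration ρ n s).val.2 <;> rfl
    rw [hval]
    split_ifs with h
    · simp only [true_iff]
      exact ⟨n, le_rfl, by omega, s, hs, h⟩
    · have hnext : stateAt ρ (n + 1) = (iteration ρ n s).val.2 := by
        rw [stateAt, hs]; rfl
      have key : (∃ k, n ≤ k ∧ k < n + (fuel + 1) ∧ ∃ s', stateAt ρ k = some s' ∧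
          (iteration ρ k s').val.1 ≤ 1 / (N : ℚ)) ↔ ∃ k, n + 1 ≤ k ∧ k < n + 1 + fuel ∧
          ∃ s', stateAt ρ k = some s' ∧ (iteration ρ k s').val.1 ≤ 1 / (N : ℚ) := by
        constructor
        · rintro ⟨k, h1, h2, s', h3, h4⟩
          refine ⟨k, ?_, by omega, s', h3, h4⟩
          rcases h1.eq_or_lt with e | e
          · subst e
            rw [hs, Option.some_inj] at h3
            subst h3
            exact absurd h4 h
          · exact e
        · rintro ⟨k, h1, h2, h3⟩
          exact ⟨k, by omega, by omega, h3⟩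
      rw [key]
      cases he : (iteration ρ n s).val.2 with
      | none =>
        rw [he] at hnext
        -- After a failed inversion the trajectory stays undefined, which matches the rejection by
        -- the loop.
        have hnone : ∀ j, stateAt ρ (n + 1 + j) = none := by
          intro j
          induction j with
          | zero => exact hnext
          | succ j ihj => rw [← Nat.add_assoc, stateAt, ihj]; rfl
        simp only [Bool.false_eq_true, false_iff]
        rintro ⟨k, h1, h2, s', h3, -⟩
        obtain ⟨j, rfl⟩ := Nat.exists_eq_add_of_le h1
        rw [hnone] at h3
        simp at h3
      | some s' => exact ih (n + 1) s' (by rw [hnext, he])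

theorem decideEdmonds_eq_true_iff (ρ : Bipartite N ℚ) (L : ℕ) :
    (decideEdmonds ρ L).val = true ↔ ∃ k ≤ L, ∃ s, stateAt ρ k = some s ∧
      (iteration ρ k s).val.1 ≤ 1 / N := by
  rw [decideEdmonds, search_eq_true_iff ρ (L + 1) 0 ⟨1, 1⟩ rfl]
  constructor
  · rintro ⟨k, -, h1, h2⟩; exact ⟨k, by omega, h2⟩
  · rintro ⟨k, h1, h2⟩; exact ⟨k, by omega, by omega, h2⟩

theorem stateAt_isPosDef {ρ : Bipartite N ℚ} (hρ : (ρ.map (Rat.cast : ℚ → ℂ)).PosSemidef) (n : ℕ) :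
    ∀ s, stateAt ρ n = some s → s.IsPosDef := by
  induction n with
  | zero =>
    intro s hs
    simp only [stateAt, Option.some_inj] at hs
    exact hs ▸ isPosDef_one
  | succ n ih =>
    intro s hs
    rw [stateAt, Option.bind_eq_some_iff] at hs
    obtain ⟨s', h1, h2⟩ := hs
    exact (iteration_next hρ (ih s' h1) h2).1

end OperatorScaling

namespace OperatorScaling

variable {N : ℕ}

/-! ### Operator Sinkhorn scaling and the states of the rational algorithm -/

/-- With Q = R†R and t = tr(R⁻¹†R⁻¹) one has tQ ≥ 1, hence tT(Q) ≥ T(1). So nonsingularity at the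
identity is enough for all later inversions. -/
theorem posDef_apply_of_posDef_apply_one {T : Op N}
    (hT : ∀ X : Mat N, X.PosSemidef → (T X).PosSemidef) (h1 : (T 1).PosDef) {Q : Mat N}
    (hQ : Q.PosDef) : (T Q).PosDef := by
  obtain ⟨R, rfl⟩ := exists_conjTranspose_mul_self hQ.posSemidef
  have hR := hQ.det_pos.ne'
  rw [det_mul, mul_ne_zero_iff] at hR
  have hu := hR.2.isUnit
  set t := ((R⁻¹)ᴴ * R⁻¹).trace with ht
  have h2 := (posSemidef_le_trace (posSemidef_conjTranspose_mul_self R⁻¹)).conjTranspose_mul_mul_same R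
  have e : Rᴴ * (t • (1 : Mat N) - (R⁻¹)ᴴ * R⁻¹) * R = t • (Rᴴ * R) - 1 := by
    have e1 : Rᴴ * R⁻¹ᴴ = 1 := by
      rw [← conjTranspose_mul, Matrix.nonsing_inv_mul _ hu, conjTranspose_one]
    rw [Matrix.mul_sub, Matrix.sub_mul, Matrix.mul_smul, Matrix.smul_mul, Matrix.mul_one,
      ← Matrix.mul_assoc, e1, Matrix.one_mul, Matrix.nonsing_inv_mul _ hu]
  rw [e] at h2
  have h3 := hT _ h2
  rw [map_sub, map_smul] at h3
  have h4 := h1.add_posSemidef h3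
  rw [add_sub_cancel] at h4
  have h5 := h4.det_pos.ne'
  rw [det_smul, mul_ne_zero_iff] at h5
  exact (hT _ hQ.posSemidef).posDef_iff_det_ne_zero.mpr h5.2

theorem invSqrt_mul_self {B : Mat N} (hB : B.PosDef) :
    (invSqrt B).IsHermitian ∧ invSqrt B * invSqrt B = B⁻¹ := by
  have h := Matrix.nonneg_iff_posSemidef.mpr hB.inv.posSemidef
  exact ⟨(Matrix.nonneg_iff_posSemidef.mp (CFC.sqrt_nonneg B⁻¹)).1, CFC.sqrt_mul_sqrt_self _ h⟩

theorem invSqrt_det_ne_zero {B : Mat N} (hB : B.PosDef) : (invSqrt B).det ≠ 0 := by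
  intro h
  have := congrArg det (invSqrt_mul_self hB).2
  rw [det_mul, h, zero_mul] at this
  exact hB.inv.det_pos.ne' this.symm

/-- Normalising the scaled operator replaces L by (LSL†)^{-1/2} L, and L cancels from L†(LSL†)⁻¹L.
This is why the rational update is plain inversion. -/
theorem invSqrt_conj {L S : Mat N} (hL : L.det ≠ 0) (hS : S.PosDef) :
    (invSqrt (L * S * Lᴴ) * L)ᴴ * (invSqrt (L * S * Lᴴ) * L) = S⁻¹ := by
  have hB := posDef_mul_mul_conjTranspose hL hS
  obtain ⟨h1, h2⟩ := invSqrt_mul_self hB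
  have hL' := (det_conjTranspose_ne_zero hL).isUnit
  calc _ = Lᴴ * (invSqrt (L * S * Lᴴ) * invSqrt (L * S * Lᴴ)) * L := by
        rw [conjTranspose_mul, h1.eq]; simp only [Matrix.mul_assoc]
    _ = S⁻¹ := by
        rw [h2, Matrix.mul_inv_rev, Matrix.mul_inv_rev, ← Matrix.mul_assoc,
          Matrix.mul_nonsing_inv _ hL', Matrix.one_mul, Matrix.mul_assoc,
          Matrix.nonsing_inv_mul _ hL.isUnit, Matrix.mul_one]

section

variable {ρ : Bipartite N ℚ} (hρ : (ρ.map (Rat.cast : ℚ → ℂ)).PosSemidef)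

include hρ

theorem scalable_posDef (h : Scalable (opOfChoi (ρ.map (Rat.cast : ℚ → ℂ)))) :
    (opOfChoi (ρ.map (Rat.cast : ℚ → ℂ)) 1).PosDef ∧
      (dual (opOfChoi (ρ.map (Rat.cast : ℚ → ℂ))) 1).PosDef :=
  ⟨(opOfChoi_posSemidef hρ Matrix.PosSemidef.one).posDef_iff_det_ne_zero.mpr h.1.ne_zero,
    (dual_posSemidef hρ Matrix.PosSemidef.one).posDef_iff_det_ne_zero.mpr h.2.ne_zero⟩

theorem exists_next_state (h : Scalable (opOfChoi (ρ.map (Rat.cast : ℚ → ℂ)))) {s : ScalingState N}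
    (hs : s.IsPosDef) (n : ℕ) : ∃ s', (iteration ρ n s).val.2 = some s' := by
  obtain ⟨h1, h2⟩ := scalable_posDef hρ h
  rw [iteration_val_snd]
  split_ifs
  · obtain ⟨P, hP⟩ := exists_invert_of_posDef (A := (applyOp ρ s.Q).val) (by
      rw [toComplex_applyOp]
      exact posDef_apply_of_posDef_apply_one (fun X => opOfChoi_posSemidef hρ) h1 hs.2)
    exact ⟨_, by rw [hP]; rfl⟩
  · obtain ⟨P, hP⟩ := exists_invert_of_posDef (A := (applyDual ρ s.P).val) (by
      rw [toComplex_applyDual]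
      exact posDef_apply_of_posDef_apply_one (fun X => dual_posSemidef hρ) h2 hs.1)
    exact ⟨_, by rw [hP]; rfl⟩

/-- The state before iteration `n` represents the operator `T_n`. -/
theorem exists_stateAt_osi (h : Scalable (opOfChoi (ρ.map (Rat.cast : ℚ → ℂ)))) (n : ℕ) :
    ∃ s, stateAt ρ n = some s ∧ ∃ L R : Mat N, L.det ≠ 0 ∧ R.det ≠ 0 ∧
      toComplex s.P = Lᴴ * L ∧ toComplex s.Q = Rᴴ * R ∧
      osi (opOfChoi (ρ.map (Rat.cast : ℚ → ℂ))) n =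
        scale L R (opOfChoi (ρ.map (Rat.cast : ℚ → ℂ))) := by
  obtain ⟨h1, h2⟩ := scalable_posDef hρ h
  set T := opOfChoi (ρ.map (Rat.cast : ℚ → ℂ)) with hT
  induction n with
  | zero =>
    refine ⟨⟨1, 1⟩, rfl, 1, 1, by simp, by simp, ?_, ?_, ?_⟩
    · rw [toComplex_one]; simp
    · rw [toComplex_one]; simp
    · rw [scale_one_one]; rfl
  | succ n ih =>
    obtain ⟨s, hs, L, R, hL, hR, hP, hQ, ho⟩ := ih
    have hsp := stateAt_isPosDef hρ n s hs
    obtain ⟨s', hs'⟩ := exists_next_state hρ h hsp n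
    refine ⟨s', by rw [stateAt, hs]; exact hs', ?_⟩
    obtain ⟨-, hnext⟩ := iteration_next hρ hsp hs'
    by_cases hn : n % 2 = 0
    · rw [if_pos hn] at hnext
      have hS := posDef_apply_of_posDef_apply_one (fun X => opOfChoi_posSemidef hρ) h1 hsp.2
      have hT1 : osi T n 1 = L * T (toComplex s.Q) * Lᴴ := by
        rw [ho, scale_apply, Matrix.mul_one, hQ]
      refine ⟨invSqrt (osi T n 1) * L, R, ?_, hR, ?_, by rw [hnext.2, hQ], ?_⟩
      · rw [det_mul]
        refine mul_ne_zero (invSqrt_det_ne_zero ?_) hL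
        rw [hT1]; exact posDef_mul_mul_conjTranspose hL hS
      · rw [hnext.1, hT1, invSqrt_conj hL hS]
      · rw [osi, if_pos (Nat.even_iff.mpr hn), rowScale]
        conv_lhs => rw [ho]
        rw [scale_scale, Matrix.one_mul, ho]
    · rw [if_neg hn] at hnext
      have hS := posDef_apply_of_posDef_apply_one (fun X => dual_posSemidef hρ) h2 hsp.1
      have hT1 : dual (osi T n) 1 = R * dual T (toComplex s.P) * Rᴴ := by
        rw [ho, dual_scale_apply, Matrix.mul_one, hP]
      refine ⟨L, invSqrt (dual (osi T n) 1) * R, hL, ?_, by rw [hnext.2, hP], ?_, ?_⟩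
      · rw [det_mul]
        refine mul_ne_zero (invSqrt_det_ne_zero ?_) hR
        rw [hT1]; exact posDef_mul_mul_conjTranspose hR hS
      · rw [hnext.1, hT1, invSqrt_conj hR hS]
      · rw [osi, if_neg (by rwa [Nat.even_iff]), colScale]
        conv_lhs => rw [ho]
        rw [scale_scale, Matrix.one_mul, ho]

theorem exists_stateAt_iteration_eq (h : Scalable (opOfChoi (ρ.map (Rat.cast : ℚ → ℂ)))) (n : ℕ) :
    ∃ s, stateAt ρ n = some s ∧ (((iteration ρ n s).val.1 : ℚ) : ℝ) =
      DS (osi (opOfChoi (ρ.map (Rat.cast : ℚ → ℂ))) n) := by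
  obtain ⟨s, hs, L, R, -, -, hP, hQ, ho⟩ := exists_stateAt_osi hρ h n
  exact ⟨s, hs, by rw [iteration_val_fst, ho, DS_scale, scaledDS, hP, hQ]⟩

theorem rankNonDecreasing_of_iteration_le (hN : 1 ≤ N) {s : ScalingState N} (hs : s.IsPosDef)
    {n : ℕ} (h : (iteration ρ n s).val.1 ≤ 1 / N) :
    RankNonDecreasing (opOfChoi (ρ.map (Rat.cast : ℚ → ℂ))) := by
  refine rankNonDecreasing_of_scaledDS_le hN hρ hs.1.posSemidef hs.2 ?_
  rw [← iteration_val_fst ρ n s]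
  have h' : (((iteration ρ n s).val.1 : ℚ) : ℝ) ≤ ((1 / (N : ℚ) : ℚ) : ℝ) := by exact_mod_cast h
  simpa using h'

end

/-! ### Convergence -/

theorem trace_mul_dual_comm {ρ : Bipartite N ℂ} (hρ : ρ.PosSemidef) {P Q : Mat N}
    (hP : P.PosSemidef) :
    (Q * dual (opOfChoi ρ) P).trace = (P * opOfChoi ρ Q).trace := by
  rw [← trace_mul_dual_of_isHermitian _ _ hP.1 (dual_posSemidef hρ hP).1, Matrix.trace_mul_comm]

/-- The inequality `le_trace_sub_logDet` at the multiple t of the identity with t = 1/(NM), using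
that tr T(1) is a sum of N² entries of ρ. -/
theorem logDet_apply_one_le (hN : 1 ≤ N) {ρ : Bipartite N ℂ} {M : ℕ} (hM1 : 1 ≤ M)
    (hM : ∀ p q, ‖ρ p q‖ ≤ M) (h1 : (opOfChoi ρ 1).PosDef) :
    logDet (opOfChoi ρ 1) ≤ N * Real.log (N * M) := by
  have hN' : (1 : ℝ) ≤ N := by exact_mod_cast hN
  have hM' : (1 : ℝ) ≤ M := by exact_mod_cast hM1
  set t : ℝ := (N * M : ℝ)⁻¹ with ht
  have ht0 : 0 < t := by positivity
  have hone : (1 : Mat N).det ≠ 0 := by simp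
  have h2 := le_trace_sub_logDet (P := (t : ℂ) • (1 : Mat N))
    (Matrix.PosDef.one.smul (by exact_mod_cast ht0)) h1
  rw [logDet_smul ht0 hone, logDet_one, Matrix.smul_mul, Matrix.one_mul, trace_smul, smul_eq_mul,
    Complex.re_ofReal_mul, ht, Real.log_inv] at h2
  have h3 : (opOfChoi ρ 1).trace.re ≤ N * (N * M) := by
    refine (Complex.re_le_norm _).trans ?_
    have e : (opOfChoi ρ 1).trace = ∑ a, ∑ i, ρ (i, a) (i, a) := by
      simp [Matrix.trace, opOfChoi_apply, Matrix.one_apply]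
    rw [e]
    calc ‖∑ a, ∑ i, ρ (i, a) (i, a)‖ ≤ ∑ _a : Fin N, ∑ _i : Fin N, (M : ℝ) :=
          (norm_sum_le _ _).trans (Finset.sum_le_sum fun a _ =>
            (norm_sum_le _ _).trans (Finset.sum_le_sum fun i _ => hM _ _))
      _ = N * (N * M) := by simp
  have h4 : (N * M : ℝ)⁻¹ * (opOfChoi ρ 1).trace.re ≤ N := by
    rw [inv_mul_le_iff₀ (by positivity)]
    linarith
  linarith

section

variable {ρ : Bipartite N ℤ} {M : ℕ} (hρ : (ρ.map (Int.cast : ℤ → ℂ)).PosSemidef)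

theorem map_intCast_map_ratCast (ρ : Bipartite N ℤ) :
    (ρ.map (Int.cast : ℤ → ℚ)).map (Rat.cast : ℚ → ℂ) = ρ.map (Int.cast : ℤ → ℂ) := by
  ext p q; simp

include hρ

/-- Lower bounds that replace the capacity in the presence of a nonsingular matrix. -/
theorem logDet_bounds (hN : 1 ≤ N) (hM : ∀ p q, |ρ p q| ≤ (M : ℤ))
    (hns : HasNonsingular (imageSpace (ρ.map (Int.cast : ℤ → ℂ)))) :
    1 ≤ M ∧ ∀ X : Mat N, X.PosDef →
      ((opOfChoi (ρ.map (Int.cast : ℤ → ℂ)) X).PosDef ∧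
        logDet X ≤ N * Real.log (M * N ^ 6) + logDet (opOfChoi (ρ.map (Int.cast : ℤ → ℂ)) X)) ∧
      ((dual (opOfChoi (ρ.map (Int.cast : ℤ → ℂ))) X).PosDef ∧
        logDet X ≤ N * Real.log (M * N ^ 6) +
          logDet (dual (opOfChoi (ρ.map (Int.cast : ℤ → ℂ))) X)) := by
  have hN' : (1 : ℝ) ≤ N := by exact_mod_cast hN
  have hM1 : 1 ≤ M := by
    by_contra hlt
    have hM0 : M = 0 := by omega
    obtain ⟨A, ⟨x, hx⟩, hA⟩ := hns
    have h0 : ρ.map (Int.cast : ℤ → ℂ) = 0 := by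
      ext p q
      have := hM p q
      rw [hM0, Nat.cast_zero, abs_nonpos_iff] at this
      simp [this]
    rw [h0] at hx
    have hA0 : A = 0 := by
      rw [← vec_inj, ← hx]; simp
    have : Nonempty (Fin N) := Fin.pos_iff_nonempty.mp hN
    rw [hA0, det_zero] at hA
    exact not_isUnit_zero hA
  have hM' : (1 : ℝ) ≤ M := by exact_mod_cast hM1
  obtain ⟨A, hA, hd⟩ := exists_dominated_kraus hρ hM hns
  have hc : (0 : ℝ) < M * N ^ 6 := by positivity
  refine ⟨hM1, fun X hX => ⟨?_, ?_⟩⟩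
  · exact posDef_and_logDet_le hc (opOfChoi_posSemidef hρ hX.posSemidef) hX hA
      (posSemidef_smul_opOfChoi_sub hd hX.posSemidef)
  · refine posDef_and_logDet_le (B := Aᴴ) hc (dual_posSemidef hρ hX.posSemidef) hX
      (by rwa [det_conjTranspose, norm_star]) ?_
    rw [conjTranspose_conjTranspose]
    exact posSemidef_smul_dual_sub hd hX.posSemidef

theorem scalable_of_hasNonsingular (hN : 1 ≤ N) (hM : ∀ p q, |ρ p q| ≤ (M : ℤ))
    (hns : HasNonsingular (imageSpace (ρ.map (Int.cast : ℤ → ℂ)))) :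
    Scalable (opOfChoi (ρ.map (Int.cast : ℤ → ℂ))) := by
  obtain ⟨-, h⟩ := logDet_bounds hρ hN hM hns
  have := h 1 Matrix.PosDef.one
  exact ⟨this.1.1.det_pos.ne'.isUnit, this.2.1.det_pos.ne'.isUnit⟩

/-- Without a nearly doubly stochastic operator the potential drops by `1 / (6 N)` per step. -/
theorem potential_le (hN : 1 ≤ N) (hM : ∀ p q, |ρ p q| ≤ (M : ℤ))
    (hns : HasNonsingular (imageSpace (ρ.map (Int.cast : ℤ → ℂ)))) (m : ℕ)
    (hlarge : ∀ n s, 1 ≤ n → n ≤ m → stateAt (ρ.map (Int.cast : ℤ → ℚ)) n = some s →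
      1 / (N : ℝ) < ((iteration (ρ.map (Int.cast : ℤ → ℚ)) n s).val.1 : ℚ)) :
    ∃ s, stateAt (ρ.map (Int.cast : ℤ → ℚ)) (m + 1) = some s ∧ s.IsPosDef ∧
      (if m % 2 = 0 then
        toComplex s.P * opOfChoi (ρ.map (Int.cast : ℤ → ℂ)) (toComplex s.Q) = 1 else
        toComplex s.Q * dual (opOfChoi (ρ.map (Int.cast : ℤ → ℂ))) (toComplex s.P) = 1) ∧
      - logDet (toComplex s.P) - logDet (toComplex s.Q) ≤
        N * Real.log (N * M) - m * (1 / (6 * N)) := by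
  have hc := map_intCast_map_ratCast ρ
  have hsc := scalable_of_hasNonsingular hρ hN hM hns
  obtain ⟨hM1, hb⟩ := logDet_bounds hρ hN hM hns
  have hρ' : ((ρ.map (Int.cast : ℤ → ℚ)).map (Rat.cast : ℚ → ℂ)).PosSemidef := by rwa [hc]
  have hsc' : Scalable (opOfChoi ((ρ.map (Int.cast : ℤ → ℚ)).map (Rat.cast : ℚ → ℂ))) := by
    rwa [hc]
  induction m with
  -- Iteration 0 only normalises, leaving P = T(1)⁻¹ and Q = 1; the hypothesis about `DS` concerns
  -- iterations 1, …, m.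
  | zero =>
    obtain ⟨s', hs'⟩ := exists_next_state hρ' hsc' isPosDef_one 0
    have h1 := iteration_next hρ' isPosDef_one hs'
    simp only [Nat.zero_mod, if_true, hc, toComplex_one] at h1
    refine ⟨s', hs', h1.1, ?_, ?_⟩
    · simp only [Nat.zero_mod, if_true]
      rw [h1.2.1, h1.2.2, toComplex_one]
      exact Matrix.nonsing_inv_mul _ hsc.1
    · rw [h1.2.1, h1.2.2, toComplex_one, logDet_one, logDet_inv hsc.1.ne_zero]
      have := logDet_apply_one_le hN hM1 (ρ := ρ.map (Int.cast : ℤ → ℂ)) (fun p q => by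
        rw [Matrix.map_apply, Complex.norm_intCast]; exact_mod_cast hM p q)
        (hb 1 Matrix.PosDef.one).1.1
      simpa using this
  | succ m ih =>
    obtain ⟨s, hs, hpd, hbal, hpot⟩ := ih (fun n s h1 h2 => hlarge n s h1 (by omega))
    obtain ⟨s', hs'⟩ := exists_next_state hρ' hsc' hpd (m + 1)
    obtain ⟨hpd', h1⟩ := iteration_next hρ' hpd hs'
    have hl := hlarge (m + 1) s (by omega) le_rfl hs
    rw [iteration_val_fst, scaledDS, hc] at hl
    rw [hc] at h1
    refine ⟨s', by rw [stateAt, hs]; exact hs', hpd', ?_⟩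
    set T := opOfChoi (ρ.map (Int.cast : ℤ → ℂ))
    have hcomm := trace_mul_dual_comm (Q := toComplex s.Q) hρ hpd.1.posSemidef
    have hSQ := (hb _ hpd.2).1.1
    have hSP := (hb _ hpd.1).2.1
    have hone : (1 : Mat N).trace.re = N := by simp
    by_cases hm : m % 2 = 0
    · have hm' : ¬ (m + 1) % 2 = 0 := by omega
      rw [if_neg hm'] at h1 ⊢
      rw [if_pos hm] at hbal
      rw [hbal, sub_self] at hl
      rw [hbal] at hcomm
      -- P is balanced here, so the first term of `DS` vanishes and tr(Q T*(P)) = tr(P T(Q)) = N.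
      -- The change of -log det Q under Q ← T*(P)⁻¹ is log det Q + log det T*(P), which is what the
      -- lemma bounds.
      have hd := logDet_add_logDet_le hN hpd.2 hSP (by rw [hcomm, hone])
        (by simpa using hl.le)
      rw [h1.1, h1.2, logDet_inv hSP.det_pos.ne']
      refine ⟨Matrix.nonsing_inv_mul _ hSP.det_pos.ne'.isUnit, ?_⟩
      push_cast
      linarith
    · have hm' : (m + 1) % 2 = 0 := by omega
      rw [if_pos hm'] at h1 ⊢
      rw [if_neg hm] at hbal
      rw [hbal, sub_self] at hl
      rw [hbal] at hcomm
      have hd := logDet_add_logDet_le hN hpd.1 hSQ (by rw [← hcomm, hone])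
        (by simpa using hl.le)
      rw [h1.1, h1.2, logDet_inv hSQ.det_pos.ne']
      refine ⟨Matrix.nonsing_inv_mul _ hSQ.det_pos.ne'.isUnit, ?_⟩
      push_cast
      linarith

/-- Minimising over P gives N + log det T(Q), and the dominated Kraus operator bounds log det T(Q)
by log det Q from below up to the constant. -/
theorem le_potential (hN : 1 ≤ N) (hM : ∀ p q, |ρ p q| ≤ (M : ℤ))
    (hns : HasNonsingular (imageSpace (ρ.map (Int.cast : ℤ → ℂ)))) {P Q : Mat N}
    (hP : P.PosDef) (hQ : Q.PosDef) :
    - (N * Real.log (M * N ^ 6)) + N ≤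
      (P * opOfChoi (ρ.map (Int.cast : ℤ → ℂ)) Q).trace.re - logDet P - logDet Q := by
  obtain ⟨hM1, hb⟩ := logDet_bounds hρ hN hM hns
  have h1 := (hb Q hQ).1
  have h2 := le_trace_sub_logDet hP h1.1
  linarith

theorem exists_iteration_le (hN : 1 ≤ N) (hM : ∀ p q, |ρ p q| ≤ (M : ℤ))
    (hns : HasNonsingular (imageSpace (ρ.map (Int.cast : ℤ → ℂ)))) :
    ∃ (n : ℕ) (s : ScalingState N), (n : ℝ) ≤ 50 * (N * (N * Real.log N + N * Real.log M)) ∧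
      stateAt (ρ.map (Int.cast : ℤ → ℚ)) n = some s ∧
      (iteration (ρ.map (Int.cast : ℤ → ℚ)) n s).val.1 ≤ 1 / (N : ℚ) := by
  obtain ⟨hM1, hb⟩ := logDet_bounds hρ hN hM hns
  have hN' : (1 : ℝ) ≤ N := by exact_mod_cast hN
  have hM' : (1 : ℝ) ≤ M := by exact_mod_cast hM1
  set B : ℝ := N * (N * Real.log N + N * Real.log M) with hB
  have hlN : 0 ≤ Real.log N := Real.log_nonneg hN'
  have hlM : 0 ≤ Real.log M := Real.log_nonneg hM'
  -- In this case the bound allows only n = 0; but 0 < ρ ≤ 1 forces ρ = 1, which is doubly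
  -- stochastic already.
  by_cases hNM : N = 1 ∧ M = 1
  · obtain ⟨rfl, rfl⟩ := hNM
    refine ⟨0, ⟨1, 1⟩, by simp [hB], rfl, ?_⟩
    have h1 := (hb 1 Matrix.PosDef.one).1.1.det_pos
    have e : (opOfChoi (ρ.map (Int.cast : ℤ → ℂ)) 1).det = (ρ (0, 0) (0, 0) : ℂ) := by
      rw [det_fin_one, opOfChoi_apply]; simp
    rw [e] at h1
    have h2 : 0 < ρ (0, 0) (0, 0) := by exact_mod_cast h1
    have h3 := (abs_le.mp (hM (0, 0) (0, 0))).2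
    have h4 : ρ (0, 0) (0, 0) = 1 := by
      push_cast at h3; omega
    have h5 : (((iteration (ρ.map (Int.cast : ℤ → ℚ)) 0 ⟨1, 1⟩).val.1 : ℚ) : ℝ) = 0 := by
      rw [iteration_val_fst, map_intCast_map_ratCast, scaledDS, toComplex_one, Matrix.one_mul,
        Matrix.one_mul]
      have e1 : opOfChoi (ρ.map (Int.cast : ℤ → ℂ)) 1 = 1 := by
        ext i j
        rw [opOfChoi_apply, Subsingleton.elim i 0, Subsingleton.elim j 0]
        simp [h4]
      have e2 : dual (opOfChoi (ρ.map (Int.cast : ℤ → ℂ))) 1 = 1 := by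
        ext i j
        rw [dual_opOfChoi, opOfChoi_apply, Subsingleton.elim i 0, Subsingleton.elim j 0]
        simp [h4, dualChoi]
      rw [e1, e2]; simp
    have h6 : (iteration (ρ.map (Int.cast : ℤ → ℚ)) 0 ⟨1, 1⟩).val.1 = 0 := by exact_mod_cast h5
    rw [h6]; norm_num
  · have hl2 : 1 / 2 ≤ Real.log 2 := by have := Real.log_two_gt_d9; linarith
    have hBpos : 1 / 2 ≤ B := by
      have : 1 / 2 ≤ Real.log N + Real.log M := by
        rcases Nat.lt_or_ge 1 N with h | h
        · have : Real.log 2 ≤ Real.log N := Real.log_le_log (by norm_num) (by exact_mod_cast h)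
          linarith
        · have h2 : 2 ≤ M := by
            have : N = 1 := le_antisymm h hN
            by_contra hlt
            exact hNM ⟨this, by omega⟩
          have : Real.log 2 ≤ Real.log M := Real.log_le_log (by norm_num) (by exact_mod_cast h2)
          linarith
      rw [hB, ← mul_add]
      nlinarith [mul_le_mul hN' hN' zero_le_one (by linarith)]
    by_contra hcon
    push Not at hcon
    -- 42 = 6 · 7: the potential falls by 1/(6N) per step and has room for at most N(7 log N + 2 log
    -- M) ≤ 7(N log N + N log M). Since B ≥ 1/2, the extra step fits into 50B.
    set m := ⌊42 * B⌋₊ + 1 with hm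
    have hm1 : (m : ℝ) ≤ 50 * B := by
      have := Nat.floor_le (show 0 ≤ 42 * B by linarith)
      rw [hm]; push_cast; linarith
    have hm2 : 42 * B < m := by
      rw [hm]; push_cast; exact Nat.lt_floor_add_one _
    obtain ⟨s, -, hpd, hbal, hpot⟩ := potential_le hρ hN hM hns m (fun n s h1 h2 h3 => by
      have : (n : ℝ) ≤ m := by exact_mod_cast h2
      have := hcon n s (by linarith) h3
      have h4 : ((1 / (N : ℚ) : ℚ) : ℝ) < ((iteration (ρ.map (Int.cast : ℤ → ℚ)) n s).val.1 : ℚ) :=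
          by
        exact_mod_cast this
      simpa using h4)
    have hlow := le_potential hρ hN hM hns hpd.1 hpd.2
    have htr : (toComplex s.P * opOfChoi (ρ.map (Int.cast : ℤ → ℂ)) (toComplex s.Q)).trace.re = N :=
        by
      split_ifs at hbal
      · rw [hbal]; simp
      · rw [← trace_mul_dual_comm hρ hpd.1.posSemidef, hbal]; simp
    rw [htr] at hlow
    have e1 : Real.log (M * N ^ 6) = Real.log M + 6 * Real.log N := by
      rw [Real.log_mul (by positivity) (by positivity), Real.log_pow]; norm_num
    have e2 : Real.log (N * M) = Real.log N + Real.log M :=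
      Real.log_mul (by positivity) (by positivity)
    rw [e1] at hlow
    rw [e2] at hpot
    have h6 : (m : ℝ) * (1 / (6 * N)) ≤ 7 * (N * Real.log N + N * Real.log M) := by
      nlinarith [mul_nonneg (by linarith : (0 : ℝ) ≤ N) hlM]
    have h7 : (m : ℝ) ≤ 42 * B := by
      rw [mul_one_div, div_le_iff₀ (by positivity)] at h6
      rw [hB]; linarith
    linarith

end

end OperatorScaling

namespace OperatorScaling

variable {N : ℕ}

/-! ### Counting rational operations -/

theorem matMul_ops (A B : Matrix (Fin N) (Fin N) ℚ) : (matMul A B).ops = 2 * N ^ 3 := by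
  simp [matMul, Counted.matrix, Counted.sum, Counted.rMul]; ring

theorem applyOp_ops (ρ : Bipartite N ℚ) (X : Matrix (Fin N) (Fin N) ℚ) :
    (applyOp ρ X).ops = 2 * N ^ 4 + N ^ 3 := by
  simp [applyOp, Counted.matrix, Counted.sum, Counted.rMul]; ring

theorem applyDual_ops (ρ : Bipartite N ℚ) (X : Matrix (Fin N) (Fin N) ℚ) :
    (applyDual ρ X).ops = 2 * N ^ 4 + N ^ 3 := by
  simp [applyDual, Counted.matrix, Counted.sum, Counted.rMul]; ring

theorem defect_ops (A B : Matrix (Fin N) (Fin N) ℚ) :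
    (defect A B).ops = 2 * N ^ 3 + 3 * N ^ 2 + N := by
  have : (defect A B).ops = (matMul A B).ops + (N ^ 2 + (2 * N ^ 2 + N)) := by
    simp [defect, bind, Counted.matrix, Counted.sum, Counted.rMul, Counted.rSub]; ring
  rw [this, matMul_ops]; ring

theorem sweep_ops_le (A : Matrix (Fin N) (Fin N) ℚ) (k : Fin N) : (sweep A k).ops ≤ 3 * N ^ 2 := by
  have : (sweep A k).ops ≤ ∑ _i : Fin N, ∑ _j : Fin N, 3 := by
    simp only [sweep, Counted.matrix]
    refine Finset.sum_le_sum fun i _ => Finset.sum_le_sum fun j _ => ?_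
    split_ifs <;> simp [bind, Counted.rDiv, Counted.rSub, Counted.rMul]
  refine this.trans_eq ?_
  simp; ring

theorem sweepAll_ops_le (l : List (Fin N)) : ∀ A : Matrix (Fin N) (Fin N) ℚ,
    (sweepAll l A).ops ≤ l.length * (3 * N ^ 2 + 1) := by
  induction l with
  | nil => intro A; simp [sweepAll, pure]
  | cons k l ih =>
    intro A
    have h : (sweepAll (k :: l) A).ops ≤ 1 + ((sweep A k).ops + (sweepAll l (sweep A k).val).ops) :=
        by
      simp only [sweepAll, bind, Counted.rIsZero]
      by_cases h0 : A k k = 0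
      · simp only [h0, decide_true, if_true, pure]; omega
      · simp only [h0, decide_false]; rfl
    have h1 := ih (sweep A k).val
    have h2 := sweep_ops_le A k
    rw [List.length_cons, add_mul, one_mul]
    omega

theorem invert_ops_le (A : Matrix (Fin N) (Fin N) ℚ) : (invert A).ops ≤ N * (3 * N ^ 2 + 1) := by
  have := sweepAll_ops_le (List.finRange N) A
  rwa [List.length_finRange] at this

theorem iteration_ops_le (hN : 1 ≤ N) (ρ : Bipartite N ℚ) (n : ℕ) (s : ScalingState N) :
    (iteration ρ n s).ops ≤ 17 * N ^ 3 + (applyOp ρ s.Q).ops + (applyDual ρ s.P).ops := by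
  have h : (iteration ρ n s).ops ≤ (applyOp ρ s.Q).ops + ((applyDual ρ s.P).ops +
      ((defect s.P (applyOp ρ s.Q).val).ops + ((defect s.Q (applyDual ρ s.P).val).ops +
      (1 + N * (3 * N ^ 2 + 1))))) := by
    simp only [iteration, bind, Counted.rAdd]
    have h1 := invert_ops_le (applyOp ρ s.Q).val
    have h2 := invert_ops_le (applyDual ρ s.P).val
    split_ifs
    · simp only [pure]; omega
    · simp only [pure]; omega
  -- Each defect costs at most 6N³, the inversion at most 4N³, and one addition remains: 17 = 6 + 6
  -- + 4 + 1.
  rw [defect_ops, defect_ops] at h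
  have h2 : N ^ 2 ≤ N ^ 3 := Nat.pow_le_pow_right hN (by norm_num)
  have h1 : N ≤ N ^ 3 := Nat.le_self_pow (by norm_num) N
  have h0 : 1 ≤ N ^ 3 := Nat.one_le_pow _ _ hN
  have e : N * (3 * N ^ 2 + 1) = 3 * N ^ 3 + N := by ring
  omega

theorem search_ops_le (hN : 1 ≤ N) (ρ : Bipartite N ℚ) (fuel : ℕ) : ∀ (n : ℕ) (s : ScalingState N),
    (search ρ fuel n s).ops ≤ fuel * (25 * N ^ 4) := by
  induction fuel with
  | zero => intro n s; simp [search, pure]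
  | succ fuel ih =>
    intro n s
    have h : (search ρ (fuel + 1) n s).ops ≤ (iteration ρ n s).ops + (1 + (1 + fuel * (25 * N ^ 4))) := by
      simp only [search, bind, Counted.rDiv, Counted.rLe]
      by_cases hle : (iteration ρ n s).val.1 ≤ 1 / (N : ℚ)
      · simp only [hle, decide_true, if_true, pure]; omega
      · simp only [hle, decide_false]
        cases (iteration ρ n s).val.2 with
        | none => simp [pure]; omega
        | some s' => simpa using ih (n + 1) s'
    have h1 := iteration_ops_le hN ρ n s
    -- Together 4N⁴ + 19N³ + 2 ≤ 25N⁴, the final 2 for the division and the comparison in the loop.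
    rw [applyOp_ops, applyDual_ops] at h1
    have h3 : N ^ 3 ≤ N ^ 4 := Nat.pow_le_pow_right hN (by norm_num)
    have h0 : 1 ≤ N ^ 4 := Nat.one_le_pow _ _ hN
    rw [add_mul, one_mul]
    omega

/-- The iteration bound, the rational algorithm, and its arithmetic cost. -/
theorem scaling_iteration_bound : ∃ (C : ℝ) (K : ℕ), ∀ (N : ℕ), 1 ≤ N →
      ∀ (ρ : Bipartite N ℤ) (M : ℕ),
      (ρ.map (Int.cast : ℤ → ℂ)).PosSemidef →
      (∀ p q, |ρ p q| ≤ (M : ℤ)) →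
      EdmondsRado (ρ.map (Int.cast : ℤ → ℂ)) →
      (HasNonsingular (imageSpace (ρ.map (Int.cast : ℤ → ℂ))) →
        Scalable (opOfChoi (ρ.map (Int.cast : ℤ → ℂ))) ∧
        ∃ n : ℕ, (n : ℝ) ≤ C * (N * (N * Real.log N + N * Real.log M)) ∧
          DS (osi
            (opOfChoi (ρ.map (Int.cast : ℤ → ℂ))) n) ≤ 1 / (N : ℝ)) ∧
      (Scalable (opOfChoi (ρ.map (Int.cast : ℤ → ℂ))) →
        ∀ n : ℕ, DS (osi
            (opOfChoi (ρ.map (Int.cast : ℤ → ℂ))) n) ≤ 1 / (N : ℝ) →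
          HasNonsingular
            (imageSpace (ρ.map (Int.cast : ℤ → ℂ)))) ∧
      (Scalable (opOfChoi (ρ.map (Int.cast : ℤ → ℂ))) →
        ∀ n : ℕ, ∃ s : ScalingState N,
          stateAt (ρ.map (Int.cast : ℤ → ℚ)) n = some s ∧
          (((iteration (ρ.map (Int.cast : ℤ → ℚ)) n s).val.1 : ℚ) : ℝ) =
            DS (osi
              (opOfChoi (ρ.map (Int.cast : ℤ → ℂ))) n)) ∧
      (∀ (n : ℕ) (s : ScalingState N),
        (iteration (ρ.map (Int.cast : ℤ → ℚ)) n s).ops ≤ K * N ^ 3 +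
          (applyOp (ρ.map (Int.cast : ℤ → ℚ)) s.Q).ops +
          (applyDual (ρ.map (Int.cast : ℤ → ℚ)) s.P).ops) ∧
      (∀ X : Matrix (Fin N) (Fin N) ℚ,
        (applyOp (ρ.map (Int.cast : ℤ → ℚ)) X).ops ≤ K * N ^ 4 ∧
        (applyDual (ρ.map (Int.cast : ℤ → ℚ)) X).ops ≤ K * N ^ 4) ∧
      (∀ L : ℕ, C * (N * (N * Real.log N + N * Real.log M)) ≤ (L : ℝ) →
        ((decideEdmonds (ρ.map (Int.cast : ℤ → ℚ)) L).val = true ↔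
          HasNonsingular
            (imageSpace (ρ.map (Int.cast : ℤ → ℂ)))) ∧
        (decideEdmonds (ρ.map (Int.cast : ℤ → ℚ)) L).ops ≤
          (L + 1) * (K * N ^ 4)) := by
  refine ⟨50, 25, fun N hN ρ M hρ hM hER => ?_⟩
  have hc := map_intCast_map_ratCast ρ
  have hρ' : ((ρ.map (Int.cast : ℤ → ℚ)).map (Rat.cast : ℚ → ℂ)).PosSemidef := by rwa [hc]
  have hrep := fun hs => exists_stateAt_iteration_eq (ρ := ρ.map (Int.cast : ℤ → ℚ)) hρ' hs
  rw [hc] at hrep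
  -- Acceptance certifies rank non-decrease; the Edmonds–Rado property converts it into a
  -- nonsingular matrix.
  have hsound : ∀ n s, stateAt (ρ.map (Int.cast : ℤ → ℚ)) n = some s →
      (iteration (ρ.map (Int.cast : ℤ → ℚ)) n s).val.1 ≤ 1 / (N : ℚ) →
      HasNonsingular (imageSpace (ρ.map (Int.cast : ℤ → ℂ))) := fun n s hs hle => by
    have := rankNonDecreasing_of_iteration_le hρ' hN (stateAt_isPosDef hρ' n s hs) hle
    rw [hc] at this
    exact hER.mpr this
  have hcast : ∀ q : ℚ, (q : ℝ) ≤ 1 / (N : ℝ) ↔ q ≤ 1 / (N : ℚ) := fun q => by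
    rw [← Rat.cast_le (K := ℝ)]; simp
  refine ⟨fun hns => ?_, fun hs n hn => ?_, hrep, fun n s => ?_, fun X => ?_, fun L hL => ⟨?_, ?_⟩⟩
  · have hs := scalable_of_hasNonsingular hρ hN hM hns
    refine ⟨hs, ?_⟩
    obtain ⟨n, s, h1, h2, h3⟩ := exists_iteration_le hρ hN hM hns
    obtain ⟨s', h4, h5⟩ := hrep hs n
    rw [h2, Option.some_inj] at h4
    subst h4
    exact ⟨n, h1, by rw [← h5]; exact (hcast _).mpr h3⟩
  · obtain ⟨s, h1, h2⟩ := hrep hs n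
    rw [← h2] at hn
    exact hsound n s h1 ((hcast _).mp hn)
  · have := iteration_ops_le hN (ρ.map (Int.cast : ℤ → ℚ)) n s
    refine this.trans ?_
    gcongr
    norm_num
  · rw [applyOp_ops, applyDual_ops]
    have h3 : N ^ 3 ≤ N ^ 4 := Nat.pow_le_pow_right hN (by norm_num)
    omega
  · rw [decideEdmonds_eq_true_iff]
    constructor
    · rintro ⟨n, -, s, h1, h2⟩
      exact hsound n s h1 h2
    · intro hns
      obtain ⟨n, s, h1, h2, h3⟩ := exists_iteration_le hρ hN hM hns
      exact ⟨n, by exact_mod_cast h1.trans hL, s, h2, h3⟩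
  · exact search_ops_le hN _ _ _ _

end OperatorScaling

namespace OperatorScaling

variable {N : ℕ}

/-! ### Gradient descent in fixed point arithmetic -/

/-- The sum of all |P i j|² is tr(P²), and P ≤ tr(P) · 1 gives tr(P²) ≤ (tr P)². -/
theorem norm_apply_le_trace {n : Type*} [Fintype n] [DecidableEq n] {P : Matrix n n ℂ}
    (hP : P.PosSemidef) (i j : n) : ‖P i j‖ ≤ P.trace.re := by
  have h0 : 0 ≤ P.trace.re := (Complex.le_def.mp hP.trace_nonneg).1
  have him : P.trace = (P.trace.re : ℂ) := by
    have := (Complex.le_def.mp hP.trace_nonneg).2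
    exact Complex.ext rfl (by simpa using this.symm)
  have h1 := (Complex.le_def.mp (trace_mul_nonneg hP (posSemidef_le_trace hP))).1
  rw [mul_sub, Matrix.mul_smul, Matrix.mul_one, trace_sub, trace_smul, smul_eq_mul, him,
    ← Complex.ofReal_mul, Complex.sub_re, Complex.ofReal_re] at h1
  have h2 : (P * P).trace.re = ∑ a, ∑ b, ‖P a b‖ ^ 2 := by
    rw [Matrix.trace, Complex.re_sum]
    refine Finset.sum_congr rfl fun a _ => ?_
    rw [Matrix.diag_apply, Matrix.mul_apply, Complex.re_sum]
    refine Finset.sum_congr rfl fun b _ => ?_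
    rw [← hP.1.apply b a, Complex.star_def, Complex.mul_conj, Complex.ofReal_re,
        Complex.normSq_eq_norm_sq]
  have h3 : ‖P i j‖ ^ 2 ≤ ∑ a, ∑ b, ‖P a b‖ ^ 2 :=
    (Finset.single_le_sum (f := fun b => ‖P i b‖ ^ 2) (fun _ _ => sq_nonneg _)
      (Finset.mem_univ j)).trans
      (Finset.single_le_sum (f := fun a => ∑ b, ‖P a b‖ ^ 2)
        (fun _ _ => Finset.sum_nonneg fun _ _ => sq_nonneg _) (Finset.mem_univ i))
  simp only [Complex.zero_re] at h1
  exact abs_le_of_sq_le_sq' (by nlinarith) h0 |>.2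

/-- Every eigenvalue is bounded by the Frobenius norm, which is at most N. -/
theorem posSemidef_natCast_add_of_norm_le_one {F : Mat N} (hF : F.IsHermitian)
    (h : ∀ i j, ‖F i j‖ ≤ 1) :
    ((N : ℂ) • (1 : Mat N) - F).PosSemidef ∧ ((N : ℂ) • (1 : Mat N) + F).PosSemidef := by
  obtain ⟨V, f, h1, h2, h3⟩ := exists_unitary_diagonal hF
  have htr : (F * F).trace.re = ∑ i, f i ^ 2 := by
    have : F * F = V * diagonal (fun i => (f i : ℂ) * f i) * Vᴴ := by
      conv_lhs => rw [h3]
      calc _ = V * diagonal (fun i => (f i : ℂ)) * (Vᴴ * V) * diagonal (fun i => (f i : ℂ)) * Vᴴ :=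
          by
            simp only [Matrix.mul_assoc]
        _ = _ := by rw [h1, Matrix.mul_one, Matrix.mul_assoc V, diagonal_mul_diagonal]
    rw [this, trace_conj_unitary h1, trace_diagonal, Complex.re_sum]
    simp [sq]
  have hle : (F * F).trace.re ≤ (N : ℝ) ^ 2 := by
    rw [Matrix.trace, Complex.re_sum]
    calc ∑ i, ((F * F).diag i).re ≤ ∑ _i : Fin N, ∑ _j : Fin N, (1 : ℝ) := by
          refine Finset.sum_le_sum fun i _ => ?_
          rw [Matrix.diag_apply, Matrix.mul_apply, Complex.re_sum]
          refine Finset.sum_le_sum fun j _ => (Complex.re_le_norm _).trans ?_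
          rw [norm_mul]
          exact mul_le_one₀ (h i j) (norm_nonneg _) (h j i)
      _ = (N : ℝ) ^ 2 := by simp [sq]
  have hf : ∀ i, |f i| ≤ N := fun i => by
    have := Finset.single_le_sum (f := fun i => f i ^ 2) (fun _ _ => sq_nonneg _)
        (Finset.mem_univ i)
    exact abs_le_of_sq_le_sq (by linarith) (by positivity)
  have e1 : (N : ℂ) • (1 : Mat N) - F = V * diagonal (fun i => ((N - f i : ℝ) : ℂ)) * Vᴴ := by
    have : diagonal (fun i => ((N - f i : ℝ) : ℂ)) = (N : ℂ) • (1 : Mat N) -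
        diagonal (fun i => (f i : ℂ)) := by
      ext i j; by_cases h : i = j <;> simp [h]
    rw [this, Matrix.mul_sub, Matrix.sub_mul, ← h3]; simp [h2]
  have e2 : (N : ℂ) • (1 : Mat N) + F = V * diagonal (fun i => ((N + f i : ℝ) : ℂ)) * Vᴴ := by
    have : diagonal (fun i => ((N + f i : ℝ) : ℂ)) = (N : ℂ) • (1 : Mat N) +
        diagonal (fun i => (f i : ℂ)) := by
      ext i j; by_cases h : i = j <;> simp [h]
    rw [this, Matrix.mul_add, Matrix.add_mul, ← h3]; simp [h2]
  rw [e1, e2, posSemidef_conj_unitary_iff h1, posSemidef_conj_unitary_iff h1,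
    posSemidef_diagonal_iff, posSemidef_diagonal_iff]
  constructor
  · intro i
    have := (abs_le.mp (hf i)).2
    exact_mod_cast sub_nonneg.mpr this
  · intro i
    have := (abs_le.mp (hf i)).1
    have h0 : 0 ≤ (N : ℝ) + f i := by linarith
    exact_mod_cast h0

/-- A gradient step followed by a small upward perturbation. -/
theorem perturbed_gradient_step {P S E : Mat N} {δ : ℝ} (hN : 1 ≤ N) (hP : P.PosDef)
    (hS : S.PosSemidef) (ht : (P * S).trace.re ≤ 2 * N) (hE : E.PosSemidef)
    (hEδ : ((δ : ℂ) • (1 : Mat N) - E).PosSemidef) (hδ : δ * S.trace.re ≤ 1 / (32 * N ^ 2))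
    {P' : Mat N} (hP' : P' = P + ((1 / (4 * N) : ℝ) : ℂ) • (P - P * S * P) + E) :
    P'.PosDef ∧ (P' * S).trace.re ≤ 2 * N ∧
    (P' * S).trace.re - logDet P' ≤ (P * S).trace.re - logDet P -
      1 / (8 * N) * ((P * S - 1) ^ 2).trace.re + 1 / (32 * N ^ 2) ∧
    ∀ κ : ℝ, 0 ≤ κ → ((κ : ℂ) • (1 : Mat N) - P).PosSemidef →
      (((5 / 4 * κ + δ : ℝ) : ℂ) • (1 : Mat N) - P').PosSemidef := by
  have hN' : (1 : ℝ) ≤ N := by exact_mod_cast hN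
  set R := P + ((1 / (4 * N) : ℝ) : ℂ) • (P - P * S * P) with hR
  obtain ⟨h1, h2, h3⟩ := gradient_step hN hP hS ht hR
  have h4 : P'.PosDef := hP' ▸ h1.add_posSemidef hE
  -- The price of the perturbation is tr(ES) ≤ δ tr S in the linear term only; log det can only
  -- grow. The slack 1/2 in the trace bound of `gradient_step` absorbs it as well.
  have h5 : (E * S).trace.re ≤ δ * S.trace.re := by
    have := (Complex.le_def.mp (trace_mul_nonneg hEδ hS)).1
    rw [sub_mul, Matrix.smul_mul, Matrix.one_mul, trace_sub, trace_smul, smul_eq_mul,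
      Complex.sub_re, Complex.re_ofReal_mul, Complex.zero_re] at this
    linarith
  have h6 : (P' * S).trace.re = (R * S).trace.re + (E * S).trace.re := by
    rw [hP', add_mul, trace_add, Complex.add_re]
  have h7 : logDet R ≤ logDet P' := logDet_le_logDet h1 h4
    (by rw [hP', add_sub_cancel_left]; exact hE)
  have h8 : 1 / (32 * (N : ℝ) ^ 2) ≤ 1 / 2 := by
    rw [div_le_div_iff₀ (by positivity) (by norm_num)]
    nlinarith
  refine ⟨h4, by linarith, by linarith, fun κ hκ0 hκ => ?_⟩
  set η : ℝ := 1 / (4 * N) with hη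
  have hη0 : 0 ≤ η := by positivity
  have hη4 : η ≤ 1 / 4 := by
    rw [hη, div_le_div_iff₀ (by positivity) (by norm_num)]; linarith
  -- A decomposition into positive semidefinite summands: the term -ηPSP only helps, and 1 + η ≤
  -- 5/4.
  have e : ((5 / 4 * κ + δ : ℝ) : ℂ) • (1 : Mat N) - P' =
      ((1 + η : ℝ) : ℂ) • ((κ : ℂ) • (1 : Mat N) - P) + (η : ℂ) • (P * S * P) +
        (((1 / 4 - η) * κ : ℝ) : ℂ) • (1 : Mat N) + ((δ : ℂ) • (1 : Mat N) - E) := by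
    rw [hP', hR]
    push_cast
    module
  rw [e]
  have hPSP : (P * S * P).PosSemidef := by
    have := hS.mul_mul_conjTranspose_same P
    rwa [hP.1.eq] at this
  refine Matrix.PosSemidef.add (Matrix.PosSemidef.add (Matrix.PosSemidef.add ?_ ?_) ?_) hEδ
  · exact hκ.smul (by rw [Complex.zero_le_real]; linarith)
  · exact hPSP.smul (by rwa [Complex.zero_le_real])
  · exact Matrix.PosSemidef.one.smul (by
      rw [Complex.zero_le_real]; exact mul_nonneg (by linarith) hκ0)

/-- Evaluation of the operator with an integral Choi matrix. -/
def intApply (ρ : Bipartite N ℤ) (V : Matrix (Fin N) (Fin N) ℤ) : Matrix (Fin N) (Fin N) ℤ :=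
  Matrix.of fun a b => ∑ i, ∑ j, V i j * ρ (i, a) (j, b)

/-- Evaluation of the dual of the operator with an integral Choi matrix. -/
def intDual (ρ : Bipartite N ℤ) (U : Matrix (Fin N) (Fin N) ℤ) : Matrix (Fin N) (Fin N) ℤ :=
  Matrix.of fun i j => ∑ a, ∑ b, U a b * ρ (i, a) (j, b)

/-- `c (P S - 1)` for the scaled matrices `P`, `S`. -/
def residual (c : ℤ) (U S : Matrix (Fin N) (Fin N) ℤ) : Matrix (Fin N) (Fin N) ℤ :=
  U * S - c • (1 : Matrix (Fin N) (Fin N) ℤ)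

/-- The gradient step in fixed point arithmetic. -/
def gradStep (c : ℤ) (U S : Matrix (Fin N) (Fin N) ℤ) : Matrix (Fin N) (Fin N) ℤ :=
  Matrix.of fun i j => U i j + (-(residual c U S * U) i j) / (4 * N * c) + if i = j then (N :
      ℤ) else 0

/-- The complex matrix with the given integral entries. -/
abbrev intToComplex (U : Matrix (Fin N) (Fin N) ℤ) : Mat N := U.map (Int.cast : ℤ → ℂ)

theorem intToComplex_mul (A B : Matrix (Fin N) (Fin N) ℤ) :
    intToComplex (A * B) = intToComplex A * intToComplex B := by
  ext i j; simp [Matrix.mul_apply]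

theorem intToComplex_residual (c : ℤ) (U S : Matrix (Fin N) (Fin N) ℤ) :
    intToComplex (residual c U S) = intToComplex U * intToComplex S - (c : ℂ) • (1 : Mat N) := by
  rw [← intToComplex_mul]
  ext i j
  simp only [residual, Matrix.sub_apply, Matrix.smul_apply, Matrix.one_apply, Matrix.map_apply]
  split_ifs <;> simp

theorem isSymm_of_intToComplex {U : Matrix (Fin N) (Fin N) ℤ} {w : ℝ} (hw : 0 < w)
    (h : ((w : ℂ) • intToComplex U).IsHermitian) : Uᵀ = U := by
  ext i j
  have := congrFun (congrFun h i) j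
  simp [conjTranspose_apply, hw.ne'] at this
  exact this

/-- Since w s c = 1, the residual is c times P S - 1, and the acceptance test becomes an inequality
between integers. -/
theorem trace_sq_residual {c : ℤ} (hc : 0 < c) {U S : Matrix (Fin N) (Fin N) ℤ} {w s : ℝ}
    (hws : w * s * c = 1) :
    (((w : ℂ) • intToComplex U * ((s : ℂ) • intToComplex S) - 1) ^ 2).trace.re =
      ((residual c U S * residual c U S).trace : ℤ) / (c : ℝ) ^ 2 := by
  have hc' : (c : ℂ) ≠ 0 := by exact_mod_cast hc.ne'
  have hws' : (w : ℂ) * s * c = 1 := by exact_mod_cast hws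
  have e : (w : ℂ) • intToComplex U * ((s : ℂ) • intToComplex S) - 1 =
      ((c : ℂ)⁻¹) • intToComplex (residual c U S) := by
    rw [intToComplex_residual, smul_sub, smul_smul, inv_mul_cancel₀ hc', one_smul,
      Matrix.smul_mul, Matrix.mul_smul, smul_smul, eq_inv_of_mul_eq_one_left hws']
  have e2 : (intToComplex (residual c U S * residual c U S)).trace =
      (((residual c U S * residual c U S).trace : ℤ) : ℂ) := by
    simp [Matrix.trace]
  rw [e, sq, Matrix.smul_mul, Matrix.mul_smul, smul_smul, ← intToComplex_mul, trace_smul, e2,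
    smul_eq_mul]
  have : ((c : ℂ)⁻¹ * (c : ℂ)⁻¹ * (((residual c U S * residual c U S).trace : ℤ) : ℂ)) =
      (((((residual c U S * residual c U S).trace : ℤ) : ℝ) / (c : ℝ) ^ 2 : ℝ) : ℂ) := by
    push_cast; field_simp
  rw [this, Complex.ofReal_re]

/-- Rounding down leaves a symmetric error F with entries of absolute value at most 1, hence -N ≤ F
≤ N as matrices. The added N on the diagonal makes the total deviation w(N - F) lie between 0 and
2Nw, which is the upward perturbation allowed by `perturbed_gradient_step`. -/
theorem gradStep_spec {c : ℤ} (hc : 0 < c) (hN : 1 ≤ N) {U S : Matrix (Fin N) (Fin N) ℤ} {w s : ℝ}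
    (hw : 0 < w) (hs : 0 < s) (hws : w * s * c = 1) (hP : ((w : ℂ) • intToComplex U).PosDef)
    (hS : ((s : ℂ) • intToComplex S).PosSemidef)
    (ht : ((w : ℂ) • intToComplex U * ((s : ℂ) • intToComplex S)).trace.re ≤ 2 * N)
    (hδ : 2 * N * w * ((s : ℂ) • intToComplex S).trace.re ≤ 1 / (32 * N ^ 2)) :
    ((w : ℂ) • intToComplex (gradStep c U S)).PosDef ∧
    ((w : ℂ) • intToComplex (gradStep c U S) * ((s : ℂ) • intToComplex S)).trace.re ≤ 2 * N ∧
    ((w : ℂ) • intToComplex (gradStep c U S) * ((s : ℂ) • intToComplex S)).trace.re -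
        logDet ((w : ℂ) • intToComplex (gradStep c U S)) ≤
      ((w : ℂ) • intToComplex U * ((s : ℂ) • intToComplex S)).trace.re -
        logDet ((w : ℂ) • intToComplex U) -
      1 / (8 * N) * (((w : ℂ) • intToComplex U * ((s : ℂ) • intToComplex S) - 1) ^ 2).trace.re +
        1 / (32 * N ^ 2) ∧
    ∀ κ : ℝ, 0 ≤ κ → ((κ : ℂ) • (1 : Mat N) - (w : ℂ) • intToComplex U).PosSemidef →
      (((5 / 4 * κ + 2 * N * w : ℝ) : ℂ) • (1 : Mat N) -
        (w : ℂ) • intToComplex (gradStep c U S)).PosSemidef := by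
  have hN' : (1 : ℝ) ≤ N := by exact_mod_cast hN
  have hUs := isSymm_of_intToComplex hw hP.1
  have hSs := isSymm_of_intToComplex hs hS.1
  set H := residual c U S * U with hH
  -- H = USU - cU is symmetric as U and S are; therefore its entrywise rounding is symmetric too.
  have hHs : Hᵀ = H := by
    rw [hH, residual, sub_mul, Matrix.smul_mul, Matrix.one_mul, transpose_sub, transpose_mul,
      transpose_mul, hUs, hSs, transpose_smul, hUs, Matrix.mul_assoc]
  set b : ℤ := 4 * N * c with hb
  have hb0 : 0 < b := by positivity
  set F : Mat N := Matrix.of fun i j => (((-H i j : ℤ) / (b : ℝ) - ((-H i j / b : ℤ) : ℝ) : ℝ) : ℂ)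
    with hF
  have hbR : (0 : ℝ) < b := by exact_mod_cast hb0
  have hF1 : ∀ i j, ‖F i j‖ ≤ 1 := by
    intro i j
    simp only [hF, Matrix.of_apply, Complex.norm_real, Real.norm_eq_abs]
    have h1 : b * (-H i j / b) ≤ -H i j := Int.mul_ediv_self_le hb0.ne'
    have h2 : -H i j < b * (-H i j / b) + b := Int.lt_mul_ediv_self_add hb0
    have h1' : (b : ℝ) * ((-H i j / b : ℤ) : ℝ) ≤ ((-H i j : ℤ) : ℝ) := by exact_mod_cast h1
    have h2' : ((-H i j : ℤ) : ℝ) < (b : ℝ) * ((-H i j / b : ℤ) : ℝ) + b := by exact_mod_cast h2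
    rw [abs_le]
    constructor
    · have : ((-H i j / b : ℤ) : ℝ) ≤ ((-H i j : ℤ) : ℝ) / b := by
        rw [le_div_iff₀ hbR]; linarith
      linarith
    · rw [sub_le_iff_le_add, div_le_iff₀ hbR]; linarith
  have hFh : F.IsHermitian := by
    ext i j
    have : H j i = H i j := congrFun (congrFun hHs i) j
    simp only [hF, conjTranspose_apply, Matrix.of_apply, this, Complex.star_def,
        Complex.conj_ofReal]
  obtain ⟨hF2, hF3⟩ := posSemidef_natCast_add_of_norm_le_one hFh hF1
  have hwC : (0 : ℂ) ≤ (w : ℂ) := by rw [Complex.zero_le_real]; exact hw.le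
  refine perturbed_gradient_step (E := (w : ℂ) • ((N : ℂ) • (1 : Mat N) - F)) (δ := 2 * N * w)
    hN hP hS ht (hF2.smul hwC) ?_ hδ ?_
  · convert hF3.smul hwC using 1
    push_cast
    module
  · have hPSP : (w : ℂ) • intToComplex U * ((s : ℂ) • intToComplex S) * ((w : ℂ) • intToComplex U) =
        (w : ℂ) • ((c : ℂ)⁻¹ • (intToComplex U * intToComplex S * intToComplex U)) := by
      have hws' : (w : ℂ) * s * c = 1 := by exact_mod_cast hws
      simp only [Matrix.smul_mul, Matrix.mul_smul, smul_smul]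
      rw [← eq_inv_of_mul_eq_one_left hws']
      congr 1
      ring
    rw [hPSP]
    have hHc : intToComplex U * intToComplex S * intToComplex U =
        intToComplex H + (c : ℂ) • intToComplex U := by
      rw [hH, intToComplex_mul, intToComplex_residual, sub_mul, Matrix.smul_mul, Matrix.one_mul]
      abel
    rw [hHc]
    have hc' : (c : ℂ) ≠ 0 := by exact_mod_cast hc.ne'
    have hNc : (N : ℂ) ≠ 0 := by
      have : N ≠ 0 := by omega
      exact_mod_cast this
    ext i j
    simp only [Matrix.smul_apply, Matrix.map_apply, gradStep, Matrix.of_apply, Matrix.add_apply,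
      Matrix.sub_apply, hF, smul_eq_mul, ← hH, ← hb, Matrix.one_apply]
    push_cast
    have hbC : (b : ℂ) = 4 * N * c := by rw [hb]; push_cast; ring
    by_cases hij : i = j
    · simp only [hij, if_true, hbC]
      field_simp
      ring
    · simp only [hij, if_false, hbC]
      field_simp
      ring

end OperatorScaling

/-! ### The integral descent: invariant, progress and termination. -/

namespace OperatorScaling

variable {N : ℕ}

/-- The state of the descent: two integral matrices and a flag for acceptance. -/
structure DescentState (N : ℕ) where
  U : Matrix (Fin N) (Fin N) ℤ
  V : Matrix (Fin N) (Fin N) ℤ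
  flag : ℤ

/-- The residual is too large for acceptance. -/
def IsLarge (c : ℤ) (U S : Matrix (Fin N) (Fin N) ℤ) : Prop :=
  -- In scaled terms, tr((PS - 1)²) > 1/(2N). Two residuals that are not large give `DS` at most
  -- 1/N.
  0 < 2 * N * (residual c U S * residual c U S).trace - c * c

instance (c : ℤ) (U S : Matrix (Fin N) (Fin N) ℤ) : Decidable (IsLarge c U S) :=
  inferInstanceAs (Decidable (0 < _))

/-- One iteration of the descent. -/
def descend (ρ : Bipartite N ℤ) (c : ℤ) (x : DescentState N) : DescentState N :=
  if IsLarge c x.U (intApply ρ x.V) then ⟨gradStep c x.U (intApply ρ x.V), x.V, x.flag⟩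
  else if IsLarge c x.V (intDual ρ x.U) then ⟨x.U, gradStep c x.V (intDual ρ x.U), x.flag⟩
  else ⟨x.U, x.V, 1⟩

/-- The state after `n` iterations. -/
def descentAt (ρ : Bipartite N ℤ) (c W : ℤ) : ℕ → DescentState N
  | 0 => ⟨W • 1, W • 1, 0⟩
  | n + 1 => descend ρ c (descentAt ρ c W n)

/-- One more than the trace. -/
def intTrace (ρ : Bipartite N ℤ) : ℤ := 1 + ρ.trace

theorem intToComplex_intApply (ρ : Bipartite N ℤ) (V : Matrix (Fin N) (Fin N) ℤ) :
    intToComplex (intApply ρ V) = opOfChoi (ρ.map (Int.cast : ℤ → ℂ)) (intToComplex V) := by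
  ext a b
  rw [opOfChoi_apply]
  simp [intApply]

theorem intToComplex_intDual (ρ : Bipartite N ℤ) (V : Matrix (Fin N) (Fin N) ℤ) :
    intToComplex (intDual ρ V) = dual (opOfChoi (ρ.map (Int.cast : ℤ → ℂ))) (intToComplex V) := by
  ext a b
  rw [dual_opOfChoi, opOfChoi_apply]
  simp [intDual, dualChoi]

theorem trace_opOfChoi_one (ρ : Bipartite N ℂ) : (opOfChoi ρ 1).trace = ρ.trace := by
  simp only [Matrix.trace, Matrix.diag_apply, opOfChoi_apply, Matrix.one_apply,
    Fintype.sum_prod_type, ite_mul, one_mul, zero_mul, Finset.sum_ite_eq, Finset.mem_univ, if_true]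
  exact Finset.sum_comm

section

variable {ρ : Bipartite N ℤ} (hρ : (ρ.map (Int.cast : ℤ → ℂ)).PosSemidef)

include hρ

theorem abs_apply_le_trace (p q : Fin N × Fin N) : |ρ p q| ≤ ρ.trace := by
  have := norm_apply_le_trace hρ p q
  rw [Matrix.map_apply, Complex.norm_intCast] at this
  have e : (ρ.map (Int.cast : ℤ → ℂ)).trace.re = (ρ.trace : ℤ) := by
    simp [Matrix.trace]
  rw [e] at this
  exact_mod_cast this

omit hρ in
theorem trace_map_intCast_le (ρ : Bipartite N ℤ) : (ρ.map (Int.cast : ℤ →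
    ℂ)).trace.re ≤ (intTrace ρ : ℤ) := by
  simp [intTrace, Matrix.trace]

/-- The summand 1 keeps the normalising denominator positive even for ρ = 0. -/
theorem one_le_intTrace : 1 ≤ intTrace ρ := by
  have h : 0 ≤ ρ.trace := by
    have h1 := (Complex.le_def.mp hρ.trace_nonneg).1
    have e : (ρ.map (Int.cast : ℤ → ℂ)).trace.re = (ρ.trace : ℤ) := by
      simp [Matrix.trace]
    rw [e] at h1
    exact_mod_cast h1
  unfold intTrace
  omega

end

/-- The invariant of the descent with `P = U / (τ W)` and `Q = V / W`. -/
structure DescentInvariant (T : Op N) (τ κ : ℝ) (P Q : Mat N) : Prop where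
  posDef_P : P.PosDef
  posDef_Q : Q.PosDef
  trace_le : (P * T Q).trace.re ≤ 2 * N
  P_le : (((κ / τ : ℝ) : ℂ) • (1 : Mat N) - P).PosSemidef
  Q_le : ((κ : ℂ) • (1 : Mat N) - Q).PosSemidef

theorem trace_apply_le {T : Op N} (hT : ∀ X : Mat N, X.PosSemidef → (T X).PosSemidef) {κ t : ℝ}
    {Q : Mat N} (hκ : 0 ≤ κ) (ht : (T 1).trace.re ≤ t)
    (hQ : ((κ : ℂ) • (1 : Mat N) - Q).PosSemidef) :
    (T Q).trace.re ≤ κ * t := by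
  have := (Complex.le_def.mp (hT _ hQ).trace_nonneg).1
  rw [map_sub, map_smul, trace_sub, trace_smul, smul_eq_mul, Complex.sub_re,
    Complex.re_ofReal_mul, Complex.zero_re] at this
  nlinarith [mul_le_mul_of_nonneg_left ht hκ]

/-- The scaled matrices of a state. -/
noncomputable def scaledP (τ W : ℤ) (x : DescentState N) : Mat N :=
  (((1 / (τ * W) : ℝ)) : ℂ) • intToComplex x.U

/-- The scaled matrices of a state. -/
noncomputable def scaledQ (W : ℤ) (x : DescentState N) : Mat N :=
  (((1 / W : ℝ)) : ℂ) • intToComplex x.V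

/-- The potential function of the descent. -/
noncomputable def descentPotential (T : Op N) (P Q : Mat N) : ℝ :=
  (P * T Q).trace.re - logDet P - logDet Q

section

variable {ρ : Bipartite N ℤ} (hρ : (ρ.map (Int.cast : ℤ → ℂ)).PosSemidef) (hN : 1 ≤ N)
  {W : ℤ} {n : ℕ} (hW : 64 * N ^ 3 * 2 ^ n ≤ W) {x : DescentState N}

include hρ hN hW

/-- A large residual makes the exact gradient step gain 1/(8N) · 1/(2N) = 2/(32N²), of which
rounding consumes at most half. If neither residual is large, the state certifies rank non-decrease.
-/
theorem descend_spec
    (hx : DescentInvariant (opOfChoi (ρ.map (Int.cast : ℤ → ℂ))) (intTrace ρ) (2 ^ n)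
      (scaledP (intTrace ρ) W x) (scaledQ W x)) :
    DescentInvariant (opOfChoi (ρ.map (Int.cast : ℤ → ℂ))) (intTrace ρ) (2 ^ (n + 1))
      (scaledP (intTrace ρ) W (descend ρ (intTrace ρ * W * W) x))
      (scaledQ W (descend ρ (intTrace ρ * W * W) x)) ∧
    (((descend ρ (intTrace ρ * W * W) x).flag = x.flag ∧
      descentPotential (opOfChoi (ρ.map (Int.cast : ℤ → ℂ)))
        (scaledP (intTrace ρ) W (descend ρ (intTrace ρ * W * W) x))
        (scaledQ W (descend ρ (intTrace ρ * W * W) x)) ≤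
      descentPotential (opOfChoi (ρ.map (Int.cast : ℤ → ℂ)))
        (scaledP (intTrace ρ) W x) (scaledQ W x) - 1 / (32 * N ^ 2)) ∨
     ((descend ρ (intTrace ρ * W * W) x).flag = 1 ∧
      RankNonDecreasing (opOfChoi (ρ.map (Int.cast : ℤ → ℂ))))) := by
  have hN' : (1 : ℝ) ≤ N := by exact_mod_cast hN
  have hτ1 := one_le_intTrace hρ
  set τ := intTrace ρ with hτ
  have hτR : (1 : ℝ) ≤ τ := by exact_mod_cast hτ1
  have hWR : 64 * (N : ℝ) ^ 3 * 2 ^ n ≤ W := by exact_mod_cast hW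
  have h2n : (1 : ℝ) ≤ 2 ^ n := one_le_pow₀ (by norm_num)
  have hWpos : (0 : ℝ) < W := lt_of_lt_of_le (by positivity) hWR
  have hWZ : 0 < W := by exact_mod_cast hWpos
  -- P and Q carry the scales 1/(τW) and 1/W, so both residuals have the common denominator c.
  set c := τ * W * W with hc
  have hc0 : 0 < c := by positivity
  have hcR : (c : ℝ) = τ * W * W := by rw [hc]; push_cast; ring
  set T := opOfChoi (ρ.map (Int.cast : ℤ → ℂ)) with hT
  -- This is where W ≥ 64N³2ⁿ enters: the rounding error 2N/W, times the bound 2ⁿ on the matrices,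
  -- stays below 1/(32N²).
  have hNW : 2 * N / (W : ℝ) * 2 ^ n ≤ 1 / (32 * N ^ 2) := by
    rw [div_mul_eq_mul_div, div_le_div_iff₀ hWpos (by positivity)]
    linarith
  have hNW1 : 2 * N / (W : ℝ) ≤ 3 / 4 := by
    have h1 : 1 / (32 * (N : ℝ) ^ 2) ≤ 3 / 4 := by
      rw [div_le_div_iff₀ (by positivity) (by norm_num)]
      nlinarith
    have h2 : 2 * N / (W : ℝ) ≤ 2 * N / (W : ℝ) * 2 ^ n :=
      le_mul_of_one_le_right (by positivity) h2n
    linarith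
  have htr1 : (T 1).trace.re ≤ τ := by
    rw [hT, trace_opOfChoi_one]; exact trace_map_intCast_le ρ
  have hdual1 : (dual T 1).trace = (T 1).trace := by
    have := trace_mul_dual_comm (Q := 1) hρ (P := 1) Matrix.PosSemidef.one
    rwa [Matrix.one_mul, Matrix.one_mul] at this
  have hTQ : T (scaledQ W x) = ((1 / W : ℝ) : ℂ) • intToComplex (intApply ρ x.V) := by
    rw [scaledQ, map_smul, intToComplex_intApply]
  have hTP : dual T (scaledP τ W x) =
      ((1 / (τ * W) : ℝ) : ℂ) • intToComplex (intDual ρ x.U) := by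
    rw [scaledP, map_smul, intToComplex_intDual]
  have hcomm : (scaledQ W x * dual T (scaledP τ W x)).trace =
      (scaledP τ W x * T (scaledQ W x)).trace :=
    trace_mul_dual_comm hρ hx.posDef_P.posSemidef
  have hw1 : (1 / (τ * W) : ℝ) * (1 / W) * c = 1 := by rw [hcR]; field_simp
  have hw2 : (1 / W : ℝ) * (1 / (τ * W)) * c = 1 := by rw [hcR]; field_simp
  -- The growth 5/4 · κ plus rounding is at most 2κ, so the size bound doubles per iteration.
  have hgrowP : ∀ P : Mat N, (((5 / 4 * (2 ^ n / τ) + 2 * N * (1 / (τ * W)) : ℝ) : ℂ) • (1 :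
      Mat N) -
      P).PosSemidef → (((2 ^ (n + 1) / τ : ℝ) : ℂ) • (1 : Mat N) - P).PosSemidef := by
    intro P hP
    have h1 : 0 ≤ (2 ^ (n + 1) / τ : ℝ) - (5 / 4 * (2 ^ n / τ) + 2 * N * (1 / (τ * W))) := by
      have : (2 ^ (n + 1) / τ : ℝ) - (5 / 4 * (2 ^ n / τ) + 2 * N * (1 / (τ * W))) =
          (3 / 4 * 2 ^ n - 2 * N / W) / τ := by
        rw [pow_succ]; field_simp; ring
      rw [this]
      exact div_nonneg (by linarith) (by linarith)
    have h2 := hP.add (Matrix.PosSemidef.one.smul (Complex.zero_le_real.mpr h1))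
    convert h2 using 1
    push_cast
    module
  have hgrowQ : ∀ Q : Mat N, (((5 / 4 * 2 ^ n + 2 * N * (1 / W) : ℝ) : ℂ) • (1 : Mat N) -
      Q).PosSemidef → (((2 ^ (n + 1) : ℝ) : ℂ) • (1 : Mat N) - Q).PosSemidef := by
    intro Q hQ
    have h1 : 0 ≤ (2 ^ (n + 1) : ℝ) - (5 / 4 * 2 ^ n + 2 * N * (1 / W)) := by
      rw [pow_succ, mul_one_div]; linarith
    have h2 := hQ.add (Matrix.PosSemidef.one.smul (Complex.zero_le_real.mpr h1))
    convert h2 using 1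
    push_cast
    module
  have hmonoP : (((2 ^ (n + 1) / τ : ℝ) : ℂ) • (1 : Mat N) - scaledP τ W x).PosSemidef := by
    have h2 := hx.P_le.add (Matrix.PosSemidef.one.smul
      (show (0 : ℂ) ≤ ((2 ^ n / τ : ℝ) : ℂ) from by rw [Complex.zero_le_real]; positivity))
    convert h2 using 1
    rw [pow_succ]
    push_cast
    module
  have hmonoQ : (((2 ^ (n + 1) : ℝ) : ℂ) • (1 : Mat N) - scaledQ W x).PosSemidef := by
    have h2 := hx.Q_le.add (Matrix.PosSemidef.one.smul
      (show (0 : ℂ) ≤ ((2 ^ n : ℝ) : ℂ) from by rw [Complex.zero_le_real]; positivity))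
    convert h2 using 1
    rw [pow_succ]
    push_cast
    module
  have hlarge : ∀ {A S : Matrix (Fin N) (Fin N) ℤ} {w s : ℝ}, w * s * c = 1 →
      (IsLarge c A S ↔ 1 / (2 * (N : ℝ)) <
        (((w : ℂ) • intToComplex A * ((s : ℂ) • intToComplex S) - 1) ^ 2).trace.re) := by
    intro A S w s hws
    rw [trace_sq_residual hc0 hws, IsLarge, sub_pos]
    have hcpos : (0 : ℝ) < (c : ℝ) ^ 2 := by have : (0 : ℝ) < c := by exact_mod_cast hc0
                                             positivity
    rw [div_lt_div_iff₀ (by positivity) hcpos]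
    set t := (residual c A S * residual c A S).trace
    rw [← @Int.cast_lt ℝ]
    push_cast
    constructor <;> intro h <;> linarith
  have hdec : 1 / (8 * (N : ℝ)) * (1 / (2 * N)) = 1 / (32 * N ^ 2) + 1 / (32 * N ^ 2) := by
    field_simp; norm_num
  by_cases hA : IsLarge c x.U (intApply ρ x.V)
  · have hd : descend ρ c x = ⟨gradStep c x.U (intApply ρ x.V), x.V, x.flag⟩ := by
      rw [descend, if_pos hA]
    rw [hd]
    have hA' := (hlarge hw1).mp hA
    have hS := opOfChoi_posSemidef hρ hx.posDef_Q.posSemidef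
    have hσ : 2 * N * (1 / (τ * W) : ℝ) * (T (scaledQ W x)).trace.re ≤ 1 / (32 * N ^ 2) := by
      have h1 := trace_apply_le (T := T) (fun X => opOfChoi_posSemidef hρ) (by positivity) htr1
        hx.Q_le
      have h2 : 2 * N * (1 / (τ * W) : ℝ) * (2 ^ n * τ) = 2 * N / (W : ℝ) * 2 ^ n := by field_simp
      calc _ ≤ 2 * N * (1 / (τ * W) : ℝ) * (2 ^ n * τ) :=
            mul_le_mul_of_nonneg_left h1 (by positivity)
        _ ≤ _ := h2 ▸ hNW
    have ht := hx.trace_le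
    rw [hTQ] at hS hσ ht
    obtain ⟨g1, g2, g3, g4⟩ := gradStep_spec hc0 hN (w := 1 / (τ * W)) (s := 1 / W) (by positivity)
      (by positivity) hw1 hx.posDef_P hS ht hσ
    refine ⟨⟨g1, hx.posDef_Q, ?_, hgrowP _ (g4 _ (by positivity) hx.P_le), hmonoQ⟩, Or.inl ⟨rfl,
        ?_⟩⟩
    · change (_ * T (scaledQ W x)).trace.re ≤ _
      rw [hTQ]; exact g2
    · change (_ * T (scaledQ W x)).trace.re - _ - _ ≤ (_ * T (scaledQ W x)).trace.re - _ - _ - _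
      rw [hTQ]
      have := mul_le_mul_of_nonneg_left hA'.le (show 0 ≤ 1 / (8 * (N : ℝ)) by positivity)
      change _ - _ - logDet (scaledQ W x) ≤ _
      simp only [scaledP] at g3 ⊢
      linarith
  · by_cases hB : IsLarge c x.V (intDual ρ x.U)
    · have hd : descend ρ c x = ⟨x.U, gradStep c x.V (intDual ρ x.U), x.flag⟩ := by
        rw [descend, if_neg hA, if_pos hB]
      rw [hd]
      have hB' := (hlarge hw2).mp hB
      have hS := dual_posSemidef hρ hx.posDef_P.posSemidef
      have hσ : 2 * N * (1 / W : ℝ) * (dual T (scaledP τ W x)).trace.re ≤ 1 / (32 * N ^ 2) := by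
        have h1 := trace_apply_le (T := dual T) (fun X => dual_posSemidef hρ) (by positivity)
          (show (dual T 1).trace.re ≤ τ by rw [hdual1]; exact htr1) hx.P_le
        have h2 : 2 * N * (1 / W : ℝ) * (2 ^ n / τ * τ) = 2 * N / (W : ℝ) * 2 ^ n := by field_simp
        calc _ ≤ 2 * N * (1 / W : ℝ) * (2 ^ n / τ * τ) :=
              mul_le_mul_of_nonneg_left h1 (by positivity)
          _ ≤ _ := h2 ▸ hNW
      have ht := hx.trace_le
      rw [← hcomm] at ht
      rw [hTP] at hS hσ ht
      obtain ⟨g1, g2, g3, g4⟩ := gradStep_spec hc0 hN (w := 1 / W) (s := 1 / (τ * W))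
          (by positivity)
        (by positivity) hw2 hx.posDef_Q hS ht hσ
      have hcomm2 : ∀ Q : Mat N, (scaledP τ W x * T Q).trace = (Q * dual T (scaledP τ W x)).trace :=
        fun Q => (trace_mul_dual_comm (Q := Q) hρ hx.posDef_P.posSemidef).symm
      refine ⟨⟨hx.posDef_P, g1, ?_, hmonoP, ?_⟩, Or.inl ⟨rfl, ?_⟩⟩
      · change (scaledP τ W x * T _).trace.re ≤ _
        rw [hcomm2, hTP]; exact g2
      · have := hgrowQ _ (g4 _ (by positivity) (by simpa [scaledQ] using hx.Q_le))
        simpa [scaledQ] using this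
      · change (scaledP τ W x * T _).trace.re - logDet (scaledP τ W x) - _ ≤
          (scaledP τ W x * T (scaledQ W x)).trace.re - _ - _ - _
        rw [hcomm2, hcomm2, hTP]
        have := mul_le_mul_of_nonneg_left hB'.le (show 0 ≤ 1 / (8 * (N : ℝ)) by positivity)
        simp only [scaledQ] at g3 ⊢
        linarith
    · have hd : descend ρ c x = ⟨x.U, x.V, 1⟩ := by
        rw [descend, if_neg hA, if_neg hB]
      rw [hd]
      refine ⟨⟨hx.posDef_P, hx.posDef_Q, hx.trace_le, hmonoP, hmonoQ⟩, Or.inr ⟨rfl, ?_⟩⟩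
      refine rankNonDecreasing_of_scaledDS_le hN hρ hx.posDef_P.posSemidef hx.posDef_Q ?_
      rw [scaledDS, ← hT, hTQ, hTP]
      have hA' := (hlarge hw1).not.mp hA
      have hB' := (hlarge hw2).not.mp hB
      push Not at hA' hB'
      have : 1 / (N : ℝ) = 1 / (2 * N) + 1 / (2 * N) := by field_simp; norm_num
      rw [this]
      exact add_le_add hA' hB'

end

/-- The start is P = τ⁻¹ · 1 and Q = 1. Then tr(P T(Q)) = tr(ρ)/τ ≤ 1, and the only determinant term
is N log τ. -/
theorem descentInvariant_zero {ρ : Bipartite N ℤ} (hρ : (ρ.map (Int.cast : ℤ → ℂ)).PosSemidef)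
    (hN : 1 ≤ N) {W : ℤ} (hW : 0 < W) :
    DescentInvariant (opOfChoi (ρ.map (Int.cast : ℤ → ℂ))) (intTrace ρ) (2 ^ 0)
      (scaledP (intTrace ρ) W (⟨W • 1, W • 1, 0⟩ : DescentState N)) (scaledQ W ⟨W • 1, W • 1, 0⟩) ∧
    descentPotential (opOfChoi (ρ.map (Int.cast : ℤ → ℂ)))
      (scaledP (intTrace ρ) W (⟨W • 1, W • 1, 0⟩ : DescentState N)) (scaledQ W ⟨W • 1, W • 1, 0⟩) ≤
      1 + N * Real.log (intTrace ρ) := by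
  have hN' : (1 : ℝ) ≤ N := by exact_mod_cast hN
  have hτ1 := one_le_intTrace hρ
  set τ := intTrace ρ with hτ
  have hτR : (1 : ℝ) ≤ τ := by exact_mod_cast hτ1
  have hWR : (0 : ℝ) < W := by exact_mod_cast hW
  have hWC : (W : ℂ) ≠ 0 := by exact_mod_cast hW.ne'
  have hτC : (τ : ℂ) ≠ 0 := by
    have : τ ≠ 0 := by omega
    exact_mod_cast this
  have e : intToComplex (W • (1 : Matrix (Fin N) (Fin N) ℤ)) = (W : ℂ) • (1 : Mat N) := by
    ext i j
    simp only [Matrix.map_apply, Matrix.smul_apply, Matrix.one_apply]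
    split_ifs <;> simp
  have eP : scaledP τ W (⟨W • 1, W • 1, 0⟩ : DescentState N) = ((1 / τ : ℝ) : ℂ) • (1 : Mat N) := by
    rw [scaledP, e, smul_smul]
    congr 1
    push_cast
    field_simp
  have eQ : scaledQ W (⟨W • 1, W • 1, 0⟩ : DescentState N) = 1 := by
    rw [scaledQ, e, smul_smul]
    push_cast
    rw [one_div, inv_mul_cancel₀ hWC, one_smul]
  rw [eP, eQ]
  have htr : ((((1 / τ : ℝ) : ℂ) • (1 : Mat N)) *
      opOfChoi (ρ.map (Int.cast : ℤ → ℂ)) 1).trace.re ≤ 1 := by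
    rw [Matrix.smul_mul, Matrix.one_mul, trace_smul, smul_eq_mul, Complex.re_ofReal_mul,
      trace_opOfChoi_one, one_div, inv_mul_le_iff₀ (by linarith), mul_one]
    exact trace_map_intCast_le ρ
  refine ⟨⟨?_, Matrix.PosDef.one, by linarith, ?_, ?_⟩, ?_⟩
  · refine Matrix.PosDef.one.smul ?_
    rw [Complex.zero_lt_real]; positivity
  · simpa using Matrix.PosSemidef.zero
  · simpa using Matrix.PosSemidef.zero
  · rw [descentPotential, logDet_smul (by positivity) (by simp), logDet_one, one_div, Real.log_inv]
    rw [one_div] at htr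
    linarith

section

variable {ρ : Bipartite N ℤ} (hρ : (ρ.map (Int.cast : ℤ → ℂ)).PosSemidef) (hN : 1 ≤ N)
  {W : ℤ} {L : ℕ} (hW : 64 * N ^ 3 * 2 ^ L ≤ W)

include hρ hN hW

theorem descentAt_spec {n : ℕ} (hn : n ≤ L) :
    DescentInvariant (opOfChoi (ρ.map (Int.cast : ℤ → ℂ))) (intTrace ρ) (2 ^ n)
      (scaledP (intTrace ρ) W (descentAt ρ (intTrace ρ * W * W) W n))
      (scaledQ W (descentAt ρ (intTrace ρ * W * W) W n)) ∧
    (((descentAt ρ (intTrace ρ * W * W) W n).flag = 0 ∧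
      descentPotential (opOfChoi (ρ.map (Int.cast : ℤ → ℂ)))
        (scaledP (intTrace ρ) W (descentAt ρ (intTrace ρ * W * W) W n))
        (scaledQ W (descentAt ρ (intTrace ρ * W * W) W n)) ≤
      1 + N * Real.log (intTrace ρ) - n * (1 / (32 * N ^ 2))) ∨
     ((descentAt ρ (intTrace ρ * W * W) W n).flag = 1 ∧
      RankNonDecreasing (opOfChoi (ρ.map (Int.cast : ℤ → ℂ))))) := by
  induction n with
  | zero =>
    have hW0 : 0 < W := lt_of_lt_of_le (by positivity) hW
    obtain ⟨h1, h2⟩ := descentInvariant_zero hρ hN hW0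
    exact ⟨h1, Or.inl ⟨rfl, by simpa [descentAt] using h2⟩⟩
  | succ n ih =>
    obtain ⟨h1, h2⟩ := ih (by omega)
    have hWn : 64 * N ^ 3 * 2 ^ n ≤ W := by
      refine le_trans ?_ hW
      have : (2 : ℤ) ^ n ≤ 2 ^ L := pow_le_pow_right₀ (by norm_num) (by omega)
      exact mul_le_mul_of_nonneg_left this (by positivity)
    obtain ⟨h3, h4⟩ := descend_spec hρ hN hWn h1
    refine ⟨h3, ?_⟩
    rw [descentAt]
    rcases h4 with ⟨h5, h6⟩ | h5
    · rcases h2 with ⟨h7, h8⟩ | ⟨h7, h8⟩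
      · refine Or.inl ⟨h5.trans h7, h6.trans ?_⟩
        push_cast
        linarith
      · exact Or.inr ⟨h5.trans h7, h8⟩
    · exact Or.inr h5

/-- An entry of a positive semidefinite matrix is at most the trace, hence at most N times the
operator bound. This keeps the bit length linear in the number of iterations. -/
theorem abs_descentAt_le {n : ℕ} (hn : n ≤ L) (i j : Fin N) :
    |(descentAt ρ (intTrace ρ * W * W) W n).U i j| ≤ N * W * 2 ^ n ∧
      |(descentAt ρ (intTrace ρ * W * W) W n).V i j| ≤ N * W * 2 ^ n := by
  obtain ⟨h, -⟩ := descentAt_spec hρ hN hW hn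
  have hW0 : 0 < W := lt_of_lt_of_le (by positivity) hW
  have hWR : (0 : ℝ) < W := by exact_mod_cast hW0
  have hτ1 := one_le_intTrace hρ
  have hτR : (1 : ℝ) ≤ intTrace ρ := by exact_mod_cast hτ1
  have key : ∀ {A : Matrix (Fin N) (Fin N) ℤ} {w κ : ℝ}, 0 < w →
      ((w : ℂ) • intToComplex A).PosSemidef →
      ((κ : ℂ) • (1 : Mat N) - (w : ℂ) • intToComplex A).PosSemidef →
      κ = w * (W * 2 ^ n) → |A i j| ≤ N * W * 2 ^ n := by
    intro A w κ hw h1 h2 h3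
    have h4 := norm_apply_le_trace h1 i j
    have h5 := (Complex.le_def.mp h2.trace_nonneg).1
    rw [trace_sub, trace_smul, trace_one, smul_eq_mul, Complex.sub_re, Complex.re_ofReal_mul] at h5
    simp only [Matrix.smul_apply, Matrix.map_apply, smul_eq_mul, norm_mul, Complex.norm_real,
      Complex.norm_intCast, Real.norm_eq_abs, abs_of_pos hw] at h4
    simp only [Complex.zero_re, Fintype.card_fin, Complex.natCast_re] at h5
    have h6 : w * (|A i j| : ℤ) ≤ w * (N * W * 2 ^ n) := by
      push_cast
      rw [h3] at h5
      linarith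
    have := le_of_mul_le_mul_left h6 hw
    exact_mod_cast this
  constructor
  · refine key (w := 1 / (intTrace ρ * W)) (by positivity) h.posDef_P.posSemidef h.P_le ?_
    field_simp
  · refine key (w := 1 / W) (by positivity) h.posDef_Q.posSemidef h.Q_le ?_
    field_simp

theorem rankNonDecreasing_of_flag
    (h : (descentAt ρ (intTrace ρ * W * W) W L).flag ≠ 0) :
    RankNonDecreasing (opOfChoi (ρ.map (Int.cast : ℤ → ℂ))) := by
  rcases (descentAt_spec hρ hN hW le_rfl).2 with h1 | h1
  · exact absurd h1.1 h
  · exact h1.2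

/-- Without acceptance the potential would drop by L/(32N²) = (300/32)N²(ℓ + 1) from at most 1 + Nℓ.
By `le_potential` with M = τ it cannot fall below N - Nℓ - 6N², where log τ ≤ ℓ and log N ≤ N. -/
theorem flag_of_hasNonsingular {ℓ : ℕ} (hℓ : intTrace ρ ≤ 2 ^ ℓ) (hL : L = 300 * N ^ 4 * (ℓ + 1))
    (hns : HasNonsingular (imageSpace (ρ.map (Int.cast : ℤ → ℂ)))) :
    (descentAt ρ (intTrace ρ * W * W) W L).flag = 1 := by
  obtain ⟨hI, h⟩ := descentAt_spec hρ hN hW le_rfl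
  rcases h with ⟨-, hpot⟩ | h
  swap
  · exact h.1
  exfalso
  have hN' : (1 : ℝ) ≤ N := by exact_mod_cast hN
  have hτ1 := one_le_intTrace hρ
  have hτR : (1 : ℝ) ≤ intTrace ρ := by exact_mod_cast hτ1
  have hM : ∀ p q, |ρ p q| ≤ ((intTrace ρ).natAbs : ℤ) := by
    intro p q
    have := abs_apply_le_trace hρ p q
    rw [Int.natAbs_of_nonneg (by omega)]
    unfold intTrace
    omega
  have hlow := le_potential hρ hN hM hns hI.posDef_P hI.posDef_Q
  rw [descentPotential] at hpot
  have hMc : (((intTrace ρ).natAbs : ℕ) : ℝ) = intTrace ρ := by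
    rw [Nat.cast_natAbs, abs_of_nonneg (by omega)]
  rw [hMc, Real.log_mul (by positivity) (by positivity), Real.log_pow] at hlow
  have hlogτ : Real.log (intTrace ρ) ≤ ℓ := by
    have h1 : (intTrace ρ : ℝ) ≤ 2 ^ ℓ := by exact_mod_cast hℓ
    have h2 := Real.log_le_log (by linarith) h1
    rw [Real.log_pow] at h2
    have h3 : Real.log 2 ≤ 1 := by have := Real.log_two_lt_d9; linarith
    nlinarith [Nat.cast_nonneg (α := ℝ) ℓ]
  have hlogN : Real.log N ≤ N := (Real.log_le_sub_one_of_pos (by linarith)).trans (by linarith)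
  have hLR : (L : ℝ) * (1 / (32 * N ^ 2)) = 300 / 32 * N ^ 2 * (ℓ + 1) := by
    rw [hL]; push_cast; field_simp
  rw [hLR] at hpot
  push_cast at hlow
  have hℓ0 : (0 : ℝ) ≤ ℓ := Nat.cast_nonneg ℓ
  have h1 : (N : ℝ) * Real.log (intTrace ρ) ≤ N * ℓ := mul_le_mul_of_nonneg_left hlogτ (by linarith)
  have h2 : (N : ℝ) * Real.log N ≤ N * N := mul_le_mul_of_nonneg_left hlogN (by linarith)
  have h3 : (N : ℝ) * ℓ ≤ N ^ 2 * ℓ := by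
    refine mul_le_mul_of_nonneg_right ?_ hℓ0
    nlinarith
  have h4 : 1 ≤ (N : ℝ) ^ 2 := one_le_pow₀ hN'
  nlinarith

end

end OperatorScaling

namespace OperatorScaling

/-! ### Executing programs with bounded memory contents -/

theorem bitLength_le_of_abs_lt {z : ℤ} {β : ℕ} (h : |z| < 2 ^ β) : bitLength z ≤ β + 1 := by
  rw [bitLength, Nat.add_le_add_iff_right, Nat.size_le]
  zify
  exact h

theorem natAbs_lt_two_pow_bitLength (z : ℤ) : z.natAbs < 2 ^ (bitLength z - 1) := by
  rw [bitLength, Nat.add_sub_cancel]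
  exact Nat.lt_size_self _

theorem abs_lt_two_pow_bitLength (z : ℤ) : |z| < 2 ^ bitLength z := by
  have h := natAbs_lt_two_pow_bitLength z
  have h2 : z.natAbs < 2 ^ bitLength z :=
    h.trans_le (Nat.pow_le_pow_right (by norm_num) (Nat.sub_le _ _))
  zify at h2
  exact h2

/-- Both summands are charged a sign bit but the result only one; the spare bit covers the carry. -/
theorem bitLength_add_le_add (x y : ℤ) : bitLength (x + y) ≤ bitLength x + bitLength y := by
  have hx : x.natAbs < 2 ^ x.natAbs.size := Nat.lt_size_self _
  have hy : y.natAbs < 2 ^ y.natAbs.size := Nat.lt_size_self _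
  have h : (x + y).natAbs.size ≤ x.natAbs.size + y.natAbs.size + 1 := by
    rw [Nat.size_le]
    have h1 : 2 ^ x.natAbs.size ≤ 2 ^ (x.natAbs.size + y.natAbs.size) :=
      Nat.pow_le_pow_right (by norm_num) (by omega)
    have h2 : 2 ^ y.natAbs.size ≤ 2 ^ (x.natAbs.size + y.natAbs.size) :=
      Nat.pow_le_pow_right (by norm_num) (by omega)
    have h3 := Int.natAbs_add_le x y
    rw [pow_succ]
    omega
  unfold bitLength
  omega

theorem bitLength_neg (x : ℤ) : bitLength (-x) = bitLength x := by
  rw [bitLength, bitLength, Int.natAbs_neg]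

theorem bitLength_sub_le_add (x y : ℤ) : bitLength (x - y) ≤ bitLength x + bitLength y := by
  rw [sub_eq_add_neg, ← bitLength_neg y]
  exact bitLength_add_le_add _ _

theorem bitLength_mul_le_add (x y : ℤ) : bitLength (x * y) ≤ bitLength x + bitLength y := by
  have hx : x.natAbs < 2 ^ x.natAbs.size := Nat.lt_size_self _
  have hy : y.natAbs < 2 ^ y.natAbs.size := Nat.lt_size_self _
  have h : (x * y).natAbs.size ≤ x.natAbs.size + y.natAbs.size := by
    rw [Nat.size_le, Int.natAbs_mul, pow_add]
    exact Nat.mul_lt_mul_of_lt_of_le hx hy.le (by positivity)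
  unfold bitLength
  omega

theorem bitLength_ediv_le_add (x y : ℤ) : bitLength (x / y) ≤ bitLength x + bitLength y := by
  have h : (x / y).natAbs.size ≤ x.natAbs.size :=
    Nat.size_le_size (Int.natAbs_ediv_le_natAbs x y)
  unfold bitLength
  omega

namespace Expr

instance : Add Expr := ⟨Expr.add⟩
instance : Sub Expr := ⟨Expr.sub⟩
instance : Mul Expr := ⟨Expr.mul⟩
instance : Div Expr := ⟨Expr.div⟩

/-- The variable kept in cell `0` of array `a`. -/
def var (a : ℕ) : Expr := .load a (.const 0)

theorem eval_add (m : Memory) (e f : Expr) : (e + f).eval m = e.eval m + f.eval m := rfl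
theorem eval_sub (m : Memory) (e f : Expr) : (e - f).eval m = e.eval m - f.eval m := rfl
theorem eval_mul (m : Memory) (e f : Expr) : (e * f).eval m = e.eval m * f.eval m := rfl
theorem eval_div (m : Memory) (e f : Expr) : (e / f).eval m = e.eval m / f.eval m := rfl
theorem eval_const (m : Memory) (z : ℤ) : (const z).eval m = z := rfl
theorem eval_load (m : Memory) (a : ℕ) (e : Expr) : (load a e).eval m = m a (e.eval m) := rfl
theorem eval_var (m : Memory) (a : ℕ) : (var a).eval m = m a 0 := rfl

/-- A bound for the growth of the bit length in the evaluation of an expression. -/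
def weight : Expr → ℕ
  | const z => bitLength z
  | load _ _ => 1
  | add e f => e.weight + f.weight
  | sub e f => e.weight + f.weight
  | mul e f => e.weight + f.weight
  | div e f => e.weight + f.weight

/-- A bound for the cost of the evaluation of an expression, relative to the word length. -/
def costWeight : Expr → ℕ
  | const z => bitLength z
  | load _ e => e.costWeight + 1
  | add e f => e.costWeight + f.costWeight + (e.weight + f.weight)
  | sub e f => e.costWeight + f.costWeight + (e.weight + f.weight)
  | mul e f => e.costWeight + f.costWeight + (e.weight + f.weight)
  | div e f => e.costWeight + f.costWeight + (e.weight + f.weight)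

end Expr

/-- All cells hold integers of at most `β` bits. -/
def Bounded (β : ℕ) (m : Memory) : Prop := ∀ a z, |m a z| < 2 ^ β

/-- Each operation at most adds the bit lengths of its operands, and a load returns a bounded word
whatever its address. So the growth depends on the program text only. -/
theorem Expr.bitLength_eval_le {β : ℕ} {m : Memory} (h : Bounded β m) (e : Expr) :
    bitLength (e.eval m) ≤ e.weight * (β + 1) := by
  induction e with
  | const z => exact Nat.le_mul_of_pos_right _ (by omega)
  | load a e _ =>
    rw [weight, one_mul]
    exact bitLength_le_of_abs_lt (h _ _)
  | add e f he hf =>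
    rw [weight, add_mul]
    exact (bitLength_add_le_add _ _).trans (add_le_add he hf)
  | sub e f he hf =>
    rw [weight, add_mul]
    exact (bitLength_sub_le_add _ _).trans (add_le_add he hf)
  | mul e f he hf =>
    rw [weight, add_mul]
    exact (bitLength_mul_le_add _ _).trans (add_le_add he hf)
  | div e f he hf =>
    rw [weight, add_mul]
    exact (bitLength_ediv_le_add _ _).trans (add_le_add he hf)

theorem Expr.cost_le {β : ℕ} {m : Memory} (h : Bounded β m) (e : Expr) :
    e.cost m ≤ e.costWeight * (β + 1) := by
  induction e with
  | const z => exact Nat.le_mul_of_pos_right _ (by omega)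
  | load a e he =>
    rw [costWeight, add_mul, one_mul]
    exact add_le_add he (bitLength_le_of_abs_lt (h _ _))
  | add e f he hf =>
    rw [costWeight, add_mul, add_mul (e.costWeight)]
    exact add_le_add (add_le_add he hf) (bitLength_eval_le h (.add e f))
  | sub e f he hf =>
    rw [costWeight, add_mul, add_mul (e.costWeight)]
    exact add_le_add (add_le_add he hf) (bitLength_eval_le h (.sub e f))
  | mul e f he hf =>
    rw [costWeight, add_mul, add_mul (e.costWeight)]
    exact add_le_add (add_le_add he hf) (bitLength_eval_le h (.mul e f))
  | div e f he hf =>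
    rw [costWeight, add_mul, add_mul (e.costWeight)]
    exact add_le_add (add_le_add he hf) (bitLength_eval_le h (.div e f))

/-- The memory with one cell changed. -/
def setCell (m : Memory) (a : ℕ) (z v : ℤ) : Memory :=
  Function.update m a (Function.update (m a) z v)

theorem setCell_of_ne (m : Memory) {a b : ℕ} (h : b ≠ a) (z v : ℤ) : setCell m a z v b = m b :=
  Function.update_of_ne h _ _

theorem setCell_self (m : Memory) (a : ℕ) (z v : ℤ) : setCell m a z v a z = v := by
  simp [setCell]

theorem setCell_of_ne_address (m : Memory) (a : ℕ) {z z' : ℤ} (h : z' ≠ z) (v : ℤ) :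
    setCell m a z v a z' = m a z' := by
  simp [setCell, h]

theorem Bounded.setCell {β : ℕ} {m : Memory} (h : Bounded β m) {a : ℕ} {z v : ℤ}
    (hv : |v| < 2 ^ β) : Bounded β (setCell m a z v) := by
  intro b y
  by_cases hb : b = a
  · subst hb
    by_cases hy : y = z
    · rw [hy, setCell_self]; exact hv
    · rw [setCell_of_ne_address _ _ hy]; exact h _ _
  · rw [setCell_of_ne _ hb]; exact h _ _

/-- The program halts at a cost of at most `k` word operations on words of `β + 1` bits. -/
def Exec (β : ℕ) (p : Prog) (m m' : Memory) (k : ℕ) : Prop :=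
  ∃ t, Run p m m' t ∧ t ≤ k * (β + 1)

theorem Exec.mono {β : ℕ} {p : Prog} {m m' : Memory} {k k' : ℕ} (h : Exec β p m m' k)
    (hk : k ≤ k') : Exec β p m m' k' := by
  obtain ⟨t, h1, h2⟩ := h
  exact ⟨t, h1, h2.trans (Nat.mul_le_mul_right _ hk)⟩

theorem exec_store {β : ℕ} {m : Memory} (h : Bounded β m) (a : ℕ) (e f : Expr) :
    Exec β (.store a e f) m (setCell m a (e.eval m) (f.eval m))
      (e.costWeight + f.costWeight + 1) := by
  refine ⟨_, Run.store a e f m, ?_⟩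
  have h1 := e.cost_le h
  have h2 := f.cost_le h
  rw [add_mul, add_mul]
  omega

theorem Exec.seq {β : ℕ} {p q : Prog} {m m' m'' : Memory} {k k' : ℕ} (h : Exec β p m m' k)
    (h' : Exec β q m' m'' k') : Exec β (.seq p q) m m'' (k + k' + 1) := by
  obtain ⟨t, h1, h2⟩ := h
  obtain ⟨t', h3, h4⟩ := h'
  refine ⟨_, Run.seq h1 h3, ?_⟩
  rw [add_mul, add_mul]
  omega

theorem exec_ifPos_true {β : ℕ} {e : Expr} {p q : Prog} {m m' : Memory} {k : ℕ} (hb : Bounded β m)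
    (he : 0 < e.eval m) (h : Exec β p m m' k) :
    Exec β (.ifPos e p q) m m' (e.costWeight + k + 1) := by
  obtain ⟨t, h1, h2⟩ := h
  refine ⟨_, Run.ifTrue he h1, ?_⟩
  have := e.cost_le hb
  rw [add_mul, add_mul]
  omega

theorem exec_ifPos_false {β : ℕ} {e : Expr} {p q : Prog} {m m' : Memory} {k : ℕ} (hb : Bounded β m)
    (he : e.eval m ≤ 0) (h : Exec β q m m' k) :
    Exec β (.ifPos e p q) m m' (e.costWeight + k + 1) := by
  obtain ⟨t, h1, h2⟩ := h
  refine ⟨_, Run.ifFalse he h1, ?_⟩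
  have := e.cost_le hb
  rw [add_mul, add_mul]
  omega

theorem exec_whilePos_false {β : ℕ} {e : Expr} {p : Prog} {m : Memory} (hb : Bounded β m)
    (he : e.eval m ≤ 0) : Exec β (.whilePos e p) m m (e.costWeight + 1) := by
  refine ⟨_, Run.whileFalse he, ?_⟩
  have := e.cost_le hb
  rw [add_mul]
  omega

theorem exec_whilePos_true {β : ℕ} {e : Expr} {p : Prog} {m m' m'' : Memory} {k k' : ℕ}
    (hb : Bounded β m) (he : 0 < e.eval m) (h : Exec β p m m' k)
    (h' : Exec β (.whilePos e p) m' m'' k') :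
    Exec β (.whilePos e p) m m'' (e.costWeight + k + k' + 1) := by
  obtain ⟨t, h1, h2⟩ := h
  obtain ⟨t', h3, h4⟩ := h'
  refine ⟨_, Run.whileTrue he h1 h3, ?_⟩
  have := e.cost_le hb
  rw [add_mul, add_mul, add_mul]
  omega

/-! ### Counting loops -/

/-- `for k = 0, …, n - 1` -/
def forProg (k : ℕ) (n : Expr) (body : Prog) : Prog :=
  .seq (.store k (.const 0) (.const 0))
    (.whilePos (n - .var k) (.seq body (.store k (.const 0) (.var k + .const 1))))

/-- A bound for the cost of a counting loop. -/
def forCost (e : Expr) (c n : ℕ) : ℕ := (n + 1) * (e.costWeight + e.weight + c + 20)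

/-- An invariant rule. The invariant is stated at the loop test, so the body must establish it for
the memory in which the counter has just been advanced. -/
theorem exec_for {β : ℕ} {k : ℕ} {e : Expr} {body : Prog} {c n : ℕ} {Inv : ℕ → Memory → Prop}
    (hn : ∀ i m, i ≤ n → Inv i m → Bounded β m ∧ m k 0 = i ∧ e.eval m = n)
    (hbody : ∀ i m, i < n → Inv i m → ∃ m', Exec β body m m' c ∧ Bounded β m' ∧ m' k 0 = i ∧
      Inv (i + 1) (setCell m' k 0 (i + 1)))
    {m : Memory} (hm : Bounded β m) (h0 : Inv 0 (setCell m k 0 0)) :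
    ∃ m', Exec β (forProg k e body) m m' (forCost e c n) ∧ Inv n m' := by
  have h1 : bitLength 0 = 1 := rfl
  have h2 : bitLength 1 = 2 := rfl
  have hw : (e - Expr.var k).costWeight = e.costWeight + 2 + (e.weight + 1) := by
    show (Expr.sub e (Expr.load k (.const 0))).costWeight = _
    simp [Expr.costWeight, Expr.weight, h1]
  have hv : (Expr.var k + Expr.const 1).costWeight = 7 := by
    show (Expr.add (Expr.load k (.const 0)) (.const 1)).costWeight = _
    simp [Expr.costWeight, Expr.weight, h1, h2]
  -- Induction on the number r of rounds left.
  have key : ∀ r i m, i + r = n → Inv i m → ∃ m',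
      Exec β (.whilePos (e - .var k) (.seq body (.store k (.const 0) (.var k + .const 1)))) m m'
        (r * (e.costWeight + e.weight + c + 20) + (e.costWeight + e.weight + 4)) ∧ Inv n m' := by
    intro r
    induction r with
    | zero =>
      intro i m hi hI
      obtain rfl : i = n := by omega
      obtain ⟨hb, hk, he⟩ := hn i m le_rfl hI
      refine ⟨m, (exec_whilePos_false hb ?_).mono ?_, hI⟩
      · rw [Expr.eval_sub, Expr.eval_var, he, hk, sub_self]
      · rw [hw]; omega
    | succ r ih =>
      intro i m hi hI
      obtain ⟨hb, hk, he⟩ := hn i m (by omega) hI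
      obtain ⟨m1, hm1, hb1, hk1, hI1⟩ := hbody i m (by omega) hI
      obtain ⟨m2, hm2, hI2⟩ := ih (i + 1) _ (by omega) hI1
      refine ⟨m2, (exec_whilePos_true
        (k' := r * (e.costWeight + e.weight + c + 20) + (e.costWeight + e.weight + 4))
        hb ?_ (hm1.seq (exec_store hb1 _ _ _)) ?_).mono ?_, hI2⟩
      · rw [Expr.eval_sub, Expr.eval_var, he, hk, sub_pos]
        exact_mod_cast (by omega : i < n)
      · rw [Expr.eval_add, Expr.eval_var, Expr.eval_const, Expr.eval_const, hk1]
        exact hm2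
      · rw [hw, hv, add_mul, one_mul]
        simp only [Expr.costWeight, h1]
        omega
  obtain ⟨m', hm', hI⟩ := key n 0 _ (by omega) h0
  refine ⟨m', ((exec_store hm k (.const 0) (.const 0)).seq hm').mono ?_, hI⟩
  simp only [Expr.costWeight, h1, forCost, add_mul, one_mul]
  omega

/-- `x := e₀; for k = 0, …, n - 1: x := e` -/
def foldProg (x k : ℕ) (e₀ n e : Expr) : Prog :=
  .seq (.store x (.const 0) e₀) (forProg k n (.store x (.const 0) e))

/-- A bound for the cost of `foldProg`. -/
def foldCost (e₀ e e' : Expr) (n : ℕ) : ℕ := e₀.costWeight + forCost e (e'.costWeight + 2) n + 3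

/-- The sequence g prescribes the value of the accumulator before each round. Requiring all its
values to fit into a word keeps the memory bounded throughout the loop. -/
theorem exec_fold {β x k n : ℕ} (hxk : x ≠ k) {e₀ en e : Expr} {g : ℕ → ℤ} {m : Memory}
    (hm : Bounded β m) (hg : ∀ i ≤ n, |g i| < 2 ^ β) (hnβ : (n : ℤ) < 2 ^ β)
    (he₀ : e₀.eval m = g 0)
    (hn : ∀ m' : Memory, (∀ a, a ≠ x → a ≠ k → m' a = m a) → en.eval m' = n)
    (he : ∀ i < n, ∀ m' : Memory, (∀ a, a ≠ x → a ≠ k → m' a = m a) → m' x 0 = g i → m' k 0 = i →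
      e.eval m' = g (i + 1)) :
    ∃ m', Exec β (foldProg x k e₀ en e) m m' (foldCost e₀ en e n) ∧ Bounded β m' ∧
      (∀ a, a ≠ x → a ≠ k → m' a = m a) ∧ m' x 0 = g n := by
  have h1 : bitLength 0 = 1 := rfl
  have hcast : ∀ i ≤ n, |(i : ℤ)| < 2 ^ β := fun i hi => by
    rw [abs_of_nonneg (by positivity)]
    exact lt_of_le_of_lt (by exact_mod_cast hi) hnβ
  set Inv : ℕ → Memory → Prop := fun i m' => i ≤ n ∧ Bounded β m' ∧ m' k 0 = i ∧ m' x 0 = g i ∧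
    ∀ a, a ≠ x → a ≠ k → m' a = m a with hInv
  have hs := exec_store hm x (.const 0) e₀
  rw [he₀, Expr.eval_const] at hs
  have hb1 : Bounded β (setCell m x 0 (g 0)) := hm.setCell (hg 0 (Nat.zero_le _))
  obtain ⟨m', hm', hI⟩ := exec_for (β := β) (k := k) (e := en) (c := e.costWeight + 2) (n := n)
    (body := .store x (.const 0) e) (Inv := Inv)
    (fun i m' _ hI => ⟨hI.2.1, hI.2.2.1, hn m' hI.2.2.2.2⟩) (fun i m1 hi hI => by
      obtain ⟨hin, hb, hk, hx, ha⟩ := hI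
      have hev := he i hi m1 ha hx hk
      have hst := exec_store hb x (.const 0) e
      rw [hev, Expr.eval_const] at hst
      have hk' : setCell m1 x 0 (g (i + 1)) k 0 = i := by rw [setCell_of_ne _ hxk.symm, hk]
      refine ⟨_, hst.mono (by simp only [Expr.costWeight, h1]; omega),
        hb.setCell (hg _ (by omega)), hk', by omega, (hb.setCell (hg _ (by omega))).setCell ?_, ?_,
            ?_, ?_⟩
      · exact_mod_cast hcast (i + 1) (by omega)
      · rw [setCell_self]; push_cast; ring
      · rw [setCell_of_ne _ hxk, setCell_self]
      · intro a hax hak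
        rw [setCell_of_ne _ hak, setCell_of_ne _ hax, ha a hax hak]) hb1
    ⟨Nat.zero_le _, hb1.setCell (by simp), by rw [setCell_self]; rfl,
      by rw [setCell_of_ne _ hxk, setCell_self], fun a hax hak => by
        rw [setCell_of_ne _ hak, setCell_of_ne _ hax]⟩
  refine ⟨m', (hs.seq hm').mono ?_, hI.2.1, hI.2.2.2.2, hI.2.2.2.1⟩
  simp only [Expr.costWeight, h1, foldCost]
  omega

/-- The loop variables `x = 10`, `k = 11`, `z = 12` of `mapProg`, and its target array. -/
def Agree (dst : ℕ) (m m' : Memory) : Prop :=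
  ∀ a, a ≠ 10 → a ≠ 11 → a ≠ 12 → a ≠ dst → m' a = m a

/-- `for z = 0, …, nz - 1: dst[z] := f`, where `f` may use the sum `x` of `e` over `k < nk`. -/
def mapProg (dst : ℕ) (nz nk e f : Expr) : Prog :=
  forProg 12 nz (.seq (foldProg 10 11 (.const 0) nk (.var 10 + e)) (.store dst (.var 12) f))

/-- A bound for the cost of `mapProg`. -/
def mapCost (nz nk e f : Expr) (n n' : ℕ) : ℕ :=
  forCost nz (foldCost (.const 0) nk (.var 10 + e) n' + f.costWeight + 4) n

/-- The bijections σ and τ identify loop counters with index types, so later specifications can use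
sums over indices instead of addresses. The bound n'B controls all partial sums, not just the final
one. -/
theorem exec_map {β dst n n' : ℕ} (h10 : dst ≠ 10) (h11 : dst ≠ 11) (h12 : dst ≠ 12)
    {κ ι : Type} [Fintype ι] (σ : Fin n ≃ κ) (τ : Fin n' ≃ ι) {nz nk e f : Expr} {t : κ → ι → ℤ}
    {h : κ → ℤ} {B : ℤ} {m : Memory} (hm : Bounded β m)
    (hnz : ∀ m' : Memory, Agree dst m m' → nz.eval m' = n)
    (hnk : ∀ m' : Memory, Agree dst m m' → nk.eval m' = n')
    (he : ∀ a b, ∀ m' : Memory, Agree dst m m' → m' 12 0 = (σ.symm a : ℕ) →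
      m' 11 0 = (τ.symm b : ℕ) → e.eval m' = t a b)
    (hf : ∀ a, ∀ m' : Memory, Agree dst m m' → m' 12 0 = (σ.symm a : ℕ) →
      m' 10 0 = ∑ b, t a b → f.eval m' = h a)
    (hnβ : (n : ℤ) < 2 ^ β) (hnβ' : (n' : ℤ) < 2 ^ β) (ht : ∀ a b, |t a b| ≤ B)
    (hB : n' * B < 2 ^ β) (hh : ∀ a, |h a| < 2 ^ β) :
    ∃ m', Exec β (mapProg dst nz nk e f) m m' (mapCost nz nk e f n n') ∧ Bounded β m' ∧
      Agree dst m m' ∧ ∀ a, m' dst (σ.symm a : ℕ) = h a := by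
  have h1 : bitLength 0 = 1 := rfl
  have hvw : (Expr.var 12).costWeight = 2 := rfl
  have hcast : ∀ i ≤ n, |(i : ℤ)| < 2 ^ β := fun i hi => by
    rw [abs_of_nonneg (by positivity)]
    exact lt_of_le_of_lt (by exact_mod_cast hi) hnβ
  set Inv : ℕ → Memory → Prop := fun i m' => Bounded β m' ∧ m' 12 0 = i ∧ Agree dst m m' ∧
    ∀ j : Fin n, (j : ℕ) < i → m' dst (j : ℕ) = h (σ j) with hInv
  obtain ⟨m', hm', hI⟩ := exec_for (β := β) (k := 12) (e := nz)
    (c := foldCost (.const 0) nk (.var 10 + e) n' + f.costWeight + 4) (n := n)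
    (body := .seq (foldProg 10 11 (.const 0) nk (.var 10 + e)) (.store dst (.var 12) f)) (Inv :=
        Inv)
    (fun i m' _ hI => ⟨hI.1, hI.2.1, hnz m' hI.2.2.1⟩) (fun i m1 hi hI => by
      obtain ⟨hb, hz, ha, hd⟩ := hI
      set a := σ ⟨i, hi⟩ with haa
      have hσ : (σ.symm a : ℕ) = i := by rw [haa, Equiv.symm_apply_apply]
      -- Partial sums in the order of the loop; the value 0 beyond n' only makes g total.
      set g : ℕ → ℤ := fun j => ∑ l ∈ Finset.range j, if hl : l < n' then t a (τ ⟨l, hl⟩) else 0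
        with hg
      have hgn : g n' = ∑ b, t a b := by
        rw [hg]
        simp only
        rw [Finset.sum_range, ← Equiv.sum_comp τ]
        refine Finset.sum_congr rfl fun l _ => ?_
        rw [dif_pos l.2]
      have hga : ∀ j ≤ n', |g j| < 2 ^ β := by
        intro j hj
        refine lt_of_le_of_lt ?_ hB
        calc |g j| ≤ ∑ l ∈ Finset.range j, |if hl : l < n' then t a (τ ⟨l, hl⟩) else 0| :=
              Finset.abs_sum_le_sum_abs _ _
          _ ≤ ∑ _l ∈ Finset.range j, B := Finset.sum_le_sum fun l hl => by
              rw [dif_pos (by rw [Finset.mem_range] at hl; omega)]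
              exact ht _ _
          _ = j * B := by simp
          _ ≤ n' * B := by
              rcases Nat.eq_zero_or_pos n' with h0 | h0
              · rw [h0] at hj ⊢
                rw [Nat.le_zero.mp hj]
              · have hB0 : 0 ≤ B := (abs_nonneg _).trans (ht a (τ ⟨0, h0⟩))
                exact mul_le_mul_of_nonneg_right (by exact_mod_cast hj) hB0
      have agree : ∀ m' : Memory, (∀ b, b ≠ 10 → b ≠ 11 → m' b = m1 b) → Agree dst m m' :=
        fun m' h' b b1 b2 b3 b4 => (h' b b1 b2).trans (ha b b1 b2 b3 b4)
      obtain ⟨m2, e2, b2, a2, x2⟩ := exec_fold (β := β) (x := 10) (k := 11) (n := n')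
        (e₀ := .const 0) (en := nk) (e := .var 10 + e) (g := g) (by norm_num) hb hga hnβ'
        (by rw [Expr.eval_const, hg]; simp) (fun m' h' => hnk m' (agree m' h'))
        (fun j hj m' h' hx hk => by
          have hev := he a (τ ⟨j, hj⟩) m' (agree m' h') (by rw [h' 12 (by norm_num) (by norm_num),
              hz, hσ])
            (by rw [Equiv.symm_apply_apply]; exact hk)
          rw [Expr.eval_add, Expr.eval_var, hx, hev, hg]
          simp only [Finset.sum_range_succ]
          rw [dif_pos hj])
      have hz2 : m2 12 0 = i := by rw [a2 12 (by norm_num) (by norm_num), hz]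
      have hev := hf a m2 (agree m2 a2) (by rw [hz2, hσ]) (by rw [x2, hgn])
      have hst := exec_store b2 dst (.var 12) f
      rw [hev, Expr.eval_var, hz2] at hst
      have hb3 := b2.setCell (a := dst) (z := i) (hh a)
      refine ⟨_, (e2.seq hst).mono (by rw [hvw]; omega), hb3, ?_, hb3.setCell ?_, ?_, ?_, ?_⟩
      · rw [setCell_of_ne _ h12.symm, hz2]
      · exact_mod_cast hcast (i + 1) (by omega)
      · rw [setCell_self]; push_cast; ring
      · intro b b1 b2' b3 b4
        rw [setCell_of_ne _ b3, setCell_of_ne _ b4]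
        exact agree m2 a2 b b1 b2' b3 b4
      · intro j hj
        rw [setCell_of_ne _ h12]
        by_cases hji : (j : ℕ) = i
        · have : j = ⟨i, hi⟩ := Fin.ext hji
          rw [hji, setCell_self, haa, this]
        · rw [setCell_of_ne_address _ _ (by exact_mod_cast hji), a2 dst h10 h11]
          exact hd j (by omega)) hm
    ⟨hm.setCell (by simp), by rw [setCell_self]; rfl, fun a _ _ a3 _ => by rw [setCell_of_ne _ a3],
      fun j hj => by omega⟩
  exact ⟨m', hm', hI.1, hI.2.2.1, fun a => by
    have := hI.2.2.2 (σ.symm a) (σ.symm a).2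
    rwa [Equiv.apply_symm_apply] at this⟩

end OperatorScaling

namespace OperatorScaling

/-! ### Matrix arithmetic with programs -/

namespace Expr

/-- The row of the entry number `x` of a matrix. -/
def rowOf (x : ℕ) : Expr := var x / var 0

/-- The column of the entry number `x` of a matrix. -/
def colOf (x : ℕ) : Expr := var x - var x / var 0 * var 0

/-- The entry `(e, f)` of the matrix in array `a`. -/
def entry (a : ℕ) (e f : Expr) : Expr := load a (e * var 0 + f)

/-- `1` if `e = f` and `0` otherwise. -/
def delta (e f : Expr) : Expr := const 1 / (const 1 + (e - f) * (e - f))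

theorem eval_rowOf {N : ℕ} {m : Memory} (h0 : m 0 0 = N) {x : ℕ} {i j : Fin N}
    (hx : m x 0 = (finProdFinEquiv (i, j) : ℕ)) : (rowOf x).eval m = (i : ℕ) := by
  rw [rowOf, eval_div, eval_var, eval_var, h0, hx, ← Int.natCast_ediv, finProdFinEquiv_apply_val,
    Nat.add_mul_div_left _ _ i.pos, Nat.div_eq_of_lt j.2, zero_add]

theorem eval_colOf {N : ℕ} {m : Memory} (h0 : m 0 0 = N) {x : ℕ} {i j : Fin N}
    (hx : m x 0 = (finProdFinEquiv (i, j) : ℕ)) : (colOf x).eval m = (j : ℕ) := by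
  have h := eval_rowOf h0 hx
  rw [rowOf] at h
  rw [colOf, eval_sub, eval_mul, h, eval_var, eval_var, h0, hx, finProdFinEquiv_apply_val]
  push_cast
  ring

theorem eval_entry {N : ℕ} {m : Memory} (h0 : m 0 0 = N) (a : ℕ) (e f : Expr) :
    (entry a e f).eval m = m a (e.eval m * N + f.eval m) := by
  rw [entry, eval_load, eval_add, eval_mul, eval_var, h0]

/-- For e ≠ f the denominator 1 + (e - f)² is at least 2, so the integer quotient is 0. -/
theorem eval_delta (m : Memory) (e f : Expr) :
    (delta e f).eval m = if e.eval m = f.eval m then 1 else 0 := by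
  rw [delta, eval_div, eval_add, eval_mul, eval_sub, eval_const]
  split_ifs with h
  · rw [h]; simp
  · refine Int.ediv_eq_zero_of_lt (by norm_num) ?_
    have : 0 < (e.eval m - f.eval m) * (e.eval m - f.eval m) :=
      mul_self_pos.mpr (sub_ne_zero.mpr h)
    omega

end Expr

open OperatorScaling.Expr

/-- The matrix `A` is stored row by row in array `a`. -/
def Stores {N : ℕ} (a : ℕ) (A : Matrix (Fin N) (Fin N) ℤ) (m : Memory) : Prop :=
  ∀ i j : Fin N, m a ((i : ℕ) * N + (j : ℕ)) = A i j

theorem Stores.congr {N a : ℕ} {A : Matrix (Fin N) (Fin N) ℤ} {m m' : Memory} (h : Stores a A m)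
    (ha : m' a = m a) : Stores a A m' := fun i j => by rw [ha]; exact h i j

theorem Stores.eval_entry {N a : ℕ} {A : Matrix (Fin N) (Fin N) ℤ} {m : Memory}
    (h : Stores a A m) (h0 : m 0 0 = N) {e f : Expr} {i j : Fin N} (he : e.eval m = (i : ℕ))
    (hf : f.eval m = (j : ℕ)) : (entry a e f).eval m = A i j := by
  rw [Expr.eval_entry h0, he, hf]
  exact h i j

/-- The constant depends on the expressions alone, hence is uniform in N, ρ and the word length. -/
theorem mapCost_le (nz nk e f : Expr) : ∃ K, ∀ n n', mapCost nz nk e f n n' ≤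
    K * ((n + 1) * (n' + 1)) := by
  refine ⟨nz.costWeight + nz.weight + (const 0).costWeight + (nk.costWeight + nk.weight +
    ((Expr.var 10 + e).costWeight + 2) + 20) + 3 + f.costWeight + 4 + 20, fun n n' => ?_⟩
  rw [mapCost, foldCost, forCost, forCost]
  generalize nk.costWeight + nk.weight + ((Expr.var 10 + e).costWeight + 2) + 20 = x
  generalize (const 0).costWeight = y
  generalize nz.costWeight + nz.weight = u
  generalize f.costWeight = v
  have : u + (y + (n' + 1) * x + 3 + v + 4) + 20 ≤ (u + y + x + 3 + v + 4 + 20) * (n' + 1) := by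
    nlinarith
  calc _ ≤ (n + 1) * ((u + y + x + 3 + v + 4 + 20) * (n' + 1)) := Nat.mul_le_mul_left _ this
    _ = _ := by ring

/-- `for all i, j: dst[i, j] := f`, where `f` may use the sum `x` of `e` over `k < nk`. -/
def matrixProg (dst : ℕ) (nk e f : Expr) : Prog := mapProg dst (var 0 * var 0) nk e f

theorem exec_matrix {N β dst n' : ℕ} (h0 : dst ≠ 0) (h10 : dst ≠ 10) (h11 : dst ≠ 11)
    (h12 : dst ≠ 12) {ι : Type} [Fintype ι] (τ : ι ≃ Fin n') {nk e f : Expr}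
    (t : Fin N → Fin N → ι → ℤ) (H : Matrix (Fin N) (Fin N) ℤ) (B : ℤ) {m : Memory}
    (hm : Bounded β m) (hN : m 0 0 = N) (hnk : ∀ m' : Memory, m' 0 0 = N → nk.eval m' = n')
    (he : ∀ (i j : Fin N) b, ∀ m' : Memory, m' 0 0 = N → Agree dst m m' →
      (rowOf 12).eval m' = (i : ℕ) → (colOf 12).eval m' = (j : ℕ) →
      m' 11 0 = (τ b : ℕ) → e.eval m' = t i j b)
    (hf : ∀ i j : Fin N, ∀ m' : Memory, m' 0 0 = N → Agree dst m m' → m' 12 0 = (i : ℕ) * N + (j :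
        ℕ) →
      (rowOf 12).eval m' = (i : ℕ) → (colOf 12).eval m' = (j : ℕ) →
      m' 10 0 = ∑ b, t i j b → f.eval m' = H i j)
    (hnβ : (N : ℤ) * N < 2 ^ β) (hnβ' : (n' : ℤ) < 2 ^ β) (ht : ∀ i j b, |t i j b| ≤ B)
    (hB : n' * B < 2 ^ β) (hh : ∀ i j, |H i j| < 2 ^ β) :
    ∃ m', Exec β (matrixProg dst nk e f) m m'
      (mapCost (var 0 * var 0) nk e f (N * N) n') ∧ Bounded β m' ∧
      Agree dst m m' ∧ Stores dst H m' := by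
  have hN' : ∀ m' : Memory, Agree dst m m' → m' 0 0 = N := fun m' h => by
    rw [h 0 (by norm_num) (by norm_num) (by norm_num) h0.symm, hN]
  obtain ⟨m', h1, h2, h3, h4⟩ := exec_map (β := β) h10 h11 h12 finProdFinEquiv.symm τ.symm
    (nz := var 0 * var 0) (nk := nk) (e := e) (f := f) (t := fun a b => t a.1 a.2 b)
    (h := fun a => H a.1 a.2) (B := B) hm
    (fun m' h => by rw [eval_mul, eval_var, hN' m' h]; push_cast; rfl)
    (fun m' h => hnk m' (hN' m' h))
    (fun a b m' h hz hk => he a.1 a.2 b m' (hN' m' h) h (eval_rowOf (hN' m' h) hz)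
      (eval_colOf (hN' m' h) hz) hk)
    (fun a m' h hz hx => hf a.1 a.2 m' (hN' m' h) h
      (by rw [hz, Equiv.symm_symm, finProdFinEquiv_apply_val]; push_cast; ring)
      (eval_rowOf (hN' m' h) hz) (eval_colOf (hN' m' h) hz) hx)
    (by exact_mod_cast hnβ) hnβ' (fun a b => ht _ _ _) hB (fun a => hh _ _)
  refine ⟨m', h1, h2, h3, fun i j => ?_⟩
  rw [← h4 (i, j), Equiv.symm_symm, finProdFinEquiv_apply_val]
  congr 1
  push_cast
  ring

/-- `S := T(V)` -/
def applyProg : Prog :=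
  matrixProg 6 (var 0 * var 0) (entry 5 (rowOf 11) (colOf 11) *
    load 3 (((rowOf 11 * var 0 + rowOf 12) * var 0 + colOf 11) * var 0 + colOf 12)) (var 10)

/-- `S := T*(U)` -/
def dualProg : Prog :=
  matrixProg 6 (var 0 * var 0) (entry 4 (rowOf 11) (colOf 11) *
    load 3 (((rowOf 12 * var 0 + rowOf 11) * var 0 + colOf 12) * var 0 + colOf 11)) (var 10)

/-- `G := U S - c I` for the matrix `U` in array `u` -/
def residualProg (u : ℕ) : Prog :=
  matrixProg 7 (var 0) (entry u (rowOf 12) (var 11) * entry 6 (var 11) (colOf 12))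
    (var 10 - var 18 * delta (rowOf 12) (colOf 12))

/-- `d := tr G²` -/
def traceProg : Prog :=
  mapProg 19 (const 1) (var 0 * var 0)
    (entry 7 (rowOf 11) (colOf 11) * entry 7 (colOf 11) (rowOf 11)) (var 10)

/-- `H := U - G U / (4 N c) + N I` for the matrix `U` in array `u` -/
def gradProg (u : ℕ) : Prog :=
  matrixProg 8 (var 0) (entry 7 (rowOf 12) (var 11) * entry u (var 11) (colOf 12))
    (entry u (rowOf 12) (colOf 12) + (const 0 - var 10) / (const 4 * var 0 * var 18) +
      var 0 * delta (rowOf 12) (colOf 12))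

/-- `U := H` for the matrix `U` in array `u` -/
def copyProg (u : ℕ) : Prog := matrixProg u (const 0) (const 0) (load 8 (var 12))

/-- A gradient step for the matrix in array `u` if its residual is large, and `q` otherwise. -/
def stepProg (u : ℕ) (q : Prog) : Prog :=
  .seq (residualProg u) (.seq traceProg
    (.ifPos (const 2 * var 0 * var 19 - var 18 * var 18) (.seq (gradProg u) (copyProg u)) q))

/-- One iteration of the descent. -/
def descendProg : Prog :=
  .seq applyProg (stepProg 4 (.seq dualProg (stepProg 5 (.store 20 (const 0) (const 1)))))

/-- The number `b` of bits suffices for the data of the descent. -/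
structure WordBounds (N : ℕ) (ρ : Bipartite N ℤ) (c : ℤ) (b β : ℕ) : Prop where
  size : (N : ℤ) ≤ 2 ^ b
  entry : ∀ p q, |ρ p q| ≤ 2 ^ b
  level : |c| ≤ 2 ^ b
  -- The largest intermediate value is tr(G²): residual entries are at most 2^(6b+1), products at
  -- most 2^(12b+2), and N² ≤ 2^(2b) of them are added.
  word : 14 * b + 3 ≤ β

theorem cost_matrix_le {k N n n' : ℕ} (hn : n ≤ N * N) (hn' : n' ≤ N * N) :
    k * ((n + 1) * (n' + 1)) ≤ k * (N + 1) ^ 4 := by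
  refine Nat.mul_le_mul_left _ ?_
  calc (n + 1) * (n' + 1) ≤ (N + 1) ^ 2 * (N + 1) ^ 2 :=
        Nat.mul_le_mul (by nlinarith) (by nlinarith)
    _ = _ := by ring

section

variable {N : ℕ} {ρ : Bipartite N ℤ} {c : ℤ} {b β : ℕ}

theorem WordBounds.two_pow_lt (h : WordBounds N ρ c b β) {x : ℤ} {j : ℕ} (hx : x ≤ 2 ^ j)
    (hj : j < 14 * b + 3) : x < 2 ^ β :=
  lt_of_le_of_lt hx (pow_lt_pow_right₀ (by norm_num) (by have := h.word; omega))

theorem WordBounds.size_sq (h : WordBounds N ρ c b β) : (N : ℤ) * N ≤ 2 ^ (2 * b) := by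
  calc (N : ℤ) * N ≤ 2 ^ b * 2 ^ b := mul_le_mul h.size h.size (by positivity) (by positivity)
    _ = _ := by rw [← pow_add, two_mul]

theorem abs_mul_le_two_pow {x y : ℤ} {i j k : ℕ} (hx : |x| ≤ 2 ^ i) (hy : |y| ≤ 2 ^ j)
    (h : i + j ≤ k) : |x * y| ≤ 2 ^ k := by
  rw [abs_mul]
  calc |x| * |y| ≤ 2 ^ i * 2 ^ j := mul_le_mul hx hy (abs_nonneg _) (by positivity)
    _ ≤ 2 ^ k := by rw [← pow_add]; exact pow_le_pow_right₀ (by norm_num) h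

theorem abs_sum_le_two_pow {ι : Type} [Fintype ι] {t : ι → ℤ} {i j k : ℕ}
    (hι : (Fintype.card ι : ℤ) ≤ 2 ^ i) (ht : ∀ x, |t x| ≤ 2 ^ j) (h : i + j ≤ k) :
    |∑ x, t x| ≤ 2 ^ k := by
  calc |∑ x, t x| ≤ ∑ x, |t x| := Finset.abs_sum_le_sum_abs _ _
    _ ≤ ∑ _x : ι, 2 ^ j := Finset.sum_le_sum fun x _ => ht x
    _ = (Fintype.card ι : ℤ) * 2 ^ j := by simp
    _ ≤ 2 ^ i * 2 ^ j := mul_le_mul_of_nonneg_right hι (by positivity)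
    _ ≤ 2 ^ k := by rw [← pow_add]; exact pow_le_pow_right₀ (by norm_num) h

/-- The matrix `ρ` is stored in array `3`. -/
def StoresChoi (ρ : Bipartite N ℤ) (m : Memory) : Prop :=
  ∀ p q, m 3 (entryAddress p q) = ρ p q

theorem abs_intApply_le (h : WordBounds N ρ c b β) {V : Matrix (Fin N) (Fin N) ℤ}
    (hV : ∀ i j, |V i j| ≤ 2 ^ b) (i j : Fin N) : |intApply ρ V i j| ≤ 2 ^ (4 * b) := by
  rw [intApply, Matrix.of_apply, ← Fintype.sum_prod_type' fun i' j' => V i' j' * ρ (i', i) (j', j)]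
  refine abs_sum_le_two_pow (i := 2 * b) (j := 2 * b) ?_ (fun x => ?_) (by omega)
  · simpa using h.size_sq
  · exact abs_mul_le_two_pow (hV _ _) (h.entry _ _) (by omega)

theorem abs_intDual_le (h : WordBounds N ρ c b β) {V : Matrix (Fin N) (Fin N) ℤ}
    (hV : ∀ i j, |V i j| ≤ 2 ^ b) (i j : Fin N) : |intDual ρ V i j| ≤ 2 ^ (4 * b) := by
  rw [intDual, Matrix.of_apply, ← Fintype.sum_prod_type' fun i' j' => V i' j' * ρ (i, i') (j, j')]
  refine abs_sum_le_two_pow (i := 2 * b) (j := 2 * b) ?_ (fun x => ?_) (by omega)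
  · simpa using h.size_sq
  · exact abs_mul_le_two_pow (hV _ _) (h.entry _ _) (by omega)

theorem abs_residual_le (h : WordBounds N ρ c b β) {A S : Matrix (Fin N) (Fin N) ℤ}
    (hA : ∀ i j, |A i j| ≤ 2 ^ b) (hS : ∀ i j, |S i j| ≤ 2 ^ (4 * b)) (i j : Fin N) :
    |residual c A S i j| ≤ 2 ^ (6 * b + 1) := by
  have h1 : |(A * S) i j| ≤ 2 ^ (6 * b) := by
    rw [Matrix.mul_apply]
    refine abs_sum_le_two_pow (i := b) (j := 5 * b) ?_ (fun x => ?_) (by omega)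
    · simpa using h.size
    · exact abs_mul_le_two_pow (hA _ _) (hS _ _) (by omega)
  have h2 : |(c • (1 : Matrix (Fin N) (Fin N) ℤ)) i j| ≤ 2 ^ (6 * b) := by
    rw [Matrix.smul_apply, Matrix.one_apply]
    split_ifs
    · rw [smul_eq_mul, mul_one]
      exact h.level.trans (pow_le_pow_right₀ (by norm_num) (by omega))
    · simp
  rw [residual, Matrix.sub_apply, pow_succ]
  refine (abs_sub _ _).trans ?_
  linarith

/-- The inner counter runs over pairs of indices encoded in one number, which `rowOf` and `colOf`
decode. -/
theorem exec_apply : ∃ K, ∀ {N : ℕ} {ρ : Bipartite N ℤ} {c : ℤ} {b β : ℕ},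
    WordBounds N ρ c b β → ∀ {m : Memory} {V : Matrix (Fin N) (Fin N) ℤ},
    Bounded β m → m 0 0 = N → StoresChoi ρ m → Stores 5 V m → (∀ i j, |V i j| ≤ 2 ^ b) →
    ∃ m', Exec β applyProg m m' (K * (N + 1) ^ 4) ∧ Bounded β m' ∧ Agree 6 m m' ∧
      Stores 6 (intApply ρ V) m' := by
  obtain ⟨K, hK⟩ := mapCost_le (var 0 * var 0) (var 0 * var 0) (entry 5 (rowOf 11) (colOf 11) *
    load 3 (((rowOf 11 * var 0 + rowOf 12) * var 0 + colOf 11) * var 0 + colOf 12)) (var 10)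
  refine ⟨K, fun {N ρ c b β} h {m V} hm hN hρ hs hV => ?_⟩
  have hN2 := h.two_pow_lt h.size_sq (by omega)
  obtain ⟨m', h1, h2⟩ := exec_matrix (N := N) (β := β) (dst := 6) (by norm_num) (by norm_num)
    (by norm_num) (by norm_num) finProdFinEquiv (nk := var 0 * var 0)
    (e := entry 5 (rowOf 11) (colOf 11) *
      load 3 (((rowOf 11 * var 0 + rowOf 12) * var 0 + colOf 11) * var 0 + colOf 12)) (f := var 10)
    (fun a b x => V x.1 x.2 * ρ (x.1, a) (x.2, b)) (intApply ρ V) (2 ^ (2 * b)) hm hN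
    (fun m' h' => by rw [eval_mul, eval_var, h']; push_cast; rfl)
    (fun i j x m' h0 ha hr hc hk => by
      have hr' := eval_rowOf h0 hk
      have hc' := eval_colOf h0 hk
      rw [eval_mul, Stores.eval_entry (hs.congr (ha 5 (by norm_num) (by norm_num) (by norm_num)
        (by norm_num))) h0 hr' hc', eval_load, ha 3 (by norm_num) (by norm_num) (by norm_num)
        (by norm_num), ← hρ]
      simp only [eval_add, eval_mul, eval_var, hr, hc, hr', hc', h0]
      rfl)
    (fun i j m' h0 ha _ hr hc hx => by
      rw [eval_var, hx, intApply, Matrix.of_apply, Fintype.sum_prod_type])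
    hN2 (by exact_mod_cast hN2)
    (fun i j x => abs_mul_le_two_pow (hV _ _) (h.entry _ _) (by omega))
    (by
      refine h.two_pow_lt (j := 4 * b) ?_ (by omega)
      calc _ ≤ (2 : ℤ) ^ (2 * b) * 2 ^ (2 * b) :=
            mul_le_mul_of_nonneg_right (by exact_mod_cast h.size_sq) (by positivity)
        _ = _ := by rw [← pow_add]; congr 1; omega)
    (fun i j => h.two_pow_lt (abs_intApply_le h hV i j) (by omega))
  exact ⟨m', h1.mono ((hK _ _).trans (cost_matrix_le le_rfl le_rfl)), h2⟩

theorem exec_dual : ∃ K, ∀ {N : ℕ} {ρ : Bipartite N ℤ} {c : ℤ} {b β : ℕ},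
    WordBounds N ρ c b β → ∀ {m : Memory} {U : Matrix (Fin N) (Fin N) ℤ},
    Bounded β m → m 0 0 = N → StoresChoi ρ m → Stores 4 U m → (∀ i j, |U i j| ≤ 2 ^ b) →
    ∃ m', Exec β dualProg m m' (K * (N + 1) ^ 4) ∧ Bounded β m' ∧ Agree 6 m m' ∧
      Stores 6 (intDual ρ U) m' := by
  obtain ⟨K, hK⟩ := mapCost_le (var 0 * var 0) (var 0 * var 0) (entry 4 (rowOf 11) (colOf 11) *
    load 3 (((rowOf 12 * var 0 + rowOf 11) * var 0 + colOf 12) * var 0 + colOf 11)) (var 10)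
  refine ⟨K, fun {N ρ c b β} h {m U} hm hN hρ hs hV => ?_⟩
  have hN2 := h.two_pow_lt h.size_sq (by omega)
  obtain ⟨m', h1, h2⟩ := exec_matrix (N := N) (β := β) (dst := 6) (by norm_num) (by norm_num)
    (by norm_num) (by norm_num) finProdFinEquiv (nk := var 0 * var 0)
    (e := entry 4 (rowOf 11) (colOf 11) *
      load 3 (((rowOf 12 * var 0 + rowOf 11) * var 0 + colOf 12) * var 0 + colOf 11)) (f := var 10)
    (fun i j x => U x.1 x.2 * ρ (i, x.1) (j, x.2)) (intDual ρ U) (2 ^ (2 * b)) hm hN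
    (fun m' h' => by rw [eval_mul, eval_var, h']; push_cast; rfl)
    (fun i j x m' h0 ha hr hc hk => by
      have hr' := eval_rowOf h0 hk
      have hc' := eval_colOf h0 hk
      rw [eval_mul, Stores.eval_entry (hs.congr (ha 4 (by norm_num) (by norm_num) (by norm_num)
        (by norm_num))) h0 hr' hc', eval_load, ha 3 (by norm_num) (by norm_num) (by norm_num)
        (by norm_num), ← hρ]
      simp only [eval_add, eval_mul, eval_var, hr, hc, hr', hc', h0]
      rfl)
    (fun i j m' h0 ha _ hr hc hx => by
      rw [eval_var, hx, intDual, Matrix.of_apply, Fintype.sum_prod_type])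
    hN2 (by exact_mod_cast hN2)
    (fun i j x => abs_mul_le_two_pow (hV _ _) (h.entry _ _) (by omega))
    (by
      refine h.two_pow_lt (j := 4 * b) ?_ (by omega)
      calc _ ≤ (2 : ℤ) ^ (2 * b) * 2 ^ (2 * b) :=
            mul_le_mul_of_nonneg_right (by exact_mod_cast h.size_sq) (by positivity)
        _ = _ := by rw [← pow_add]; congr 1; omega)
    (fun i j => h.two_pow_lt (abs_intDual_le h hV i j) (by omega))
  exact ⟨m', h1.mono ((hK _ _).trans (cost_matrix_le le_rfl le_rfl)), h2⟩

end

end OperatorScaling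

/-! ### Programs for the residual, the gradient step and one iteration of the descent. -/

namespace OperatorScaling

open OperatorScaling.Expr

theorem exec_residual (u : ℕ) (hu : u = 4 ∨ u = 5) :
    ∃ K, ∀ {N : ℕ} {ρ : Bipartite N ℤ} {c : ℤ} {b β : ℕ},
    WordBounds N ρ c b β → ∀ {m : Memory} {A S : Matrix (Fin N) (Fin N) ℤ},
    Bounded β m → m 0 0 = N → m 18 0 = c → Stores u A m → Stores 6 S m →
    (∀ i j, |A i j| ≤ 2 ^ b) → (∀ i j, |S i j| ≤ 2 ^ (4 * b)) →
    ∃ m', Exec β (residualProg u) m m' (K * (N + 1) ^ 4) ∧ Bounded β m' ∧ Agree 7 m m' ∧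
      Stores 7 (residual c A S) m' := by
  obtain ⟨K, hK⟩ := mapCost_le (var 0 * var 0) (var 0)
    (entry u (rowOf 12) (var 11) * entry 6 (var 11) (colOf 12))
    (var 10 - var 18 * delta (rowOf 12) (colOf 12))
  refine ⟨K, fun {N ρ c b β} h {m A S} hm hN hc hs hS hA hSb => ?_⟩
  have hN2 := h.two_pow_lt h.size_sq (by omega)
  obtain ⟨m', h1, h2⟩ := exec_matrix (N := N) (β := β) (dst := 7) (by norm_num) (by norm_num)
    (by norm_num) (by norm_num) (Equiv.refl (Fin N)) (nk := var 0)
    (e := entry u (rowOf 12) (var 11) * entry 6 (var 11) (colOf 12))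
    (f := var 10 - var 18 * delta (rowOf 12) (colOf 12))
    (fun i j x => A i x * S x j) (residual c A S) (2 ^ (5 * b)) hm hN
    (fun m' h' => h')
    (fun i j x m' h0 ha hr hc hk => by
      replace hk : (var 11).eval m' = (x : ℕ) := hk
      rw [eval_mul, Stores.eval_entry (hs.congr (ha u (by omega) (by omega) (by omega) (by omega)))
        h0 hr hk, Stores.eval_entry (hS.congr (ha 6 (by norm_num) (by norm_num) (by norm_num)
        (by norm_num))) h0 hk hc])
    (fun i j m' h0 ha _ hr hc' hx => by
      rw [eval_sub, eval_mul, eval_delta, eval_var, eval_var, hx, hr, hc',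
        ha 18 (by norm_num) (by norm_num) (by norm_num) (by norm_num), hc, residual,
        Matrix.sub_apply, Matrix.mul_apply, Matrix.smul_apply, Matrix.one_apply, smul_eq_mul]
      simp only [Nat.cast_inj, Fin.val_inj])
    hN2 (h.two_pow_lt h.size (by omega))
    (fun i j x => abs_mul_le_two_pow (hA _ _) (hSb _ _) (by omega))
    (by
      refine h.two_pow_lt (j := 6 * b) ?_ (by omega)
      calc _ ≤ (2 : ℤ) ^ b * 2 ^ (5 * b) :=
            mul_le_mul_of_nonneg_right h.size (by positivity)
        _ = _ := by rw [← pow_add]; congr 1; omega)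
    (fun i j => h.two_pow_lt (abs_residual_le h hA hSb i j) (by omega))
  exact ⟨m', h1.mono ((hK _ _).trans (cost_matrix_le le_rfl (Nat.le_mul_self N))), h2⟩

theorem exec_trace : ∃ K, ∀ {N : ℕ} {ρ : Bipartite N ℤ} {c : ℤ} {b β : ℕ},
    WordBounds N ρ c b β → 1 ≤ N → ∀ {m : Memory} {G : Matrix (Fin N) (Fin N) ℤ},
    Bounded β m → m 0 0 = N → Stores 7 G m → (∀ i j, |G i j| ≤ 2 ^ (6 * b + 1)) →
    ∃ m', Exec β traceProg m m' (K * (N + 1) ^ 4) ∧ Bounded β m' ∧ Agree 19 m m' ∧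
      m' 19 0 = (G * G).trace := by
  obtain ⟨K, hK⟩ := mapCost_le (const 1) (var 0 * var 0)
    (entry 7 (rowOf 11) (colOf 11) * entry 7 (colOf 11) (rowOf 11)) (var 10)
  refine ⟨K, fun {N ρ c b β} h hN1 {m G} hm hN hs hG => ?_⟩
  have hN2 := h.two_pow_lt h.size_sq (by omega)
  have hN' : ∀ m' : Memory, Agree 19 m m' → m' 0 0 = N := fun m' h => by
    rw [h 0 (by norm_num) (by norm_num) (by norm_num) (by norm_num), hN]
  have htr : (G * G).trace = ∑ x : Fin N × Fin N, G x.1 x.2 * G x.2 x.1 := by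
    simp only [Matrix.trace, Matrix.diag_apply, Matrix.mul_apply, Fintype.sum_prod_type]
  have hterm : ∀ x : Fin N × Fin N, |G x.1 x.2 * G x.2 x.1| ≤ 2 ^ (12 * b + 2) := fun x =>
    abs_mul_le_two_pow (hG _ _) (hG _ _) (by omega)
  obtain ⟨m', h1, h2, h3, h4⟩ := exec_map (β := β) (dst := 19) (by norm_num) (by norm_num)
    (by norm_num) (Equiv.refl (Fin 1)) finProdFinEquiv.symm (nz := const 1) (nk := var 0 * var 0)
    (e := entry 7 (rowOf 11) (colOf 11) * entry 7 (colOf 11) (rowOf 11)) (f := var 10)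
    (t := fun _ x => G x.1 x.2 * G x.2 x.1) (h := fun _ => (G * G).trace) (B := 2 ^ (12 * b + 2)) hm
    (fun m' _ => rfl) (fun m' h => by rw [eval_mul, eval_var, hN' m' h]; push_cast; rfl)
    (fun _ x m' ha _ hk => by
      have h0 := hN' m' ha
      have hs' := hs.congr (ha 7 (by norm_num) (by norm_num) (by norm_num) (by norm_num))
      rw [Equiv.symm_symm] at hk
      have hr := eval_rowOf h0 hk
      have hc := eval_colOf h0 hk
      rw [eval_mul, hs'.eval_entry h0 hr hc, hs'.eval_entry h0 hc hr])
    (fun _ m' ha _ hx => by rw [eval_var, hx, htr])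
    (h.two_pow_lt (j := 0) (by norm_num) (by omega)) (by exact_mod_cast hN2)
    (fun _ x => hterm x)
    (by
      refine h.two_pow_lt (j := 14 * b + 2) ?_ (by omega)
      calc _ ≤ (2 : ℤ) ^ (2 * b) * 2 ^ (12 * b + 2) :=
            mul_le_mul_of_nonneg_right (by exact_mod_cast h.size_sq) (by positivity)
        _ = _ := by rw [← pow_add]; congr 1; omega)
    (fun _ => by
      rw [htr]
      refine h.two_pow_lt (j := 14 * b + 2) ?_ (by omega)
      exact abs_sum_le_two_pow (i := 2 * b) (by simpa using h.size_sq) hterm (by omega))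
  refine ⟨m', h1.mono ((hK _ _).trans (cost_matrix_le ?_ le_rfl)), h2, h3, h4 0⟩
  exact hN1.trans (Nat.le_mul_self N)

theorem exec_grad (u : ℕ) (hu : u = 4 ∨ u = 5) :
    ∃ K, ∀ {N : ℕ} {ρ : Bipartite N ℤ} {c : ℤ} {b β : ℕ},
    WordBounds N ρ c b β → ∀ {m : Memory} {A S : Matrix (Fin N) (Fin N) ℤ},
    Bounded β m → m 0 0 = N → m 18 0 = c → Stores u A m → Stores 7 (residual c A S) m →
    (∀ i j, |A i j| ≤ 2 ^ b) → (∀ i j, |residual c A S i j| ≤ 2 ^ (6 * b + 1)) →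
    (∀ i j, |gradStep c A S i j| ≤ 2 ^ b) →
    ∃ m', Exec β (gradProg u) m m' (K * (N + 1) ^ 4) ∧ Bounded β m' ∧ Agree 8 m m' ∧
      Stores 8 (gradStep c A S) m' := by
  obtain ⟨K, hK⟩ := mapCost_le (var 0 * var 0) (var 0)
    (entry 7 (rowOf 12) (var 11) * entry u (var 11) (colOf 12))
    (entry u (rowOf 12) (colOf 12) + (const 0 - var 10) / (const 4 * var 0 * var 18) +
      var 0 * delta (rowOf 12) (colOf 12))
  refine ⟨K, fun {N ρ c b β} h {m A S} hm hN hc hs hS hA hGb hH => ?_⟩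
  have hN2 := h.two_pow_lt h.size_sq (by omega)
  obtain ⟨m', h1, h2⟩ := exec_matrix (N := N) (β := β) (dst := 8) (by norm_num) (by norm_num)
    (by norm_num) (by norm_num) (Equiv.refl (Fin N)) (nk := var 0)
    (e := entry 7 (rowOf 12) (var 11) * entry u (var 11) (colOf 12))
    (f := entry u (rowOf 12) (colOf 12) + (const 0 - var 10) / (const 4 * var 0 * var 18) +
      var 0 * delta (rowOf 12) (colOf 12))
    (fun i j x => residual c A S i x * A x j) (gradStep c A S) (2 ^ (7 * b + 1)) hm hN
    (fun m' h' => h')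
    (fun i j x m' h0 ha hr hc hk => by
      replace hk : (var 11).eval m' = (x : ℕ) := hk
      rw [eval_mul, Stores.eval_entry (hs.congr (ha u (by omega) (by omega) (by omega) (by omega)))
        h0 hk hc, Stores.eval_entry (hS.congr (ha 7 (by norm_num) (by norm_num) (by norm_num)
        (by norm_num))) h0 hr hk])
    (fun i j m' h0 ha _ hr hc' hx => by
      simp only [eval_add, eval_sub, eval_mul, eval_div, eval_delta, eval_var, eval_const,
        Stores.eval_entry (hs.congr (ha u (by omega) (by omega) (by omega) (by omega))) h0 hr hc',
        hx, hr, hc', h0, ha 18 (by norm_num) (by norm_num) (by norm_num) (by norm_num), hc,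
        gradStep, Matrix.of_apply, Matrix.mul_apply, Nat.cast_inj, Fin.val_inj,
        zero_sub, mul_ite, mul_one, mul_zero])
    hN2 (h.two_pow_lt h.size (by omega))
    (fun i j x => abs_mul_le_two_pow (hGb _ _) (hA _ _) (by omega))
    (by
      refine h.two_pow_lt (j := 8 * b + 1) ?_ (by omega)
      calc _ ≤ (2 : ℤ) ^ b * 2 ^ (7 * b + 1) :=
            mul_le_mul_of_nonneg_right h.size (by positivity)
        _ = _ := by rw [← pow_add]; congr 1; omega)
    (fun i j => h.two_pow_lt (hH i j) (by omega))
  exact ⟨m', h1.mono ((hK _ _).trans (cost_matrix_le le_rfl (Nat.le_mul_self N))), h2⟩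

/-- Every entry of G U reads old entries of U, so the new matrix is built in array 8 and copied
afterwards. -/
theorem exec_copy (u : ℕ) (hu : u = 4 ∨ u = 5) :
    ∃ K, ∀ {N : ℕ} {ρ : Bipartite N ℤ} {c : ℤ} {b β : ℕ},
    WordBounds N ρ c b β → ∀ {m : Memory} {H : Matrix (Fin N) (Fin N) ℤ},
    Bounded β m → m 0 0 = N → Stores 8 H m → (∀ i j, |H i j| ≤ 2 ^ b) →
    ∃ m', Exec β (copyProg u) m m' (K * (N + 1) ^ 4) ∧ Bounded β m' ∧ Agree u m m' ∧
      Stores u H m' := by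
  obtain ⟨K, hK⟩ := mapCost_le (var 0 * var 0) (const 0) (const 0) (load 8 (var 12))
  refine ⟨K, fun {N ρ c b β} h {m H} hm hN hs hH => ?_⟩
  have hN2 := h.two_pow_lt h.size_sq (by omega)
  obtain ⟨m', h1, h2⟩ := exec_matrix (N := N) (β := β) (dst := u) (by omega) (by omega)
    (by omega) (by omega) (Equiv.refl (Fin 0)) (nk := const 0) (e := const 0)
    (f := load 8 (var 12)) (fun i j x => 0) H 0 hm hN (fun m' _ => rfl)
    (fun i j x => x.elim0)
    (fun i j m' h0 ha hz _ _ _ => by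
      rw [eval_load, eval_var, hz, ha 8 (by norm_num) (by norm_num) (by norm_num) (by omega)]
      exact hs i j)
    hN2 (by simp) (fun i j x => x.elim0) (by simp)
    (fun i j => h.two_pow_lt (hH i j) (by omega))
  exact ⟨m', h1.mono ((hK _ _).trans (cost_matrix_le le_rfl (Nat.zero_le _))), h2⟩

/-- The arrays with index at least `13` except for `19` and `20`, and those with index at most
`3`, are unchanged. -/
def AgreeOuter (m m' : Memory) : Prop :=
  ∀ a, (a < 4 ∨ 12 < a) → a ≠ 19 → a ≠ 20 → m' a = m a

/-- The second alternative takes the execution of q as an argument, because q itself contains the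
step for the other matrix. -/
theorem exec_step (u : ℕ) (hu : u = 4 ∨ u = 5) :
    ∃ K, ∀ {N : ℕ} {ρ : Bipartite N ℤ} {c : ℤ} {b β : ℕ},
    WordBounds N ρ c b β → 1 ≤ N → ∀ (q : Prog) {m : Memory} {A S : Matrix (Fin N) (Fin N) ℤ},
    Bounded β m → m 0 0 = N → m 18 0 = c → Stores u A m → Stores 6 S m →
    (∀ i j, |A i j| ≤ 2 ^ b) → (∀ i j, |S i j| ≤ 2 ^ (4 * b)) →
    (IsLarge c A S → (∀ i j, |gradStep c A S i j| ≤ 2 ^ b) →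
      ∃ m', Exec β (stepProg u q) m m' (K * (N + 1) ^ 4) ∧ Bounded β m' ∧
        (∀ a, a ≠ u → (a < 6 ∨ 12 < a) → a ≠ 19 → m' a = m a) ∧
        Stores u (gradStep c A S) m') ∧
    (¬ IsLarge c A S → ∃ m₁, Bounded β m₁ ∧ (∀ a, (a < 6 ∨ 12 < a) → a ≠ 19 → m₁ a = m a) ∧
      ∀ m' k, Exec β q m₁ m' k → Exec β (stepProg u q) m m' (K * (N + 1) ^ 4 + k)) := by
  obtain ⟨K1, h1⟩ := exec_residual u hu
  obtain ⟨K2, h2⟩ := exec_trace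
  obtain ⟨K3, h3⟩ := exec_grad u hu
  obtain ⟨K4, h4⟩ := exec_copy u hu
  set e : Expr := const 2 * var 0 * var 19 - var 18 * var 18 with he
  refine ⟨K1 + K2 + K3 + K4 + e.costWeight + 4,
    fun {N ρ c b β} h hN1 q {m A S} hm hN hc hs hS hA hSb => ?_⟩
  have hP : 1 ≤ (N + 1) ^ 4 := Nat.one_le_pow _ _ (by omega)
  have hw : e.costWeight + 4 ≤ (e.costWeight + 4) * (N + 1) ^ 4 := Nat.le_mul_of_pos_right _ hP
  obtain ⟨m1, e1, b1, a1, s1⟩ := h1 h hm hN hc hs hS hA hSb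
  have hN1' : m1 0 0 = N := by
    rw [a1 0 (by norm_num) (by norm_num) (by norm_num) (by norm_num), hN]
  have hG := abs_residual_le h hA hSb
  obtain ⟨m2, e2, b2, a2, s2⟩ := h2 h hN1 b1 hN1' s1 hG
  have hN2' : m2 0 0 = N := by
    rw [a2 0 (by norm_num) (by norm_num) (by norm_num) (by norm_num), hN1']
  have hc2 : m2 18 0 = c := by
    rw [a2 18 (by norm_num) (by norm_num) (by norm_num) (by norm_num),
      a1 18 (by norm_num) (by norm_num) (by norm_num) (by norm_num), hc]
  have ha2 : ∀ a, (a < 6 ∨ 12 < a) → a ≠ 19 → m2 a = m a := fun a h1 h2 => by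
    rw [a2 a (by omega) (by omega) (by omega) h2, a1 a (by omega) (by omega) (by omega) (by omega)]
  have hev : e.eval m2 = 2 * N * (residual c A S * residual c A S).trace - c * c := by
    rw [he, eval_sub, eval_mul, eval_mul, eval_mul, eval_const, eval_var, eval_var, eval_var, hN2',
      hc2, s2]
  constructor
  · intro hL hH
    have s2' : Stores u A m2 := hs.congr (ha2 u (by omega) (by omega))
    obtain ⟨m3, e3, b3, a3, s3⟩ := h3 h b2 hN2' hc2 s2'
      (s1.congr (a2 7 (by norm_num) (by norm_num) (by norm_num) (by norm_num))) hA hG hH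
    have hN3' : m3 0 0 = N := by
      rw [a3 0 (by norm_num) (by norm_num) (by norm_num) (by norm_num), hN2']
    obtain ⟨m4, e4, b4, a4, s4⟩ := h4 h b3 hN3' s3 hH
    refine ⟨m4, (e1.seq (e2.seq (exec_ifPos_true b2 (by rw [← he, hev]; exact hL)
      (e3.seq e4)))).mono ?_, b4, fun a h1 h2 h3 => ?_, s4⟩
    · rw [← he]
      simp only [add_mul] at hw ⊢
      omega
    · rw [a4 a (by omega) (by omega) (by omega) h1, a3 a (by omega) (by omega) (by omega)
        (by omega),
        ha2 a h2 h3]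
  · intro hL
    refine ⟨m2, b2, ha2, fun m' k hq => (e1.seq (e2.seq (exec_ifPos_false b2
      (by rw [← he, hev]; exact not_lt.mp hL) hq))).mono ?_⟩
    rw [← he]
    simp only [add_mul] at hw ⊢
    omega

/-- The state of the descent is stored in the arrays `4`, `5` and `20`. -/
structure StoresState {N : ℕ} (x : DescentState N) (m : Memory) : Prop where
  left : Stores 4 x.U m
  right : Stores 5 x.V m
  flag : m 20 0 = x.flag

theorem exec_descend :
    ∃ K, ∀ {N : ℕ} {ρ : Bipartite N ℤ} {c : ℤ} {b β : ℕ},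
    WordBounds N ρ c b β → 1 ≤ N → ∀ {m : Memory} {x : DescentState N},
    Bounded β m → m 0 0 = N → m 18 0 = c → StoresChoi ρ m → StoresState x m →
    (∀ i j, |x.U i j| ≤ 2 ^ b ∧ |x.V i j| ≤ 2 ^ b) →
    (∀ i j, |(descend ρ c x).U i j| ≤ 2 ^ b ∧ |(descend ρ c x).V i j| ≤ 2 ^ b) →
    ∃ m', Exec β descendProg m m' (K * (N + 1) ^ 4) ∧ Bounded β m' ∧ AgreeOuter m m' ∧
      StoresState (descend ρ c x) m' := by
  obtain ⟨K1, h1⟩ := exec_apply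
  obtain ⟨K2, h2⟩ := exec_step 4 (.inl rfl)
  obtain ⟨K3, h3⟩ := exec_dual
  obtain ⟨K4, h4⟩ := exec_step 5 (.inr rfl)
  set w := (const 0).costWeight + (const 1).costWeight + 1 with hw
  refine ⟨K1 + K2 + K3 + K4 + w + 3,
    fun {N ρ c b β} h hN1 {m x} hm hN hc hρ hx hb hb' => ?_⟩
  have hP : 1 ≤ (N + 1) ^ 4 := Nat.one_le_pow _ _ (by omega)
  have hwP : w + 3 ≤ (w + 3) * (N + 1) ^ 4 := Nat.le_mul_of_pos_right _ hP
  obtain ⟨m1, e1, b1, a1, s1⟩ := h1 h hm hN hρ hx.right fun i j => (hb i j).2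
  have a1' : ∀ a, (a < 6 ∨ 12 < a) → m1 a = m a := fun a ha =>
    a1 a (by omega) (by omega) (by omega) (by omega)
  obtain ⟨t2, f2⟩ := h2 h hN1 (.seq dualProg (stepProg 5 (.store 20 (const 0) (const 1)))) b1
    (by rw [a1' 0 (by omega), hN]) (by rw [a1' 18 (by omega), hc])
    (hx.left.congr (a1' 4 (by omega))) s1 (fun i j => (hb i j).1)
    (abs_intApply_le h fun i j => (hb i j).2)
  rw [descend] at hb' ⊢
  split_ifs at hb' ⊢ with hL hL'
  · obtain ⟨m2, e2, b2, a2, s2⟩ := t2 hL fun i j => (hb' i j).1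
    refine ⟨m2, (e1.seq e2).mono ?_, b2, fun a h1 h2 h3 => ?_, s2, ?_, ?_⟩
    · simp only [add_mul] at hwP ⊢
      omega
    · rw [a2 a (by omega) (by omega) h2, a1' a (by omega)]
    · exact hx.right.congr (by rw [a2 5 (by omega) (by omega) (by omega), a1' 5 (by omega)])
    · rw [a2 20 (by omega) (by omega) (by omega), a1' 20 (by omega)]
      exact hx.flag
  -- Both remaining branches evaluate the dual operator before testing the second residual.
  all_goals
    obtain ⟨m2, b2, a2, c2⟩ := f2 hL
    have a2' : ∀ a, (a < 6 ∨ 12 < a) → a ≠ 19 → m2 a = m a := fun a h1 h2 => by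
      rw [a2 a h1 h2, a1' a h1]
    obtain ⟨m3, e3, b3, a3, s3⟩ := h3 h b2 (by rw [a2' 0 (by omega) (by omega), hN])
      (fun p q => by rw [a2' 3 (by omega) (by omega)]; exact hρ p q)
      (hx.left.congr (a2' 4 (by omega) (by omega))) fun i j => (hb i j).1
    have a3' : ∀ a, (a < 6 ∨ 12 < a) → a ≠ 19 → m3 a = m a := fun a h1 h2 => by
      rw [a3 a (by omega) (by omega) (by omega) (by omega), a2' a h1 h2]
    obtain ⟨t4, f4⟩ := h4 h hN1 (.store 20 (const 0) (const 1)) b3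
      (by rw [a3' 0 (by omega) (by omega), hN]) (by rw [a3' 18 (by omega) (by omega), hc])
      (hx.right.congr (a3' 5 (by omega) (by omega))) s3 (fun i j => (hb i j).2)
      (abs_intDual_le h fun i j => (hb i j).1)
  · obtain ⟨m4, e4, b4, a4, s4⟩ := t4 hL' fun i j => (hb' i j).2
    refine ⟨m4, (e1.seq (c2 _ _ (e3.seq e4))).mono ?_, b4, fun a h1 h2 h3 => ?_, ?_, s4, ?_⟩
    · simp only [add_mul] at hwP ⊢
      omega
    · rw [a4 a (by omega) (by omega) h2, a3' a (by omega) h2]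
    · exact hx.left.congr (by rw [a4 4 (by omega) (by omega) (by omega), a3' 4 (by omega)
        (by omega)])
    · rw [a4 20 (by omega) (by omega) (by omega), a3' 20 (by omega) (by omega)]
      exact hx.flag
  · obtain ⟨m4, b4, a4, c4⟩ := f4 hL'
    have hst := exec_store b4 20 (const 0) (const 1)
    rw [eval_const, eval_const] at hst
    refine ⟨_, (e1.seq (c2 _ _ (e3.seq (c4 _ _ hst)))).mono ?_,
      b4.setCell (h.two_pow_lt (j := 0) (by norm_num) (by omega)),
      fun a h1 h2 h3 => ?_, ?_, ?_, ?_⟩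
    · simp only [add_mul] at hwP ⊢
      omega
    · rw [setCell_of_ne _ h3, a4 a (by omega) h2, a3' a (by omega) h2]
    · exact hx.left.congr (by rw [setCell_of_ne _ (by norm_num), a4 4 (by omega) (by omega),
        a3' 4 (by omega) (by omega)])
    · exact hx.right.congr (by rw [setCell_of_ne _ (by norm_num), a4 5 (by omega) (by omega),
        a3' 5 (by omega) (by omega)])
    · rw [setCell_self]

end OperatorScaling

namespace OperatorScaling

open OperatorScaling.Expr

/-! ### Clearing denominators -/

/-- The enumeration of the entries of a bipartite matrix. -/
def entryEquiv (N : ℕ) : (Fin N × Fin N) × (Fin N × Fin N) ≃ Fin (N * N * (N * N)) :=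
  (finProdFinEquiv.prodCongr finProdFinEquiv).trans finProdFinEquiv

/-- The row by row address is the iterated pairing of indices, so a single loop visits all entries.
-/
theorem val_entryEquiv {N : ℕ} (x : (Fin N × Fin N) × (Fin N × Fin N)) :
    ((entryEquiv N x : ℕ) : ℤ) = entryAddress x.1 x.2 := by
  rw [entryEquiv, Equiv.trans_apply, finProdFinEquiv_apply_val, Equiv.prodCongr_apply, Prod.map,
    finProdFinEquiv_apply_val, finProdFinEquiv_apply_val, entryAddress]
  push_cast
  ring

theorem sum_ite_entryAddress {N : ℕ} (f : Fin N × Fin N → Fin N × Fin N → ℤ)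
    (p q : Fin N × Fin N) :
    (∑ p', ∑ q', if entryAddress p q = entryAddress p' q' then f p' q' else 0) = f p q := by
  have key : ∀ p' q', entryAddress p q = entryAddress p' q' ↔ (p, q) = (p', q') := fun p' q' => by
    rw [← val_entryEquiv (p, q), ← val_entryEquiv (p', q'), Nat.cast_inj, Fin.val_inj,
      (entryEquiv N).apply_eq_iff_eq]
  simp only [key]
  rw [← Fintype.sum_prod_type' fun p' q' => if (p, q) = (p', q') then f p' q' else 0]
  simp

/-- The product of all denominators. -/
def commonDen {N : ℕ} (ρ : Bipartite N ℚ) : ℤ :=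
  ∏ x : (Fin N × Fin N) × (Fin N × Fin N), ((ρ x.1 x.2).den : ℤ)

/-- The integral multiple of `ρ` by the product of all denominators. -/
def clearDen {N : ℕ} (ρ : Bipartite N ℚ) : Bipartite N ℤ :=
  Matrix.of fun p q => (ρ p q).num * (commonDen ρ / (ρ p q).den)

section

variable {N : ℕ} (ρ : Bipartite N ℚ)

theorem commonDen_pos : 0 < commonDen ρ :=
  Finset.prod_pos fun x _ => by exact_mod_cast (ρ x.1 x.2).den_pos

theorem cast_clearDen (p q : Fin N × Fin N) : (clearDen ρ p q : ℚ) = commonDen ρ * ρ p q := by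
  have hd : ((ρ p q).den : ℤ) ∣ commonDen ρ :=
    Finset.dvd_prod_of_mem (fun x : (Fin N × Fin N) × (Fin N × Fin N) => ((ρ x.1 x.2).den : ℤ))
      (Finset.mem_univ (p, q))
  have h0 : ((ρ p q).den : ℚ) ≠ 0 := by exact_mod_cast (ρ p q).den_nz
  rw [clearDen, Matrix.of_apply, Int.cast_mul, Int.cast_div hd (by exact_mod_cast h0),
    Int.cast_natCast]
  conv_rhs => rw [← Rat.num_div_den (ρ p q)]
  field_simp

theorem map_clearDen : (clearDen ρ).map (Int.cast : ℤ → ℂ) =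
    ((commonDen ρ : ℤ) : ℂ) • ρ.map (Rat.cast : ℚ → ℂ) := by
  ext p q
  have h := congrArg (Rat.cast : ℚ → ℂ) (cast_clearDen ρ p q)
  simpa using h

theorem posSemidef_clearDen (h : (ρ.map (Rat.cast : ℚ → ℂ)).PosSemidef) :
    ((clearDen ρ).map (Int.cast : ℤ → ℂ)).PosSemidef := by
  rw [map_clearDen]
  exact h.smul (by exact_mod_cast (commonDen_pos ρ).le)

theorem imageSpace_smul {σ : Bipartite N ℂ} {d : ℂ} (hd : d ≠ 0) :
    imageSpace (d • σ) = imageSpace σ := by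
  ext A
  constructor
  · rintro ⟨x, hx⟩
    refine ⟨d • x, ?_⟩
    rw [← hx, Matrix.mulVecLin_apply, Matrix.mulVecLin_apply, Matrix.mulVec_smul,
        Matrix.smul_mulVec]
  · rintro ⟨x, hx⟩
    refine ⟨d⁻¹ • x, ?_⟩
    rw [← hx, Matrix.mulVecLin_apply, Matrix.mulVecLin_apply, Matrix.mulVec_smul,
      Matrix.smul_mulVec, smul_smul, inv_mul_cancel₀ hd, one_smul]

theorem rankNonDecreasing_of_smul {σ : Bipartite N ℂ} {d : ℂ}
    (h : RankNonDecreasing (opOfChoi (d • σ))) : RankNonDecreasing (opOfChoi σ) := by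
  intro X hX
  have e : opOfChoi (d • σ) X = d • (1 : Mat N) * opOfChoi σ X := by
    rw [opOfChoi_smul, Matrix.smul_mul, one_mul]
  exact (h X hX).trans (e ▸ Matrix.rank_mul_le_right _ _)

theorem one_le_den (p q : Fin N × Fin N) : (1 : ℤ) ≤ (ρ p q).den := by
  exact_mod_cast (ρ p q).den_pos

theorem bitLength_add_le_inputSize (p q : Fin N × Fin N) :
    bitLength (ρ p q).num + bitLength (ρ p q).den ≤ inputSize ρ := by
  refine le_trans ?_ (Nat.le_add_left _ _)
  refine le_trans ?_ (Finset.single_le_sum (f := fun p => ∑ q, (bitLength (ρ p q).num +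
    bitLength (ρ p q).den)) (fun _ _ => Nat.zero_le _) (Finset.mem_univ p))
  exact Finset.single_le_sum (f := fun q => bitLength (ρ p q).num + bitLength (ρ p q).den)
    (fun _ _ => Nat.zero_le _) (Finset.mem_univ q)

theorem abs_num_le (p q : Fin N × Fin N) : |(ρ p q).num| ≤ 2 ^ inputSize ρ := by
  refine (abs_lt_two_pow_bitLength _).le.trans (pow_le_pow_right₀ (by norm_num) ?_)
  have := bitLength_add_le_inputSize ρ p q
  omega

theorem den_le (p q : Fin N × Fin N) : ((ρ p q).den : ℤ) ≤ 2 ^ inputSize ρ := by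
  refine (le_abs_self _).trans ((abs_lt_two_pow_bitLength _).le.trans
    (pow_le_pow_right₀ (by norm_num) ?_))
  have := bitLength_add_le_inputSize ρ p q
  omega

/-- A product is at most 2 to the sum of the bit lengths, and that sum is part of the input size; no
least common multiple is needed. -/
theorem commonDen_le : commonDen ρ ≤ 2 ^ inputSize ρ := by
  calc commonDen ρ ≤ ∏ x : (Fin N × Fin N) × (Fin N × Fin N), 2 ^ bitLength (ρ x.1 x.2).den :=
        Finset.prod_le_prod (fun x _ => by positivity) fun x _ =>
          (le_abs_self _).trans (abs_lt_two_pow_bitLength _).le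
    _ = 2 ^ ∑ x : (Fin N × Fin N) × (Fin N × Fin N), bitLength (ρ x.1 x.2).den := by
        rw [Finset.prod_pow_eq_pow_sum]
    _ ≤ 2 ^ inputSize ρ := by
        refine pow_le_pow_right₀ (by norm_num) ?_
        rw [inputSize, ← Fintype.sum_prod_type' fun p q => bitLength (ρ p q).num +
          bitLength (ρ p q).den]
        exact (Finset.sum_le_sum fun x _ => Nat.le_add_left _ _).trans (Nat.le_add_left _ _)

theorem abs_clearDen_le (p q : Fin N × Fin N) : |clearDen ρ p q| ≤ 2 ^ (2 * inputSize ρ) := by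
  rw [clearDen, Matrix.of_apply]
  refine abs_mul_le_two_pow (abs_num_le ρ p q) (j := inputSize ρ) ?_ (by omega)
  rw [abs_of_nonneg (Int.ediv_nonneg (commonDen_pos ρ).le (by positivity))]
  exact (Int.ediv_le_self _ (commonDen_pos ρ).le).trans (commonDen_le ρ)

theorem size_le_two_pow : (N : ℤ) ≤ 2 ^ inputSize ρ := by
  have h : N ≤ inputSize ρ := Nat.le_add_right _ _
  exact_mod_cast (h.trans Nat.lt_two_pow_self.le)

theorem intTrace_clearDen_le : intTrace (clearDen ρ) ≤ 2 ^ (4 * inputSize ρ + 1) := by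
  have h : |∑ p, clearDen ρ p p| ≤ 2 ^ (4 * inputSize ρ) := by
    refine abs_sum_le_two_pow (i := 2 * inputSize ρ) ?_ (fun p => abs_clearDen_le ρ p p) (by omega)
    have := size_le_two_pow ρ
    calc ((Fintype.card (Fin N × Fin N) : ℕ) : ℤ) = N * N := by simp
      _ ≤ 2 ^ inputSize ρ * 2 ^ inputSize ρ := mul_le_mul this this (by positivity) (by positivity)
      _ = _ := by rw [← pow_add, two_mul]
  have h1 : (1 : ℤ) ≤ 2 ^ (4 * inputSize ρ) := one_le_pow₀ (by norm_num)
  rw [intTrace, Matrix.trace, pow_succ]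
  have := (abs_le.mp h).2
  simp only [Matrix.diag_apply]
  linarith

theorem inputMemory_size : inputMemory ρ 0 0 = N := by simp [inputMemory]

theorem inputMemory_num (p q : Fin N × Fin N) :
    inputMemory ρ 1 (entryAddress p q) = (ρ p q).num := by
  rw [inputMemory, if_neg (by norm_num), if_pos rfl]
  exact sum_ite_entryAddress (fun p q => (ρ p q).num) p q

theorem inputMemory_den (p q : Fin N × Fin N) :
    inputMemory ρ 2 (entryAddress p q) = (ρ p q).den := by
  rw [inputMemory, if_neg (by norm_num), if_neg (by norm_num), if_pos rfl]
  exact sum_ite_entryAddress (fun p q => ((ρ p q).den : ℤ)) p q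

theorem inputMemory_of_le {a : ℕ} (ha : 3 ≤ a) (z : ℤ) : inputMemory ρ a z = 0 := by
  rw [inputMemory, if_neg (by omega), if_neg (by omega), if_neg (by omega)]

theorem bounded_inputMemory {β : ℕ} (hβ : inputSize ρ < β) : Bounded β (inputMemory ρ) := by
  intro a z
  have hlt : (2 : ℤ) ^ inputSize ρ < 2 ^ β := pow_lt_pow_right₀ (by norm_num) hβ
  have h0 : |(0 : ℤ)| < 2 ^ β := by simp
  have hne : (∀ p q, z ≠ entryAddress p q) → ∀ f : Fin N × Fin N → Fin N × Fin N → ℤ,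
      (∑ p, ∑ q, if z = entryAddress p q then f p q else 0) = 0 := fun h f =>
    Finset.sum_eq_zero fun p _ => Finset.sum_eq_zero fun q _ => if_neg (h p q)
  rcases (by omega : a = 0 ∨ a = 1 ∨ a = 2 ∨ 3 ≤ a) with rfl | rfl | rfl | ha
  · by_cases hz : z = 0
    · rw [hz, inputMemory_size, abs_of_nonneg (by positivity)]
      exact (size_le_two_pow ρ).trans_lt hlt
    · rw [inputMemory, if_pos rfl, if_neg hz]; exact h0
  · by_cases hz : ∃ p q : Fin N × Fin N, z = entryAddress p q
    · obtain ⟨p, q, rfl⟩ := hz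
      rw [inputMemory_num]
      exact (abs_num_le ρ p q).trans_lt hlt
    · push Not at hz
      rw [inputMemory, if_neg (by norm_num), if_pos rfl, hne hz]; exact h0
  · by_cases hz : ∃ p q : Fin N × Fin N, z = entryAddress p q
    · obtain ⟨p, q, rfl⟩ := hz
      rw [inputMemory_den, abs_of_nonneg (by positivity)]
      exact (den_le ρ p q).trans_lt hlt
    · push Not at hz
      rw [inputMemory, if_neg (by norm_num), if_neg (by norm_num), if_pos rfl, hne hz]; exact h0
  · rw [inputMemory_of_le ρ ha]; exact h0

end

/-- `N⁴` -/
def numEntries : Expr := var 0 * var 0 * (var 0 * var 0)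

theorem eval_numEntries {N : ℕ} {m : Memory} (h : m 0 0 = N) :
    numEntries.eval m = (N * N * (N * N) : ℕ) := by
  rw [numEntries, eval_mul, eval_mul, eval_var, h]
  push_cast
  rfl

/-- `D := ∏ den` -/
def commonDenProg : Prog := foldProg 9 11 (const 1) numEntries (var 9 * load 2 (var 11))

/-- `ρ := num * (D / den)` -/
def clearDenProg : Prog :=
  mapProg 3 numEntries (const 0) (const 0) (load 1 (var 12) * (var 9 / load 2 (var 12)))

/-- `τ := 1 + tr ρ` -/
def intTraceProg : Prog :=
  mapProg 13 (const 1) (var 0 * var 0) (load 3 (var 11 * (var 0 * var 0 + const 1)))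
    (const 1 + var 10)

theorem foldCost_le (e₀ e e' : Expr) : ∃ K, ∀ n, foldCost e₀ e e' n ≤ K * (n + 1) := by
  refine ⟨e₀.costWeight + (e.costWeight + e.weight + (e'.costWeight + 2) + 20) + 3, fun n => ?_⟩
  rw [foldCost, forCost]
  nlinarith [Nat.zero_le (e₀.costWeight * n), Nat.zero_le n]

theorem exec_commonDen : ∃ K, ∀ {N β : ℕ} (ρ : Bipartite N ℚ), 4 * inputSize ρ + 1 < β →
    ∃ m', Exec β commonDenProg (inputMemory ρ) m' (K * (N + 1) ^ 4) ∧ Bounded β m' ∧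
      (∀ a, a ≠ 9 → a ≠ 11 → m' a = inputMemory ρ a) ∧ m' 9 0 = commonDen ρ := by
  obtain ⟨K, hK⟩ := foldCost_le (const 1) numEntries (var 9 * load 2 (var 11))
  refine ⟨K, fun {N β} ρ hβ => ?_⟩
  -- Beyond the last entry the factor is 1. As all factors are at least 1, the partial products
  -- increase and are bounded by the full product.
  set d : ℕ → ℤ := fun l => if h : l < N * N * (N * N) then
    ((ρ ((entryEquiv N).symm ⟨l, h⟩).1 ((entryEquiv N).symm ⟨l, h⟩).2).den : ℤ) else 1 with hd
  set g : ℕ → ℤ := fun i => ∏ l ∈ Finset.range i, d l with hg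
  have hd1 : ∀ l, 1 ≤ d l := fun l => by
    rw [hd]
    dsimp only
    split_ifs
    · exact one_le_den _ _ _
    · exact le_rfl
  have hgn : g (N * N * (N * N)) = commonDen ρ := by
    rw [hg, commonDen, ← Equiv.prod_comp (entryEquiv N).symm]
    dsimp only
    rw [Finset.prod_range]
    refine Finset.prod_congr rfl fun l _ => ?_
    rw [hd]
    dsimp only
    rw [dif_pos l.2]
  have hg0 : ∀ i, 0 ≤ g i := fun i => Finset.prod_nonneg fun l _ => by linarith [hd1 l]
  have hgle : ∀ i ≤ N * N * (N * N), g i ≤ 2 ^ inputSize ρ := fun i hi => by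
    refine le_trans ?_ (hgn.le.trans (commonDen_le ρ))
    exact Finset.prod_le_prod_of_subset_of_one_le (Finset.range_subset_range.mpr hi)
      (fun l _ => by linarith [hd1 l]) fun l _ _ => hd1 l
  obtain ⟨m', h1, h2, h3, h4⟩ := exec_fold (β := β) (x := 9) (k := 11) (n := N * N * (N * N))
    (by norm_num) (e₀ := const 1) (en := numEntries) (e := var 9 * load 2 (var 11)) (g := g)
    (bounded_inputMemory ρ (by omega))
    (fun i hi => by
      rw [abs_of_nonneg (hg0 i)]
      exact (hgle i hi).trans_lt (pow_lt_pow_right₀ (by norm_num) (by omega)))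
    (by
      have := size_le_two_pow ρ
      calc ((N * N * (N * N) : ℕ) : ℤ) = N ^ 4 := by push_cast; ring
        _ ≤ (2 ^ inputSize ρ) ^ 4 := pow_le_pow_left₀ (by positivity) this 4
        _ = 2 ^ (4 * inputSize ρ) := by rw [← pow_mul]; congr 1; omega
        _ < 2 ^ β := pow_lt_pow_right₀ (by norm_num) (by omega))
    (by rw [hg]; rfl)
    (fun m' h => eval_numEntries (by rw [h 0 (by norm_num) (by norm_num), inputMemory_size]))
    (fun i hi m' h hx hk => by
      rw [eval_mul, eval_var, eval_load, eval_var, hx, hk, h 2 (by norm_num) (by norm_num), hg]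
      dsimp only
      rw [Finset.prod_range_succ]
      congr 1
      have := inputMemory_den ρ ((entryEquiv N).symm ⟨i, hi⟩).1 ((entryEquiv N).symm ⟨i, hi⟩).2
      rw [← val_entryEquiv, Equiv.apply_symm_apply] at this
      rw [this, hd]
      dsimp only
      rw [dif_pos hi])
  refine ⟨m', h1.mono ((hK _).trans (Nat.mul_le_mul_left _ ?_)), h2, h3, h4.trans hgn⟩
  calc N * N * (N * N) + 1 = N ^ 4 + 1 ^ 4 := by ring
    _ ≤ (N + 1) ^ 4 := pow_add_pow_le (by positivity) (by positivity) (by norm_num)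

theorem exec_clearDen : ∃ K, ∀ {N β : ℕ} (ρ : Bipartite N ℚ), 4 * inputSize ρ + 1 < β →
    ∀ {m : Memory}, Bounded β m → (∀ a, a ≠ 9 → a ≠ 11 → m a = inputMemory ρ a) →
    m 9 0 = commonDen ρ →
    ∃ m', Exec β clearDenProg m m' (K * (N + 1) ^ 4) ∧ Bounded β m' ∧ Agree 3 m m' ∧
      StoresChoi (clearDen ρ) m' := by
  obtain ⟨K, hK⟩ := mapCost_le numEntries (const 0) (const 0)
    (load 1 (var 12) * (var 9 / load 2 (var 12)))
  refine ⟨K, fun {N β} ρ hβ {m} hm ha hD => ?_⟩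
  obtain ⟨m', h1, h2, h3, h4⟩ := exec_map (β := β) (dst := 3) (by norm_num) (by norm_num)
    (by norm_num) (entryEquiv N).symm (Equiv.refl (Fin 0)) (nz := numEntries) (nk := const 0)
    (e := const 0) (f := load 1 (var 12) * (var 9 / load 2 (var 12))) (t := fun _ _ => 0)
    (h := fun x => clearDen ρ x.1 x.2) (B := 0) hm
    (fun m' h => eval_numEntries (by
      rw [h 0 (by norm_num) (by norm_num) (by norm_num) (by norm_num),
        ha 0 (by norm_num) (by norm_num), inputMemory_size]))
    (fun m' _ => rfl) (fun _ x => x.elim0)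
    (fun x m' h hz _ => by
      rw [Equiv.symm_symm, val_entryEquiv] at hz
      rw [eval_mul, eval_div, eval_load, eval_load, eval_var, eval_var, hz,
        h 1 (by norm_num) (by norm_num) (by norm_num) (by norm_num),
        h 2 (by norm_num) (by norm_num) (by norm_num) (by norm_num),
        h 9 (by norm_num) (by norm_num) (by norm_num) (by norm_num), hD,
        ha 1 (by norm_num) (by norm_num), ha 2 (by norm_num) (by norm_num), inputMemory_num,
        inputMemory_den]
      rfl)
    (by
      have := size_le_two_pow ρ
      calc ((N * N * (N * N) : ℕ) : ℤ) = N ^ 4 := by push_cast; ring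
        _ ≤ (2 ^ inputSize ρ) ^ 4 := pow_le_pow_left₀ (by positivity) this 4
        _ = 2 ^ (4 * inputSize ρ) := by rw [← pow_mul]; congr 1; omega
        _ < 2 ^ β := pow_lt_pow_right₀ (by norm_num) (by omega))
    (by simp) (fun _ x => x.elim0) (by simp)
    (fun x => (abs_clearDen_le ρ _ _).trans_lt (pow_lt_pow_right₀ (by norm_num) (by omega)))
  refine ⟨m', h1.mono ((hK _ _).trans (Nat.mul_le_mul_left _ ?_)), h2, h3, fun p q => ?_⟩
  · calc (N * N * (N * N) + 1) * (0 + 1) = N ^ 4 + 1 ^ 4 := by ring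
      _ ≤ (N + 1) ^ 4 := pow_add_pow_le (by positivity) (by positivity) (by norm_num)
  · rw [← h4 (p, q), Equiv.symm_symm, val_entryEquiv]

theorem exec_intTrace : ∃ K, ∀ {N : ℕ} {ρ : Bipartite N ℤ} {c : ℤ} {b β : ℕ},
    WordBounds N ρ c b β → 1 ≤ N → intTrace ρ < 2 ^ β → 1 ≤ intTrace ρ → ∀ {m : Memory},
    Bounded β m → m 0 0 = N → StoresChoi ρ m →
    ∃ m', Exec β intTraceProg m m' (K * (N + 1) ^ 4) ∧ Bounded β m' ∧ Agree 13 m m' ∧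
      m' 13 0 = intTrace ρ := by
  obtain ⟨K, hK⟩ := mapCost_le (const 1) (var 0 * var 0)
    (load 3 (var 11 * (var 0 * var 0 + const 1))) (const 1 + var 10)
  refine ⟨K, fun {N ρ c b β} h hN1 hτ hτ1 {m} hm hN hρ => ?_⟩
  have hN2 := h.two_pow_lt h.size_sq (by omega)
  have hN' : ∀ m' : Memory, Agree 13 m m' → m' 0 0 = N := fun m' h => by
    rw [h 0 (by norm_num) (by norm_num) (by norm_num) (by norm_num), hN]
  obtain ⟨m', h1, h2, h3, h4⟩ := exec_map (β := β) (dst := 13) (by norm_num) (by norm_num)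
    (by norm_num) (Equiv.refl (Fin 1)) finProdFinEquiv.symm (nz := const 1) (nk := var 0 * var 0)
    (e := load 3 (var 11 * (var 0 * var 0 + const 1))) (f := const 1 + var 10)
    (t := fun _ p => ρ p p) (h := fun _ => intTrace ρ) (B := 2 ^ b) hm
    (fun m' _ => rfl) (fun m' h => by rw [eval_mul, eval_var, hN' m' h]; push_cast; rfl)
    (fun _ p m' ha _ hk => by
      -- The diagonal entry number k of an N² × N² matrix has the address k(N² + 1).
      rw [Equiv.symm_symm, finProdFinEquiv_apply_val] at hk
      rw [eval_load, eval_mul, eval_add, eval_mul, eval_var, eval_var, eval_const, hN' m' ha, hk,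
        ha 3 (by norm_num) (by norm_num) (by norm_num) (by norm_num), ← hρ, entryAddress]
      congr 1
      push_cast
      ring)
    (fun _ m' ha _ hx => by rw [eval_add, eval_const, eval_var, hx]; rfl)
    (h.two_pow_lt (j := 0) (by norm_num) (by omega)) (by exact_mod_cast hN2)
    (fun _ p => h.entry p p)
    (by
      refine h.two_pow_lt (j := 3 * b) ?_ (by omega)
      calc _ ≤ (2 : ℤ) ^ (2 * b) * 2 ^ b :=
            mul_le_mul_of_nonneg_right (by exact_mod_cast h.size_sq) (by positivity)
        _ = _ := by rw [← pow_add]; congr 1; omega)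
    (fun _ => by rwa [abs_of_nonneg (by omega)])
  refine ⟨m', h1.mono ((hK _ _).trans (cost_matrix_le ?_ le_rfl)), h2, h3, h4 0⟩
  exact hN1.trans (Nat.le_mul_self N)

/-- `w := 1; ℓ := 0; while w < τ: w := 2 w; ℓ := ℓ + 1` -/
def logProg : Prog :=
  .seq (.store 14 (const 0) (const 1)) (.seq (.store 15 (const 0) (const 0))
    (.whilePos (var 13 - var 14) (.seq (.store 14 (const 0) (var 14 + var 14))
      (.store 15 (const 0) (var 15 + const 1)))))

/-- Before round i the cells hold 2^i and i; the loop continues exactly while 2^i < τ, that is,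
while i is below the binary ceiling logarithm. -/
theorem exec_log {β τ : ℕ} (hτ : Nat.clog 2 τ < β) {m : Memory} (hm : Bounded β m)
    (h13 : m 13 0 = τ) :
    ∃ m', Exec β logProg m m' (100 * (Nat.clog 2 τ + 1)) ∧ Bounded β m' ∧
      (∀ a, a ≠ 14 → a ≠ 15 → m' a = m a) ∧ m' 15 0 = Nat.clog 2 τ := by
  have hpow : ∀ i : ℕ, i ≤ Nat.clog 2 τ → |(2 : ℤ) ^ i| < 2 ^ β := fun i hi => by
    rw [abs_of_nonneg (by positivity)]
    exact pow_lt_pow_right₀ (by norm_num) (by omega)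
  have hcast : ∀ i : ℕ, i ≤ Nat.clog 2 τ → |(i : ℤ)| < 2 ^ β := fun i hi => by
    rw [abs_of_nonneg (by positivity)]
    exact_mod_cast Nat.lt_two_pow_self.trans_le (Nat.pow_le_pow_right (by norm_num)
      (by omega : i ≤ β))
  have w1 : (var 13 - var 14).costWeight = 6 := rfl
  have w2 : (var 14 + var 14).costWeight = 6 := rfl
  have w3 : (var 15 + const 1).costWeight = 7 := rfl
  have w4 : (const 0).costWeight = 1 := rfl
  have w5 : (const 1).costWeight = 2 := rfl
  have key : ∀ r i (m : Memory), i + r = Nat.clog 2 τ → Bounded β m → m 13 0 = τ →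
      m 14 0 = 2 ^ i → m 15 0 = i → ∃ m', Exec β
        (.whilePos (var 13 - var 14) (.seq (.store 14 (const 0) (var 14 + var 14))
          (.store 15 (const 0) (var 15 + const 1)))) m m' (50 * r + 20) ∧ Bounded β m' ∧
        (∀ a, a ≠ 14 → a ≠ 15 → m' a = m a) ∧ m' 15 0 = Nat.clog 2 τ := by
    intro r
    induction r with
    | zero =>
      intro i m hi hb h1 h2 h3
      obtain rfl : i = Nat.clog 2 τ := by omega
      refine ⟨m, (exec_whilePos_false hb ?_).mono (by rw [w1]; omega), hb, fun _ _ _ => rfl, h3⟩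
      rw [eval_sub, eval_var, eval_var, h1, h2, sub_nonpos]
      exact_mod_cast Nat.le_pow_clog (by norm_num) τ
    | succ r ih =>
      intro i m hi hb h1 h2 h3
      have e1 := exec_store hb 14 (const 0) (var 14 + var 14)
      rw [eval_const, eval_add, eval_var, h2, ← two_mul, ← pow_succ'] at e1
      have b1 := hb.setCell (a := 14) (z := 0) (hpow (i + 1) (by omega))
      have e2 := exec_store b1 15 (const 0) (var 15 + const 1)
      rw [eval_const, eval_add, eval_var, setCell_of_ne _ (by norm_num), h3, eval_const] at e2
      have b2 := b1.setCell (a := 15) (z := 0) (hcast (i + 1) (by omega))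
      push_cast at b2
      obtain ⟨m', e3, b3, a3, s3⟩ := ih (i + 1) _ (by omega) b2
        (by rw [setCell_of_ne _ (by norm_num), setCell_of_ne _ (by norm_num), h1])
        (by rw [setCell_of_ne _ (by norm_num), setCell_self])
        (by rw [setCell_self]; push_cast; rfl)
      refine ⟨m', (exec_whilePos_true hb ?_ (e1.seq e2) e3).mono ?_, b3, fun a h1 h2 => ?_, s3⟩
      · rw [eval_sub, eval_var, eval_var, h1, h2, sub_pos]
        exact_mod_cast (Nat.lt_clog_iff_pow_lt (by norm_num)).mp (by omega : i < Nat.clog 2 τ)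
      · rw [w1, w2, w3, w4]; omega
      · rw [a3 a h1 h2, setCell_of_ne _ h2, setCell_of_ne _ h1]
  have e1 := exec_store hm 14 (const 0) (const 1)
  rw [eval_const, eval_const] at e1
  have b1 := hm.setCell (a := 14) (z := 0) (hpow 0 (by omega))
  rw [pow_zero] at b1
  have e2 := exec_store b1 15 (const 0) (const 0)
  rw [eval_const] at e2
  have b2 := b1.setCell (a := 15) (z := 0) (hcast 0 (by omega))
  rw [Nat.cast_zero] at b2
  obtain ⟨m', e3, b3, a3, s3⟩ := key (Nat.clog 2 τ) 0 _ (by omega) b2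
    (by rw [setCell_of_ne _ (by norm_num), setCell_of_ne _ (by norm_num), h13])
    (by rw [setCell_of_ne _ (by norm_num), setCell_self]; rfl) (by rw [setCell_self]; rfl)
  refine ⟨m', (e1.seq (e2.seq e3)).mono (by rw [w4, w5]; omega), b3, fun a h1 h2 => ?_, s3⟩
  rw [a3 a h1 h2, setCell_of_ne _ h2, setCell_of_ne _ h1]

end OperatorScaling

namespace OperatorScaling

open OperatorScaling.Expr

/-! ### The program -/

/-- `L := 300 N⁴ (ℓ + 1)` -/
def lengthExpr : Expr := const 300 * numEntries * (var 15 + const 1)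

/-- `W := 64 N³ 2^L` -/
def scaleProg : Prog :=
  foldProg 17 11 (const 64 * (var 0 * var 0 * var 0)) (var 16) (var 17 + var 17)

/-- `U := W I` for the matrix `U` in array `u` -/
def initProg (u : ℕ) : Prog :=
  matrixProg u (const 0) (const 0) (var 17 * delta (rowOf 12) (colOf 12))

/-- `for n = 0, …, L - 1`: one iteration of the descent. -/
def descentProg : Prog := forProg 21 (var 16) descendProg

/-- The decision procedure. -/
def edmondsProg : Prog :=
  -- Arrays: 3 holds the integral ρ, 4 and 5 hold U and V, 6 to 8 the auxiliary matrices S, G, H,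
  -- and 9 the common denominator. Arrays 10 to 12 serve the loops, 13 to 18 hold τ, a power of two,
  -- ℓ, L, W, c, and 19 to 21 the squared residual, the flag and the iteration counter.
  .seq commonDenProg (.seq clearDenProg (.seq intTraceProg (.seq logProg
    (.seq (.store 16 (const 0) lengthExpr) (.seq scaleProg
      (.seq (.store 18 (const 0) (var 13 * var 17 * var 17)) (.seq (initProg 4) (.seq (initProg 5)
        (.seq descentProg (.store 0 (const 0) (var 20)))))))))))

/-- The power of two is produced by L doublings, so every intermediate value is bounded by the final
one. -/
theorem exec_scale : ∃ K, ∀ {N L b β : ℕ} {m : Memory}, Bounded β m → m 0 0 = N → m 16 0 = L →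
    64 * (N : ℤ) ^ 3 * 2 ^ L ≤ 2 ^ b → L ≤ b → b < β →
    ∃ m', Exec β scaleProg m m' (K * (L + 1)) ∧ Bounded β m' ∧
      (∀ a, a ≠ 17 → a ≠ 11 → m' a = m a) ∧ m' 17 0 = 64 * (N : ℤ) ^ 3 * 2 ^ L := by
  obtain ⟨K, hK⟩ := foldCost_le (const 64 * (var 0 * var 0 * var 0)) (var 16) (var 17 + var 17)
  refine ⟨K, fun {N L b β m} hm hN hL hW hLb hb => ?_⟩
  obtain ⟨m', h1, h2⟩ := exec_fold (β := β) (x := 17) (k := 11) (n := L) (by norm_num)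
    (e₀ := const 64 * (var 0 * var 0 * var 0)) (en := var 16) (e := var 17 + var 17)
    (g := fun i => 64 * (N : ℤ) ^ 3 * 2 ^ i) hm
    (fun i hi => by
      rw [abs_of_nonneg (by positivity)]
      calc 64 * (N : ℤ) ^ 3 * 2 ^ i ≤ 64 * (N : ℤ) ^ 3 * 2 ^ L :=
            mul_le_mul_of_nonneg_left (pow_le_pow_right₀ (by norm_num) hi) (by positivity)
        _ ≤ 2 ^ b := hW
        _ < 2 ^ β := pow_lt_pow_right₀ (by norm_num) hb)
    (by exact_mod_cast Nat.lt_two_pow_self.trans_le (Nat.pow_le_pow_right (by norm_num)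
      (by omega : L ≤ β)))
    (by simp only [eval_mul, eval_const, eval_var, hN]; ring)
    (fun m' h => by rw [eval_var, h 16 (by norm_num) (by norm_num), hL])
    (fun i _ m' _ hx _ => by rw [eval_add, eval_var, hx]; ring)
  exact ⟨m', h1.mono (hK L), h2⟩

theorem exec_init (u : ℕ) (hu : u = 4 ∨ u = 5) :
    ∃ K, ∀ {N : ℕ} {ρ : Bipartite N ℤ} {c : ℤ} {b β : ℕ},
    WordBounds N ρ c b β → ∀ {m : Memory} {W : ℤ},
    Bounded β m → m 0 0 = N → m 17 0 = W → |W| ≤ 2 ^ b →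
    ∃ m', Exec β (initProg u) m m' (K * (N + 1) ^ 4) ∧ Bounded β m' ∧ Agree u m m' ∧
      Stores (N := N) u (W • 1) m' := by
  obtain ⟨K, hK⟩ := mapCost_le (var 0 * var 0) (const 0) (const 0)
    (var 17 * delta (rowOf 12) (colOf 12))
  refine ⟨K, fun {N ρ c b β} h {m W} hm hN hW hWb => ?_⟩
  obtain ⟨m', h1, h2⟩ := exec_matrix (N := N) (β := β) (dst := u) (by omega) (by omega)
    (by omega) (by omega) (Equiv.refl (Fin 0)) (nk := const 0) (e := const 0)
    (f := var 17 * delta (rowOf 12) (colOf 12)) (fun i j x => 0) (W • 1) 0 hm hN (fun m' _ => rfl)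
    (fun i j x => x.elim0)
    (fun i j m' h0 ha _ hr hc _ => by
      rw [eval_mul, eval_delta, hr, hc, eval_var, ha 17 (by norm_num) (by norm_num) (by norm_num)
        (by omega), hW, Matrix.smul_apply, Matrix.one_apply, smul_eq_mul]
      simp only [Nat.cast_inj, Fin.val_inj])
    (h.two_pow_lt h.size_sq (by omega)) (by simp) (fun i j x => x.elim0) (by simp)
    (fun i j => by
      rw [Matrix.smul_apply, Matrix.one_apply, smul_eq_mul]
      split_ifs
      · rw [mul_one]; exact h.two_pow_lt hWb (by omega)
      · simp)
  exact ⟨m', h1.mono ((hK _ _).trans (cost_matrix_le le_rfl (Nat.zero_le _))), h2⟩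

theorem exec_descent : ∃ K, ∀ {N : ℕ} {ρ : Bipartite N ℤ} {c W : ℤ} {L b β : ℕ},
    WordBounds N ρ c b β → 1 ≤ N → L ≤ b → ∀ {m : Memory},
    Bounded β m → m 0 0 = N → m 16 0 = L → m 18 0 = c → StoresChoi ρ m →
    StoresState (descentAt ρ c W 0) m →
    (∀ n ≤ L, ∀ i j, |(descentAt ρ c W n).U i j| ≤ 2 ^ b ∧ |(descentAt ρ c W n).V i j| ≤ 2 ^ b) →
    ∃ m', Exec β descentProg m m' (K * ((N + 1) ^ 4 * (L + 1))) ∧ Bounded β m' ∧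
      m' 20 0 = (descentAt ρ c W L).flag := by
  obtain ⟨K, hK⟩ := exec_descend
  refine ⟨(var 16).costWeight + (var 16).weight + K + 20,
    fun {N ρ c W L b β} h hN1 hLb {m} hm hN hL hc hρ hx hb => ?_⟩
  have hP : 1 ≤ (N + 1) ^ 4 := Nat.one_le_pow _ _ (by omega)
  have hLβ : ∀ i : ℕ, i ≤ L → |(i : ℤ)| < 2 ^ β := fun i hi => by
    rw [abs_of_nonneg (by positivity)]
    exact_mod_cast Nat.lt_two_pow_self.trans_le (Nat.pow_le_pow_right (by norm_num)
      (by have := h.word; omega : i ≤ β))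
  obtain ⟨m', h1, h2⟩ := exec_for (β := β) (k := 21) (e := var 16) (body := descendProg)
    (c := K * (N + 1) ^ 4) (n := L)
    (Inv := fun i m' => Bounded β m' ∧ m' 21 0 = i ∧ StoresState (descentAt ρ c W i) m' ∧
      ∀ a, (a < 4 ∨ 12 < a) → a ≠ 19 → a ≠ 20 → a ≠ 21 → m' a = m a)
    (fun i m' _ hI => ⟨hI.1, hI.2.1, by
      rw [eval_var, hI.2.2.2 16 (by norm_num) (by norm_num) (by norm_num) (by norm_num), hL]⟩)
    (fun i m1 hi hI => by
      obtain ⟨hb1, hk1, hx1, ha1⟩ := hI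
      have e0 := ha1 0 (by norm_num) (by norm_num) (by norm_num) (by norm_num)
      have e3 := ha1 3 (by norm_num) (by norm_num) (by norm_num) (by norm_num)
      have e18 := ha1 18 (by norm_num) (by norm_num) (by norm_num) (by norm_num)
      obtain ⟨m2, hr, hb2, ha2, hx2⟩ := hK h hN1 hb1 (by rw [e0, hN]) (by rw [e18, hc])
        (fun p q => by rw [e3]; exact hρ p q) hx1 (hb i hi.le) (hb (i + 1) hi)
      have hb3 : |((i : ℤ) + 1)| < 2 ^ β := by exact_mod_cast hLβ (i + 1) hi
      refine ⟨m2, hr, hb2, ?_, hb2.setCell hb3, ?_, ?_, fun a h1 h2 h3 h4 => ?_⟩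
      · rw [ha2 21 (by norm_num) (by norm_num) (by norm_num), hk1]
      · rw [setCell_self]; push_cast; rfl
      · exact ⟨hx2.left.congr (setCell_of_ne _ (by norm_num) _ _),
          hx2.right.congr (setCell_of_ne _ (by norm_num) _ _),
          (by rw [setCell_of_ne _ (by norm_num)]; exact hx2.flag)⟩
      · rw [setCell_of_ne _ h4, ha2 a h1 h2 h3, ha1 a h1 h2 h3 h4])
    hm ⟨hm.setCell (by simp), by rw [setCell_self]; rfl,
      ⟨hx.left.congr (setCell_of_ne _ (by norm_num) _ _),
        hx.right.congr (setCell_of_ne _ (by norm_num) _ _),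
        (by rw [setCell_of_ne _ (by norm_num)]; exact hx.flag)⟩,
      fun a _ _ _ h4 => setCell_of_ne _ h4 _ _⟩
  refine ⟨m', h1.mono ?_, h2.1, h2.2.2.1.flag⟩
  rw [forCost]
  generalize (var 16).costWeight + (var 16).weight = u
  calc (L + 1) * (u + K * (N + 1) ^ 4 + 20)
      ≤ (L + 1) * (u * (N + 1) ^ 4 + K * (N + 1) ^ 4 + 20 * (N + 1) ^ 4) := by
        refine Nat.mul_le_mul_left _ ?_
        have h1 : u ≤ u * (N + 1) ^ 4 := Nat.le_mul_of_pos_right _ hP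
        have h2 : 20 ≤ 20 * (N + 1) ^ 4 := Nat.le_mul_of_pos_right _ hP
        omega
    _ = _ := by ring

/-- The number of iterations of the decision procedure. -/
def numSteps {N : ℕ} (ρ : Bipartite N ℤ) : ℕ :=
  300 * N ^ 4 * (Nat.clog 2 (intTrace ρ).toNat + 1)

/-- The initial multiple of the identity matrix. -/
def initialScale {N : ℕ} (ρ : Bipartite N ℤ) : ℤ := 64 * (N : ℤ) ^ 3 * 2 ^ numSteps ρ

/-- The square of the scale, multiplied by the trace. -/
def initialLevel {N : ℕ} (ρ : Bipartite N ℤ) : ℤ := intTrace ρ * initialScale ρ * initialScale ρ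

/-- A sufficient number of bits for all data. -/
def dataBits {N : ℕ} (ρ : Bipartite N ℚ) : ℕ :=
  -- The size of c = τW²: τ needs 4s + 1 bits and W needs 3s + 6 + L, where s is the input size and
  -- L the number of steps. The matrix entries, at most N W 2^L, need only 4s + 6 + 2L.
  10 * inputSize ρ + 13 + 2 * numSteps (clearDen ρ)

section

variable {N : ℕ} {ρ : Bipartite N ℚ} (hρ : (ρ.map (Rat.cast : ℚ → ℂ)).PosSemidef)

theorem initialScale_le :
    initialScale (clearDen ρ) ≤ 2 ^ (3 * inputSize ρ + 6 + numSteps (clearDen ρ)) := by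
  have h := size_le_two_pow ρ
  calc initialScale (clearDen ρ)
      ≤ 2 ^ 6 * (2 ^ inputSize ρ) ^ 3 * 2 ^ numSteps (clearDen ρ) := by
        refine mul_le_mul_of_nonneg_right ?_ (by positivity)
        exact mul_le_mul (by norm_num) (pow_le_pow_left₀ (by positivity) h 3) (by positivity)
          (by positivity)
    _ = _ := by rw [← pow_mul, ← pow_add, ← pow_add]; congr 1; omega

theorem initialScale_nonneg (σ : Bipartite N ℤ) : 0 ≤ initialScale σ := by
  unfold initialScale
  positivity

include hρ

theorem wordBounds_clearDen :
    WordBounds N (clearDen ρ) (initialLevel (clearDen ρ)) (dataBits ρ) (14 * dataBits ρ + 3) where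
  size := (size_le_two_pow ρ).trans (pow_le_pow_right₀ (by norm_num) (by unfold dataBits; omega))
  entry p q := (abs_clearDen_le ρ p q).trans
    (pow_le_pow_right₀ (by norm_num) (by unfold dataBits; omega))
  level := by
    have h1 := one_le_intTrace (posSemidef_clearDen ρ hρ)
    have hW : |initialScale (clearDen ρ)| ≤ 2 ^ (3 * inputSize ρ + 6 + numSteps (clearDen ρ)) := by
      rw [abs_of_nonneg (initialScale_nonneg _)]
      exact initialScale_le
    have hτ : |intTrace (clearDen ρ)| ≤ 2 ^ (4 * inputSize ρ + 1) := by
      rw [abs_of_nonneg (by omega)]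
      exact intTrace_clearDen_le ρ
    exact abs_mul_le_two_pow (abs_mul_le_two_pow hτ hW le_rfl) hW (by unfold dataBits; omega)
  word := le_rfl

theorem abs_descentAt_clearDen_le (hN : 1 ≤ N) {n : ℕ} (hn : n ≤ numSteps (clearDen ρ))
    (i j : Fin N) :
    |(descentAt (clearDen ρ) (initialLevel (clearDen ρ)) (initialScale (clearDen ρ)) n).U i j| ≤
      2 ^ dataBits ρ ∧
    |(descentAt (clearDen ρ) (initialLevel (clearDen ρ)) (initialScale (clearDen ρ)) n).V i j| ≤
      2 ^ dataBits ρ := by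
  have h := abs_descentAt_le (posSemidef_clearDen ρ hρ) hN (W := initialScale (clearDen ρ))
    (L := numSteps (clearDen ρ)) le_rfl hn i j
  have hle : (N : ℤ) * initialScale (clearDen ρ) * 2 ^ n ≤ 2 ^ dataBits ρ := by
    calc (N : ℤ) * initialScale (clearDen ρ) * 2 ^ n
        ≤ 2 ^ inputSize ρ * 2 ^ (3 * inputSize ρ + 6 + numSteps (clearDen ρ)) *
          2 ^ numSteps (clearDen ρ) :=
          mul_le_mul (mul_le_mul (size_le_two_pow ρ) initialScale_le (initialScale_nonneg _)
            (by positivity)) (pow_le_pow_right₀ (by norm_num) hn) (by positivity) (by positivity)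
      _ ≤ _ := by
          rw [← pow_add, ← pow_add]
          exact pow_le_pow_right₀ (by norm_num) (by unfold dataBits; omega)
  exact ⟨h.1.trans hle, h.2.trans hle⟩

end

/-- Chains the executions of all program parts. Each needs only that the cells it reads survived the
preceding parts, and the iterations of the descent dominate the cost. -/
theorem exec_edmonds : ∃ K, ∀ {N : ℕ} {ρ : Bipartite N ℚ}, 1 ≤ N →
    (ρ.map (Rat.cast : ℚ → ℂ)).PosSemidef →
    ∃ m', Exec (14 * dataBits ρ + 3) edmondsProg (inputMemory ρ) m'
      (K * ((N + 1) ^ 4 * (numSteps (clearDen ρ) + 1))) ∧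
      m' 0 0 = (descentAt (clearDen ρ) (initialLevel (clearDen ρ)) (initialScale (clearDen ρ))
        (numSteps (clearDen ρ))).flag := by
  obtain ⟨K1, h1⟩ := exec_commonDen
  obtain ⟨K2, h2⟩ := exec_clearDen
  obtain ⟨K3, h3⟩ := exec_intTrace
  obtain ⟨K5, h5⟩ := exec_scale
  obtain ⟨K6, h6⟩ := exec_init 4 (.inl rfl)
  obtain ⟨K7, h7⟩ := exec_init 5 (.inr rfl)
  obtain ⟨K8, h8⟩ := exec_descent
  refine ⟨K1 + K2 + K3 + 100 + (lengthExpr.costWeight + 2) + K5 +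
    ((var 13 * var 17 * var 17).costWeight + 2) + K6 + K7 + K8 + 14, fun {N ρ} hN hρ => ?_⟩
  set σ := clearDen ρ with hσ
  set L := numSteps σ with hL
  set W := initialScale σ with hW
  set c := initialLevel σ with hc
  set b := dataBits ρ with hb
  have hbv : b = 10 * inputSize ρ + 13 + 2 * L := rfl
  have hτ1 := one_le_intTrace (posSemidef_clearDen ρ hρ)
  rw [← hσ] at hτ1
  have h := wordBounds_clearDen hρ
  rw [← hσ, ← hc, ← hb] at h
  set β := 14 * b + 3 with hβ
  have hbβ : b < β := by omega
  have lift : ∀ {x : ℤ}, 0 ≤ x → x ≤ 2 ^ b → |x| < 2 ^ β := fun {x} h0 hx => by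
    rw [abs_of_nonneg h0]
    exact hx.trans_lt (pow_lt_pow_right₀ (by norm_num) hbβ)
  have hτb : intTrace σ ≤ 2 ^ b :=
    (intTrace_clearDen_le ρ).trans (pow_le_pow_right₀ (by norm_num) (by omega))
  have hℓ : Nat.clog 2 (intTrace σ).toNat ≤ L := by
    have h4 : 1 ≤ N ^ 4 := Nat.one_le_pow _ _ hN
    rw [hL, numSteps]
    nlinarith
  obtain ⟨m1, e1, b1, a1, s1⟩ := h1 (β := β) ρ (by omega)
  obtain ⟨m2, e2, b2, a2, s2⟩ := h2 (β := β) ρ (by omega) b1 a1 s1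
  have hN2 : m2 0 0 = N := by
    rw [a2 0 (by norm_num) (by norm_num) (by norm_num) (by norm_num),
      a1 0 (by norm_num) (by norm_num), inputMemory_size]
  obtain ⟨m3, e3, b3, a3, s3⟩ := h3 h hN (hτb.trans_lt (pow_lt_pow_right₀ (by norm_num) hbβ)) hτ1
    b2 hN2 s2
  obtain ⟨m4, e4, b4, a4, s4⟩ := exec_log (β := β) (τ := (intTrace σ).toNat) (by omega) b3
    (by rw [s3, Int.toNat_of_nonneg (by omega)])
  have hN4 : m4 0 0 = N := by
    rw [a4 0 (by norm_num) (by norm_num),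
      a3 0 (by norm_num) (by norm_num) (by norm_num) (by norm_num), hN2]
  have hLev : lengthExpr.eval m4 = L := by
    rw [lengthExpr, eval_mul, eval_mul, eval_add, eval_const, eval_const, eval_numEntries hN4,
      eval_var, s4, hL, numSteps]
    push_cast
    ring
  have e5 := exec_store b4 16 (const 0) lengthExpr
  rw [eval_const, hLev] at e5
  have b5 := b4.setCell (a := 16) (z := 0) (lift (Nat.cast_nonneg L)
    (by exact_mod_cast Nat.lt_two_pow_self.le.trans (Nat.pow_le_pow_right (by norm_num)
      (by omega : L ≤ b))))
  set m5 := setCell m4 16 0 L with hm5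
  have a5 : ∀ a, a ≠ 16 → m5 a = m4 a := fun a ha => setCell_of_ne _ ha _ _
  have hWb : W ≤ 2 ^ b :=
    initialScale_le.trans (pow_le_pow_right₀ (by norm_num) (by rw [← hσ, ← hL]; omega))
  obtain ⟨m6, e6, b6, a6, s6⟩ := h5 (N := N) (L := L) (b := b) b5 (by rw [a5 0 (by norm_num), hN4])
    (setCell_self _ _ _ _) hWb (by omega) hbβ
  have hcev : (var 13 * var 17 * var 17).eval m6 = c := by
    rw [eval_mul, eval_mul, eval_var, eval_var, s6, a6 13 (by norm_num) (by norm_num),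
      a5 13 (by norm_num), a4 13 (by norm_num) (by norm_num), s3]
    rfl
  have e7 := exec_store b6 18 (const 0) (var 13 * var 17 * var 17)
  rw [eval_const, hcev] at e7
  have b7 := b6.setCell (a := 18) (z := 0) (h.two_pow_lt h.level (by omega))
  set m7 := setCell m6 18 0 c with hm7
  have a7 : ∀ a, a ≠ 18 → m7 a = m6 a := fun a ha => setCell_of_ne _ ha _ _
  have keep7 : ∀ a, a < 11 → m7 a = m3 a := fun a ha => by
    rw [a7 a (by omega), a6 a (by omega) (by omega), a5 a (by omega), a4 a (by omega) (by omega)]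
  have hN3 : m3 0 0 = N := by
    rw [a3 0 (by norm_num) (by norm_num) (by norm_num) (by norm_num), hN2]
  obtain ⟨m8, e8, b8, a8, s8⟩ := h6 h (W := W) b7 (by rw [keep7 0 (by norm_num), hN3])
    (by rw [a7 17 (by norm_num), s6]; rfl) (by rwa [abs_of_nonneg (initialScale_nonneg _)])
  obtain ⟨m9, e9, b9, a9, s9⟩ := h7 h (W := W) b8
    (by rw [a8 0 (by norm_num) (by norm_num) (by norm_num) (by norm_num), keep7 0 (by norm_num),
        hN3])
    (by rw [a8 17 (by norm_num) (by norm_num) (by norm_num) (by norm_num), a7 17 (by norm_num), s6]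
        rfl) (by rwa [abs_of_nonneg (initialScale_nonneg _)])
  have keep9 : ∀ a, a ≠ 4 → a ≠ 5 → (a < 10 ∨ 12 < a) → m9 a = m7 a := fun a h1 h2 h3 => by
    rw [a9 a (by omega) (by omega) (by omega) h2, a8 a (by omega) (by omega) (by omega) h1]
  obtain ⟨m10, e10, b10, s10⟩ := h8 (W := W) (L := L) h hN (by omega) b9
    (by rw [keep9 0 (by norm_num) (by norm_num) (by norm_num), keep7 0 (by norm_num), hN3])
    (by rw [keep9 16 (by norm_num) (by norm_num) (by norm_num), a7 16 (by norm_num),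
      a6 16 (by norm_num) (by norm_num), hm5, setCell_self])
    (by rw [keep9 18 (by norm_num) (by norm_num) (by norm_num), hm7, setCell_self])
    (fun p q => by
      rw [keep9 3 (by norm_num) (by norm_num) (by norm_num), keep7 3 (by norm_num),
        a3 3 (by norm_num) (by norm_num) (by norm_num) (by norm_num)]
      exact s2 p q)
    ⟨s8.congr (a9 4 (by norm_num) (by norm_num) (by norm_num) (by norm_num)), s9, by
      rw [keep9 20 (by norm_num) (by norm_num) (by norm_num), a7 20 (by norm_num),
        a6 20 (by norm_num) (by norm_num), a5 20 (by norm_num), a4 20 (by norm_num) (by norm_num),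
        a3 20 (by norm_num) (by norm_num) (by norm_num) (by norm_num),
        a2 20 (by norm_num) (by norm_num) (by norm_num) (by norm_num),
        a1 20 (by norm_num) (by norm_num), inputMemory_of_le ρ (by norm_num)]
      rfl⟩
    (fun n hn i j => abs_descentAt_clearDen_le hρ hN hn i j)
  have e11 := exec_store b10 0 (const 0) (var 20)
  rw [eval_const, eval_var, s10] at e11
  refine ⟨_, (e1.seq (e2.seq (e3.seq (e4.seq (e5.seq (e6.seq (e7.seq (e8.seq (e9.seq
    (e10.seq e11)))))))))).mono ?_, setCell_self _ _ _ _⟩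
  have w0 : (const 0).costWeight = 1 := rfl
  have w20 : (var 20).costWeight = 2 := rfl
  rw [w0, w20]
  generalize lengthExpr.costWeight = x
  generalize (var 13 * var 17 * var 17).costWeight = y
  have hP : 1 ≤ (N + 1) ^ 4 := Nat.one_le_pow _ _ (by omega)
  set P := (N + 1) ^ 4 with hPdef
  set Q := P * (L + 1) with hQ
  have q1 : P ≤ Q := Nat.le_mul_of_pos_right _ (by omega)
  have q2 : L + 1 ≤ Q := Nat.le_mul_of_pos_left _ (by omega)
  have q3 : 1 ≤ Q := hP.trans q1
  have r1 := Nat.mul_le_mul_left K1 q1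
  have r2 := Nat.mul_le_mul_left K2 q1
  have r3 := Nat.mul_le_mul_left K3 q1
  have r4 : Nat.clog 2 (intTrace σ).toNat + 1 ≤ Q := by omega
  have r5 := Nat.mul_le_mul_left K5 q2
  have r6 := Nat.mul_le_mul_left K6 q1
  have r7 := Nat.mul_le_mul_left K7 q1
  have r8 := Nat.le_mul_of_pos_right x q3
  have r9 := Nat.le_mul_of_pos_right y q3
  simp only [add_mul] at *
  omega

/-! ### Correctness of the program and its polynomial running time. -/

theorem hasNonsingular_iff_flag {N : ℕ} {ρ : Bipartite N ℚ} (hN : 1 ≤ N)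
    (hρ : (ρ.map (Rat.cast : ℚ → ℂ)).PosSemidef) (h : EdmondsRado (ρ.map (Rat.cast : ℚ → ℂ))) :
    (HasNonsingular (imageSpace (ρ.map (Rat.cast : ℚ → ℂ))) →
      (descentAt (clearDen ρ) (initialLevel (clearDen ρ)) (initialScale (clearDen ρ))
        (numSteps (clearDen ρ))).flag = 1) ∧
    (¬ HasNonsingular (imageSpace (ρ.map (Rat.cast : ℚ → ℂ))) →
      (descentAt (clearDen ρ) (initialLevel (clearDen ρ)) (initialScale (clearDen ρ))
        (numSteps (clearDen ρ))).flag = 0) := by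
  have hσ := posSemidef_clearDen ρ hρ
  have hτ := one_le_intTrace hσ
  have hd : ((commonDen ρ : ℤ) : ℂ) ≠ 0 := by exact_mod_cast (commonDen_pos ρ).ne'
  constructor
  · intro hns
    refine flag_of_hasNonsingular hσ hN le_rfl (ℓ := Nat.clog 2 (intTrace (clearDen ρ)).toNat)
      ?_ rfl ?_
    · have := Nat.le_pow_clog (by norm_num : 1 < 2) (intTrace (clearDen ρ)).toNat
      zify at this
      rwa [Int.toNat_of_nonneg (by omega)] at this
    · rw [map_clearDen, imageSpace_smul hd]
      exact hns
  · intro hns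
    -- A nonzero flag would certify rank non-decrease of the integral multiple of ρ, hence of ρ, and
    -- the Edmonds–Rado property would produce a nonsingular matrix.
    by_contra hf
    have hr := rankNonDecreasing_of_flag hσ hN (W := initialScale (clearDen ρ))
      (L := numSteps (clearDen ρ)) le_rfl hf
    rw [map_clearDen] at hr
    exact hns (h.mpr (rankNonDecreasing_of_smul hr))

theorem numSteps_clearDen_le {N : ℕ} (ρ : Bipartite N ℚ) :
    numSteps (clearDen ρ) ≤ 300 * inputSize ρ ^ 4 * (4 * inputSize ρ + 2) := by
  have h1 : N ≤ inputSize ρ := Nat.le_add_right _ _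
  have h2 : Nat.clog 2 (intTrace (clearDen ρ)).toNat ≤ 4 * inputSize ρ + 1 := by
    refine Nat.clog_le_of_le_pow ?_
    have := intTrace_clearDen_le ρ
    have h3 : (intTrace (clearDen ρ)).toNat ≤ ((2 : ℤ) ^ (4 * inputSize ρ + 1)).toNat :=
      Int.toNat_le_toNat this
    refine h3.trans (le_of_eq ?_)
    exact_mod_cast Int.toNat_natCast (2 ^ (4 * inputSize ρ + 1))
  rw [numSteps]
  exact Nat.mul_le_mul (Nat.mul_le_mul_left _ (Nat.pow_le_pow_left h1 4)) (by omega)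

theorem exists_polynomial_time_program :
    ∃ (prog : Prog) (time : Polynomial ℕ), ∀ (N : ℕ), 1 ≤ N →
      ∀ ρ : Bipartite N ℚ,
      (ρ.map (Rat.cast : ℚ → ℂ)).PosSemidef →
      EdmondsRado (ρ.map (Rat.cast : ℚ → ℂ)) →
      ∃ (m : Memory) (t : ℕ),
        Run prog (inputMemory ρ) m t ∧
        t ≤ time.eval (inputSize ρ) ∧
        (HasNonsingular (imageSpace (ρ.map (Rat.cast : ℚ → ℂ))) → m 0 0 = 1) ∧
        (¬ HasNonsingular (imageSpace (ρ.map (Rat.cast : ℚ → ℂ))) → m 0 0 = 0) := by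
  obtain ⟨K, hK⟩ := exec_edmonds
  set steps : Polynomial ℕ := 300 * Polynomial.X ^ 4 * (4 * Polynomial.X + 2) with hsteps
  -- The number of word operations times the word length plus one; both are polynomial because the
  -- number of steps is.
  refine ⟨edmondsProg, (K : Polynomial ℕ) * ((Polynomial.X + 1) ^ 4 * (steps + 1)) *
    (14 * (10 * Polynomial.X + 13 + 2 * steps) + 3 + 1), fun N hN ρ hρ hER => ?_⟩
  obtain ⟨m, ⟨t, hrun, ht⟩, hm⟩ := hK hN hρ
  have hflag := hasNonsingular_iff_flag hN hρ hER
  refine ⟨m, t, hrun, ht.trans ?_, fun h => hm.trans (hflag.1 h), fun h => hm.trans (hflag.2 h)⟩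
  have hL := numSteps_clearDen_le ρ
  have hs : steps.eval (inputSize ρ) = 300 * inputSize ρ ^ 4 * (4 * inputSize ρ + 2) := by
    rw [hsteps]
    simp
  have hNs : N ≤ inputSize ρ := Nat.le_add_right _ _
  simp only [Polynomial.eval_mul, Polynomial.eval_add, Polynomial.eval_pow, Polynomial.eval_X,
    Polynomial.eval_one, Polynomial.eval_natCast, Polynomial.eval_ofNat, hs]
  rw [dataBits]
  gcongr
  simp

end OperatorScaling

theorem mainTheorem1 :
    -- iteration bound and arithmetic cost
    (∃ (C : ℝ) (K : ℕ), ∀ (N : ℕ), 1 ≤ N →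
      ∀ (ρ : Bipartite N ℤ) (M : ℕ),
      (ρ.map (Int.cast : ℤ → ℂ)).PosSemidef →
      (∀ p q, |ρ p q| ≤ (M : ℤ)) →
      EdmondsRado (ρ.map (Int.cast : ℤ → ℂ)) →
      -- nonsingular matrix present: the scaling runs and is fast
      (HasNonsingular (imageSpace (ρ.map (Int.cast : ℤ → ℂ))) →
        Scalable (opOfChoi (ρ.map (Int.cast : ℤ → ℂ))) ∧
        ∃ n : ℕ, (n : ℝ) ≤ C * (N * (N * Real.log N + N * Real.log M)) ∧
          DS (osi
            (opOfChoi (ρ.map (Int.cast : ℤ → ℂ))) n) ≤ 1 / (N : ℝ)) ∧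
      -- conversely, the scaling never gets there unless a nonsingular matrix is present
      (Scalable (opOfChoi (ρ.map (Int.cast : ℤ → ℂ))) →
        ∀ n : ℕ, DS (osi
            (opOfChoi (ρ.map (Int.cast : ℤ → ℂ))) n) ≤ 1 / (N : ℝ) →
          HasNonsingular
            (imageSpace (ρ.map (Int.cast : ℤ → ℂ)))) ∧
      -- the rational algorithm carries out the scaling
      (Scalable (opOfChoi (ρ.map (Int.cast : ℤ → ℂ))) →
        ∀ n : ℕ, ∃ s : ScalingState N,
          stateAt (ρ.map (Int.cast : ℤ → ℚ)) n = some s ∧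
          (((iteration (ρ.map (Int.cast : ℤ → ℚ)) n s).val.1 : ℚ) : ℝ) =
            DS (osi
              (opOfChoi (ρ.map (Int.cast : ℤ → ℂ))) n)) ∧
      -- rational operations of one iteration: `O(N³)` besides one evaluation each of `T` and `T*`
      (∀ (n : ℕ) (s : ScalingState N),
        (iteration (ρ.map (Int.cast : ℤ → ℚ)) n s).ops ≤ K * N ^ 3 +
          (applyOp (ρ.map (Int.cast : ℤ → ℚ)) s.Q).ops +
          (applyDual (ρ.map (Int.cast : ℤ → ℚ)) s.P).ops) ∧
      (∀ X : Matrix (Fin N) (Fin N) ℚ,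
        (applyOp (ρ.map (Int.cast : ℤ → ℚ)) X).ops ≤ K * N ^ 4 ∧
        (applyDual (ρ.map (Int.cast : ℤ → ℚ)) X).ops ≤ K * N ^ 4) ∧
      -- the decision procedure is correct, and its number of rational operations
      (∀ L : ℕ, C * (N * (N * Real.log N + N * Real.log M)) ≤ (L : ℝ) →
        ((decideEdmonds (ρ.map (Int.cast : ℤ → ℚ)) L).val = true ↔
          HasNonsingular
            (imageSpace (ρ.map (Int.cast : ℤ → ℂ)))) ∧
        (decideEdmonds (ρ.map (Int.cast : ℤ → ℚ)) L).ops ≤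
          (L + 1) * (K * N ^ 4))) ∧
    -- deterministic polynomial time in the bit model
    (∃ (prog : Prog) (time : Polynomial ℕ), ∀ (N : ℕ), 1 ≤ N →
      ∀ ρ : Bipartite N ℚ,
      (ρ.map (Rat.cast : ℚ → ℂ)).PosSemidef →
      EdmondsRado (ρ.map (Rat.cast : ℚ → ℂ)) →
      ∃ (m : Memory) (t : ℕ),
        Run prog (inputMemory ρ) m t ∧
        t ≤ time.eval (inputSize ρ) ∧
        (HasNonsingular
          (imageSpace (ρ.map (Rat.cast : ℚ → ℂ))) → m 0 0 = 1) ∧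
        (¬ HasNonsingular
          (imageSpace (ρ.map (Rat.cast : ℚ → ℂ))) → m 0 0 = 0)) := by
  exact ⟨scaling_iteration_bound, exists_polynomial_time_program⟩
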